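/- Let $V$ be an $n$-dimensional Euclidean space with inner product $(\cdot\mid\cdot)$ and let $\Phi\subset V$ be a (not necessarily crystallographic) root system: a finite set of nonzero vectors such that, for every $\alpha\in\Phi$, $\Phi\cap\mathbb{R}\alpha=\{\alpha,-\alpha\}$ and $\Phi$ is stable under the orthogonal reflection in $\alpha^{\perp}$. Let $\Delta=\{\alpha_1,\dots,\alpha_n\}\subseteq\Phi$ be a choice of simple roots, that is, a basis of $V$ such that every root is a linear combination of $\alpha_1,\dots,\alpha_n$ with coefficients all $\ge 0$ or all $\le 0$. Let $\Phi^+=\{\beta\in\Phi \mid \beta=\sum_i c_i\alpha_i,\ c_i\in\mathbb{R}_{\ge 0}\}$ be the set of positive roots, partially ordered by $\beta\le\gamma$ if $\gamma-\beta=\sum_i c_i\alpha_i$ with all $c_i\in\mathbb{R}_{\ge 0}$. A subset $I\subseteq\Phi^+$ is increasing if $\beta\in I$, $\gamma\in\Phi^+$ and $\beta\le\gamma$ imply $\gamma\in I$. Write $I^c=\Phi^+\setminus I$, let $I_{\min}$ be the set of minimal elements of $I$, and let $I^c_{\max}$ be the set of maximal elements of $I^c$. Let $C=\{v\in V\mid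 (v\mid\alpha_i)>0 \text{ for } 1\le i\le n\}$. For an increasing set $I$ and a subset $\Lambda\subseteq\Phi^+$ put $$R_I=\{v\in C\mid (v\mid\beta)>1\text{ for all }\beta\in I\text{ and }(v\mid\gamma)<1\text{ for all }\gamma\in I^c\},$$ $$\mathrm{Int}_C(\Lambda)=\{v\in C\mid (v\mid\beta)=1\text{ for all }\beta\in\Lambda\}.$$ **Theorem 3.1.** Let $I$ be a nonempty increasing set in $(\Phi^+,\le)$. (i) If there exists $v_0\in\mathrm{Int}_C(I_{\min})$ such that $(v_0\mid\gamma)<1$ for all $\gamma\in I^c_{\max}$, then $R_{I\setminus\Lambda}\neq\emptyset$ for all $\Lambda\subseteq I_{\min}$. (ii) If there exists $v_0\in\mathrm{Int}_C(I^c_{\max})$ such that $(v_0\mid\beta)>1$ for all $\beta\in I_{\min}$, then $R_{I\cup\Lambda}\neq\emptyset$ for all $\Lambda\subseteq I^c_{\max}$. **Corollary 3.2.** Let $I$ be a nonempty increasing set in $(\Phi^+,\le)$. Call an antichain in $\Phi^+$ $\subseteq$-maximal if it is not properly contained in another antichain in $\Phi^+$. (i) If $I_{\min}$ is a $\subseteq$-maximal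 antichain and $\mathrm{Int}_C(I_{\min})\neq\emptyset$, then $R_{I\setminus\Lambda}\neq\emptyset$ for all $\Lambda\subseteq I_{\min}$. (ii) If $I^c_{\max}$ is a $\subseteq$-maximal antichain and $\mathrm{Int}_C(I^c_{\max})\neq\emptyset$, then $R_{I\cup\Lambda}\neq\emptyset$ for all $\Lambda\subseteq I^c_{\max}$. -/

import Mathlib

open scoped RealInnerProductSpace

namespace DominantRegions

variable {V : Type*} [NormedAddCommGroup V] [InnerProductSpace ℝ V]

/-- A (reduced, not necessarily crystallographic) finite root system in a Euclidean space: a finite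
set of nonzero vectors that meets the line through each of its elements `α` in exactly `{α, -α}`
and that is stable under the orthogonal reflection in the hyperplane `α^⊥`. -/
structure IsRootSystem (Φ : Set V) : Prop where
  finite : Φ.Finite
  zero_notMem : (0 : V) ∉ Φ
  inter_line : ∀ α ∈ Φ, Φ ∩ (Submodule.span ℝ {α} : Submodule ℝ V) = {α, -α}
  reflection_image : ∀ α ∈ Φ, ((Submodule.span ℝ {α})ᗮ).reflection '' Φ = Φ

/-- The basis `α 0, …, α (n - 1)` of `V` consists of simple roots of `Φ`: each `α i` is a root, and
each root is a linear combination of the `α i` with coefficients all of the same sign. -/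
structure IsSimpleSystem (Φ : Set V) {n : ℕ} (α : Module.Basis (Fin n) ℝ V) : Prop where
  mem : ∀ i, α i ∈ Φ
  same_sign : ∀ β ∈ Φ, ∃ c : Fin n → ℝ, β = ∑ i, c i • α i ∧ ((∀ i, 0 ≤ c i) ∨ ∀ i, c i ≤ 0)

/-- The set `Φ⁺` of positive roots, as a type. -/
def PosRoot (Φ : Set V) {n : ℕ} (α : Module.Basis (Fin n) ℝ V) : Type _ :=
  {β : V // β ∈ Φ ∧ ∃ c : Fin n → ℝ, (∀ i, 0 ≤ c i) ∧ β = ∑ i, c i • α i}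

variable {Φ : Set V} {n : ℕ} {α : Module.Basis (Fin n) ℝ V}

/-- The vector underlying a positive root. -/
def PosRoot.vec (β : PosRoot Φ α) : V := β.1

/-- The root order: `β ≤ γ` if `γ - β` is a nonnegative real combination of the simple roots. -/
instance : PartialOrder (PosRoot Φ α) where
  le β γ := ∃ c : Fin n → ℝ, (∀ i, 0 ≤ c i) ∧ γ.vec - β.vec = ∑ i, c i • α i
  le_refl β := ⟨0, by simp, by simp⟩
  le_trans β γ δ := by
    rintro ⟨c, hc, h⟩ ⟨d, hd, h'⟩
    refine ⟨c + d, fun i => add_nonneg (hc i) (hd i), ?_⟩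
    simp only [Pi.add_apply, add_smul, Finset.sum_add_distrib, ← h, ← h']
    abel
  le_antisymm β γ := by
    rintro ⟨c, hc, h⟩ ⟨d, hd, h'⟩
    have hsum : ∑ i, (c i + d i) • α i = 0 := by
      simp only [add_smul, Finset.sum_add_distrib, ← h, ← h']
      abel
    have hz := Fintype.linearIndependent_iff.1 α.linearIndependent _ hsum
    have hc0 : ∀ i, c i = 0 := fun i => by linarith [hz i, hc i, hd i]
    simp only [hc0, zero_smul, Finset.sum_const_zero] at h
    exact Subtype.ext (sub_eq_zero.1 h).symm

/-- The dominant chamber `C`. -/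
def chamber {n : ℕ} (α : Module.Basis (Fin n) ℝ V) : Set V := {v | ∀ i, 0 < ⟪v, α i⟫}

/-- The set `R_I`; the complement of `I` is taken in `Φ⁺`. -/
def region (I : Set (PosRoot Φ α)) : Set V :=
  {v | v ∈ chamber α ∧ (∀ β ∈ I, 1 < ⟪v, β.vec⟫) ∧ ∀ γ ∈ Iᶜ, ⟪v, γ.vec⟫ < 1}

/-- The set `Int_C(Λ)` of points `v` of the dominant chamber with `(v | β) = 1` for all `β ∈ Λ`. -/
def intC (Λ : Set (PosRoot Φ α)) : Set V :=
  {v | v ∈ chamber α ∧ ∀ β ∈ Λ, ⟪v, β.vec⟫ = 1}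

/-- The set `I_min` of minimal elements of `I`. -/
def minSet (I : Set (PosRoot Φ α)) : Set (PosRoot Φ α) := {β | Minimal (· ∈ I) β}

/-- The set `I^c_max` of maximal elements of the complement of `I` in `Φ⁺`. -/
def maxCompl (I : Set (PosRoot Φ α)) : Set (PosRoot Φ α) := {γ | Maximal (· ∈ Iᶜ) γ}

/-- `Λ` is an antichain in `Φ⁺` that is contained in no larger antichain. -/
def IsMaximalAntichain (Λ : Set (PosRoot Φ α)) : Prop :=
  Maximal (fun Λ' : Set (PosRoot Φ α) => IsAntichain (· ≤ ·) Λ') Λ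

end DominantRegions

/-! Everything rests on one fact, `linearIndependent_vec`: for a point v of the dominant chamber,
the positive roots β with (v | β) = 1 are linearly independent. Inner products with these roots can
then be prescribed as ±1 by some vector u. For small ε > 0 the point v + εu lies on chosen sides of
all level-one hyperplanes through v and stays on the old side of the others (`region_nonempty`).
Monotonicity of (v | ·) in the root order shows that I \ Λ or I ∪ Λ is an admissible choice. A
maximal antichain makes every root comparable to a level-one root, which supplies the strict
inequalities of the theorem.

For independence, normalise the roots to a set R of unit vectors. Level one becomes f u = lam u,
where f = (v | ·) has no zero on R and lam, the inverse length, is invariant under reflections. If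
the reflection in d ∈ R carried u to a different w of the same level set, then f u = f w would force
f d = 0; so this never happens (`eq_of_refl_eq`). In a plane section of R, which is dihedral of some
order M, this becomes a parity condition on the positions of two level elements and excludes the
angle of 60 degrees.

Suppose the level set is dependent and take a circuit A, a minimal dependent subset. Parity gives at
least four elements (`IsCircuit.four_le_card`). A circuit is connected under non-orthogonality, so
it spans an irreducible situation of rank at least three, and the relevant planes have order at most
five (`plane_order_le_five`). This leaves few inner products.

Angles of 45 or 135 degrees (types B and F) are removed by a count: A is described by a maximal
orthonormal frame, and cannot have more elements than the frame, whereas a circuit has one more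
element than the dimension of its span (`IsCircuit.inner_sq_ne_half`).

Otherwise twice the inner products are golden integers, and lam is constant on A, so the
coefficients of any relation sum to zero. Gram determinants of independent roots are positive and
stay so under √5 ↦ -√5 (`conjVal_det_pos`). Since f is positive on A, some inner product is
positive, hence equals (φ - 1) / 2. Growing A from that edge is a finite search (`no_four_circuit`,
`five_circuit_cases`). Its only survivors contain a path which produces a root killed by f
(`false_of_path`). -/

namespace DominantRegions

/-! ### Unit root sets, level sets and their plane sections -/

section UnitRoots

variable {V : Type*} [NormedAddCommGroup V] [InnerProductSpace ℝ V]

/-- The orthogonal reflection in the hyperplane orthogonal to the unit vector `u`. -/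
def refl (u w : V) : V := w - (2 * ⟪u, w⟫) • u

/-- A finite set of unit vectors stable under the reflections in its elements. -/
structure IsUnitRootSet (R : Set V) : Prop where
  finite : R.Finite
  inner_self : ∀ u ∈ R, ⟪u, u⟫ = 1
  refl_mem : ∀ u ∈ R, ∀ w ∈ R, refl u w ∈ R

/-- A linear functional `f` without zeros on `R` together with a positive reflection invariant
function `lam` on `R`. -/
structure IsLevel (R : Set V) (f : V →ₗ[ℝ] ℝ) (lam : V → ℝ) : Prop where
  ne_zero : ∀ u ∈ R, f u ≠ 0
  pos : ∀ u ∈ R, 0 < lam u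
  lam_refl : ∀ u ∈ R, ∀ w ∈ R, lam (refl u w) = lam w

/-- The set of elements of `R` on which `f` and `lam` agree. -/
def levelSet (R : Set V) (f : V →ₗ[ℝ] ℝ) (lam : V → ℝ) : Set V := {u | u ∈ R ∧ f u = lam u}

variable {R : Set V} {f : V →ₗ[ℝ] ℝ} {lam : V → ℝ}

theorem refl_self {u : V} (hu : ⟪u, u⟫ = 1) : refl u u = -u := by
  rw [refl, hu]; module

theorem inner_refl (u w z : V) : ⟪refl u w, z⟫ = ⟪w, z⟫ - 2 * ⟪u, w⟫ * ⟪u, z⟫ := by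
  rw [refl, inner_sub_left, real_inner_smul_left]

theorem IsUnitRootSet.neg_mem (hR : IsUnitRootSet R) {u : V} (hu : u ∈ R) : -u ∈ R := by
  rw [← refl_self (hR.inner_self u hu)]; exact hR.refl_mem u hu u hu

theorem IsLevel.lam_neg (h : IsLevel R f lam) (hR : IsUnitRootSet R) {u : V} (hu : u ∈ R) :
    lam (-u) = lam u := by
  rw [← refl_self (hR.inner_self u hu)]; exact h.lam_refl u hu u hu

theorem eq_of_inner_eq_one {u w : V} (hu : ⟪u, u⟫ = 1) (hw : ⟪w, w⟫ = 1) (h : ⟪u, w⟫ = 1) :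
    u = w := by
  have : ⟪u - w, u - w⟫ = 0 := by
    rw [inner_sub_left, inner_sub_right, inner_sub_right, real_inner_comm u w, hu, hw, h]
    norm_num
  exact sub_eq_zero.1 (inner_self_eq_zero.1 this)

/-- Two distinct elements of the level set are not interchanged by a reflection in `R`. -/
theorem eq_of_refl_eq (h : IsLevel R f lam) {u w d : V} (hu : u ∈ levelSet R f lam)
    (hw : w ∈ levelSet R f lam) (hd : d ∈ R) (hrefl : refl d u = w) : u = w := by
  have h1 : lam w = lam u := by rw [← hrefl]; exact h.lam_refl d hd u hu.1
  -- Invariance of `lam` equates the values of `f`, so the reflection can only have moved `u` by a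
  -- multiple of `d` on which `f` vanishes.
  have h2 : f w = f u := by rw [hw.2, hu.2, h1]
  have h3 : f w = f u - 2 * ⟪d, u⟫ * f d := by
    rw [← hrefl, refl, map_sub, map_smul, smul_eq_mul]
  have h4 : ⟪d, u⟫ = 0 := by
    have : ⟪d, u⟫ * f d = 0 := by linarith
    exact (mul_eq_zero.1 this).resolve_right (h.ne_zero d hd)
  rw [← hrefl, refl, h4]; simp

theorem not_neg_mem_levelSet (h : IsLevel R f lam) (hR : IsUnitRootSet R) {u : V}
    (hu : u ∈ levelSet R f lam) : -u ∉ levelSet R f lam := by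
  intro hn
  have h1 := hn.2
  rw [map_neg, h.lam_neg hR hu.1, hu.2] at h1
  linarith [h.pos u hu.1]

/-- Two elements of the level set do not form an angle of 60 degrees. -/
theorem inner_ne_half (h : IsLevel R f lam) (hR : IsUnitRootSet R) {u w : V}
    (hu : u ∈ levelSet R f lam) (hw : w ∈ levelSet R f lam) : ⟪u, w⟫ ≠ 1 / 2 := by
  intro hi
  have hd : refl u w ∈ R := hR.refl_mem u hu.1 w hw.1
  have huu := hR.inner_self u hu.1
  -- At 60 degrees w - u is itself a root, and its reflection exchanges u and w.
  have key : refl (refl u w) u = w := by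
    have h1 : refl u w = w - u := by rw [refl, hi]; module
    rw [h1, refl, inner_sub_left, real_inner_comm, hi, huu]; module
  have := eq_of_refl_eq h hu hw hd key
  subst this
  rw [huu] at hi; norm_num at hi

/-- The unit vector at angle `θ` in the plane with orthonormal basis `u, e`. -/
noncomputable def dir (u e : V) (θ : ℝ) : V := Real.cos θ • u + Real.sin θ • e

theorem inner_dir (u e x : V) (θ : ℝ) :
    ⟪dir u e θ, x⟫ = Real.cos θ * ⟪u, x⟫ + Real.sin θ * ⟪e, x⟫ := by
  rw [dir, inner_add_left, real_inner_smul_left, real_inner_smul_left]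

theorem inner_dir_dir {u e : V} (hu : ⟪u, u⟫ = 1) (he : ⟪e, e⟫ = 1) (hue : ⟪u, e⟫ = 0) (θ η : ℝ) :
    ⟪dir u e θ, dir u e η⟫ = Real.cos (θ - η) := by
  have hu' : ⟪u, dir u e η⟫ = Real.cos η := by
    rw [real_inner_comm, inner_dir, hu, real_inner_comm, hue]; ring
  have he' : ⟪e, dir u e η⟫ = Real.sin η := by
    rw [real_inner_comm, inner_dir, he, hue]; ring
  rw [inner_dir, hu', he', Real.cos_sub]

/-- On angles the reflection is η ↦ 2θ - η + π; the shift by π is kept as a sign, to be absorbed by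
stability of `R` under negation. -/
theorem refl_dir {u e : V} (hu : ⟪u, u⟫ = 1) (he : ⟪e, e⟫ = 1) (hue : ⟪u, e⟫ = 0) (θ η : ℝ) :
    refl (dir u e θ) (dir u e η) = -dir u e (2 * θ - η) := by
  rw [refl, inner_dir_dir hu he hue]
  have h1 : Real.cos (2 * θ - η) = 2 * Real.cos (θ - η) * Real.cos θ - Real.cos η := by
    have := Real.cos_add θ (θ - η)
    have h2 := Real.cos_sub θ (θ - η)
    rw [show θ + (θ - η) = 2 * θ - η by ring] at this
    rw [show θ - (θ - η) = η by ring] at h2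
    linarith
  have h2 : Real.sin (2 * θ - η) = 2 * Real.cos (θ - η) * Real.sin θ - Real.sin η := by
    have := Real.sin_add θ (θ - η)
    have h2 := Real.sin_sub θ (θ - η)
    rw [show θ + (θ - η) = 2 * θ - η by ring] at this
    rw [show θ - (θ - η) = η by ring] at h2
    linarith
  simp only [dir, h1, h2]
  module

theorem dir_add_pi (u e : V) (θ : ℝ) : dir u e (θ + Real.pi) = -dir u e θ := by
  simp only [dir, Real.cos_add_pi, Real.sin_add_pi]; module

/-- A set of reals that contains `0` and a positive `p`, that is closed under `2 * x - y` and that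
has only finitely many elements in `(0, p]` consists of the integral multiples of some `p / M`. -/
theorem exists_multiples_of_closed {S : Set ℝ} {p : ℝ} (hp : 0 < p) (hpS : p ∈ S) (h0 : (0 : ℝ) ∈ S)
    (hcl : ∀ x ∈ S, ∀ y ∈ S, 2 * x - y ∈ S) (hfin : (S ∩ Set.Ioc 0 p).Finite) :
    ∃ M : ℕ, 0 < M ∧ ∀ x, x ∈ S ↔ ∃ k : ℤ, x = k * (p / M) := by
  -- The generator is the least positive element d. Only translations by 2d are immediate, so
  -- elements are reduced modulo 2d to a remainder of absolute value at most d, which minimality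
  -- forces to be 0 or d.
  obtain ⟨d, ⟨hdS, hd0, hdp⟩, hmin⟩ :=
    Set.exists_min_image _ id hfin ⟨p, hpS, hp, le_rfl⟩
  have hneg : ∀ y ∈ S, -y ∈ S := fun y hy => by simpa using hcl 0 h0 y hy
  have hadd : ∀ x ∈ S, ∀ y ∈ S, y + 2 * x ∈ S := fun x hx y hy => by
    have := hcl x hx (-y) (hneg y hy)
    rwa [show 2 * x - -y = y + 2 * x by ring] at this
  have hk : ∀ (k : ℤ) (y : ℝ), y ∈ S → y + k * (2 * d) ∈ S := by
    intro k
    induction k using Int.induction_on with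
    | zero => intro y hy; simpa using hy
    | succ n ih =>
      intro y hy
      have := hadd d hdS _ (ih y hy)
      convert this using 1; push_cast; ring
    | pred n ih =>
      intro y hy
      have := hadd (-d) (hneg d hdS) _ (ih y hy)
      convert this using 1; push_cast; ring
  have hmul : ∀ x, x ∈ S ↔ ∃ k : ℤ, x = k * d := by
    intro x
    constructor
    · intro hx
      have h2d : 0 < 2 * d := by linarith
      set q : ℤ := round (x / (2 * d)) with hq
      have hb := abs_sub_round (x / (2 * d))
      rw [← hq] at hb
      have hb' : |x - q * (2 * d)| ≤ d := by
        have : x - q * (2 * d) = (x / (2 * d) - q) * (2 * d) := by field_simp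
        rw [this, abs_mul, abs_of_pos h2d]
        nlinarith
      have hr : x - q * (2 * d) ∈ S := by
        have := hk (-q) x hx
        convert this using 1; push_cast; ring
      have hr' : |x - q * (2 * d)| ∈ S := by
        rcases abs_choice (x - q * (2 * d)) with h | h <;> rw [h]
        · exact hr
        · exact hneg _ hr
      rcases (abs_nonneg (x - q * (2 * d))).eq_or_lt with h | h
      · refine ⟨2 * q, ?_⟩
        have := abs_eq_zero.1 h.symm
        push_cast; linarith
      · have hge := hmin _ ⟨hr', h, hb'.trans hdp⟩
        simp only [id] at hge
        have heq := le_antisymm hb' hge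
        rcases abs_choice (x - q * (2 * d)) with h' | h'
        · exact ⟨2 * q + 1, by push_cast; linarith⟩
        · exact ⟨2 * q - 1, by push_cast; linarith⟩
    · rintro ⟨k, rfl⟩
      rcases Int.even_or_odd' k with ⟨j, rfl | rfl⟩
      · have := hk j 0 h0
        convert this using 1; push_cast; ring
      · have := hk j d hdS
        convert this using 1; push_cast; ring
  obtain ⟨m, hm⟩ := (hmul p).1 hpS
  have hmpos : 0 < m := by
    have : (0 : ℝ) < m := by
      by_contra hcon
      nlinarith
    exact_mod_cast this
  refine ⟨m.toNat, by omega, fun x => ?_⟩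
  have hcast : ((m.toNat : ℕ) : ℝ) = (m : ℝ) := by
    have : ((m.toNat : ℕ) : ℤ) = m := Int.toNat_of_nonneg hmpos.le
    exact_mod_cast this
  have hd : p / (m.toNat : ℕ) = d := by
    rw [hcast, hm]
    have : (m : ℝ) ≠ 0 := by exact_mod_cast hmpos.ne'
    field_simp
  rw [hd]; exact hmul x

/-- The elements of `R` in a plane through `u ∈ R` are regularly spaced. -/
theorem exists_plane_order (hR : IsUnitRootSet R) {u e : V} (hu : u ∈ R) (he : ⟪e, e⟫ = 1)
    (hue : ⟪u, e⟫ = 0) :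
    ∃ M : ℕ, 0 < M ∧ ∀ θ, dir u e θ ∈ R ↔ ∃ k : ℤ, θ = k * (Real.pi / M) := by
  have huu := hR.inner_self u hu
  have hd0 : dir u e 0 = u := by simp [dir]
  refine exists_multiples_of_closed (S := {θ | dir u e θ ∈ R}) Real.pi_pos ?_ ?_ ?_ ?_
  · have := dir_add_pi u e 0
    rw [zero_add, hd0] at this
    change dir u e Real.pi ∈ R
    rw [this]
    exact hR.neg_mem hu
  · simpa [hd0] using hu
  · intro x hx y hy
    have := hR.refl_mem _ hx _ hy
    rw [refl_dir huu he hue] at this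
    simpa using hR.neg_mem this
  · refine Set.Finite.of_finite_image (f := dir u e) (hR.finite.subset ?_) ?_
    · rintro _ ⟨θ, hθ, rfl⟩; exact hθ.1
    -- The inner product with u recovers the cosine, which is injective on (0, π]; thus finiteness
    -- of `R` bounds the set of angles there.
    · intro x hx y hy hxy
      have h1 : ⟪dir u e x, u⟫ = ⟪dir u e y, u⟫ := by rw [hxy]
      simp only [inner_dir, huu, real_inner_comm u e, hue] at h1
      have h2 : Real.cos x = Real.cos y := by linarith
      exact Real.injOn_cos ⟨hx.2.1.le, hx.2.2⟩ ⟨hy.2.1.le, hy.2.2⟩ h2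

/-- The plane spanned by two non-parallel unit vectors has an orthonormal basis starting with the
first of them. -/
theorem exists_dir_eq {u w : V} (hu : ⟪u, u⟫ = 1) (hw : ⟪w, w⟫ = 1) (h1 : u ≠ w) (h2 : u ≠ -w) :
    ∃ e : V, ⟪e, e⟫ = 1 ∧ ⟪u, e⟫ = 0 ∧ w = dir u e (Real.arccos ⟪u, w⟫) ∧
      e ∈ Submodule.span ℝ {u, w} ∧ |⟪u, w⟫| < 1 := by
  set c := ⟪u, w⟫ with hc
  set z := w - c • u with hz
  have hzz : ⟪z, z⟫ = 1 - c ^ 2 := by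
    rw [hz, inner_sub_left, inner_sub_right, inner_sub_right, real_inner_smul_left,
      real_inner_smul_left, real_inner_smul_right, real_inner_smul_right, real_inner_comm u w, hu,
      hw, ← hc]
    ring
  have huz : ⟪u, z⟫ = 0 := by
    rw [hz, inner_sub_right, real_inner_smul_right, hu, ← hc]; ring
  have hpos : 0 < 1 - c ^ 2 := by
    rcases (real_inner_self_nonneg (x := z)).eq_or_lt with h | h
    · exfalso
      have hsq : c ^ 2 = 1 := by linarith
      rcases sq_eq_sq_iff_eq_or_eq_neg.1 (hsq.trans (one_pow 2).symm) with h' | h'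
      · exact h1 (eq_of_inner_eq_one hu hw h')
      · exact h2 (eq_of_inner_eq_one hu (by simpa using hw) (by rw [inner_neg_right, ← hc, h']; simp))
    · linarith
  set s := Real.sqrt (1 - c ^ 2) with hs
  have hspos : 0 < s := Real.sqrt_pos.2 hpos
  have hss : s ^ 2 = 1 - c ^ 2 := Real.sq_sqrt hpos.le
  have hcabs : |c| < 1 := by rw [← sq_lt_one_iff_abs_lt_one]; linarith
  refine ⟨s⁻¹ • z, ?_, ?_, ?_, ?_, hcabs⟩
  · rw [real_inner_smul_left, real_inner_smul_right, hzz, ← hss]; field_simp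
  · rw [real_inner_smul_right, huz, mul_zero]
  · rw [dir, Real.cos_arccos (abs_lt.1 hcabs).1.le (abs_lt.1 hcabs).2.le, Real.sin_arccos, ← hs,
      smul_smul, mul_inv_cancel₀ hspos.ne', hz]
    module
  · refine Submodule.smul_mem _ _ (Submodule.sub_mem _ ?_ (Submodule.smul_mem _ _ ?_)) <;>
      exact Submodule.subset_span (by simp)

end UnitRoots

end DominantRegions

namespace DominantRegions

/-! ### Cosines at multiples of π / M for M ≤ 5 -/

section Angles

open Real

/-- The doubled angle has period M in k, so each order leaves finitely many residues to evaluate. -/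
theorem cos_two_mul_div_eq_emod (k : ℤ) {M : ℕ} (hM : 0 < M) :
    cos (2 * (k * (π / M))) = cos (2 * (((k % M : ℤ) : ℝ) * (π / M))) := by
  have hM' : (M : ℝ) ≠ 0 := by exact_mod_cast hM.ne'
  have h : (k : ℝ) = ((k % M : ℤ) : ℝ) + M * ((k / M : ℤ) : ℝ) := by
    exact_mod_cast (Int.emod_add_mul_ediv k M).symm
  have : 2 * ((k : ℝ) * (π / M)) = 2 * (((k % M : ℤ) : ℝ) * (π / M)) +
      ((k / M : ℤ) : ℝ) * (2 * π) := by
    conv_lhs => rw [h]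
    field_simp
  rw [this, cos_add_int_mul_two_pi]

theorem cos_two_pi_div_five' : cos (2 * π / 5) = (goldenRatio - 1) / 2 := by
  have h : 2 * π / 5 = 2 * (π / 5) := by ring
  rw [h, cos_two_mul, cos_pi_div_five, goldenRatio]
  have := Real.sq_sqrt (show (0 : ℝ) ≤ 5 by norm_num)
  nlinarith

theorem cos_four_pi_div_five : cos (4 * π / 5) = -goldenRatio / 2 := by
  have h : 4 * π / 5 = π - π / 5 := by ring
  rw [h, cos_pi_sub, cos_pi_div_five, goldenRatio]
  ring

theorem cos_two_mul_div_five (k : ℤ) : cos (2 * (k * (π / (5 : ℕ)))) = 1 ∨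
    cos (2 * (k * (π / (5 : ℕ)))) = (goldenRatio - 1) / 2 ∨
    cos (2 * (k * (π / (5 : ℕ)))) = -goldenRatio / 2 := by
  rw [cos_two_mul_div_eq_emod k (by norm_num)]
  have h0 := Int.emod_nonneg k (show ((5 : ℕ) : ℤ) ≠ 0 by norm_num)
  have h1 := Int.emod_lt_of_pos k (show (0 : ℤ) < ((5 : ℕ) : ℤ) by norm_num)
  generalize k % ((5 : ℕ) : ℤ) = r at h0 h1
  have h1 : r < 5 := h1
  interval_cases r
  · left; simp
  · right; left; rw [← cos_two_pi_div_five']; congr 1; push_cast; ring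
  · right; right; rw [← cos_four_pi_div_five]; congr 1; push_cast; ring
  · right; right; rw [← cos_four_pi_div_five, ← cos_two_pi_sub]; congr 1; push_cast; ring
  · right; left; rw [← cos_two_pi_div_five', ← cos_two_pi_sub]; congr 1; push_cast; ring

theorem cos_two_mul_div_three (k : ℤ) : cos (2 * (k * (π / (3 : ℕ)))) = 1 ∨
    cos (2 * (k * (π / (3 : ℕ)))) = -1 / 2 := by
  rw [cos_two_mul_div_eq_emod k (by norm_num)]
  have h0 := Int.emod_nonneg k (show ((3 : ℕ) : ℤ) ≠ 0 by norm_num)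
  have h1 := Int.emod_lt_of_pos k (show (0 : ℤ) < ((3 : ℕ) : ℤ) by norm_num)
  generalize k % ((3 : ℕ) : ℤ) = r at h0 h1
  have h1 : r < 3 := h1
  have h3 : cos (π - π / 3) = -1 / 2 := by rw [cos_pi_sub, cos_pi_div_three]; ring
  interval_cases r
  · left; simp
  · right; rw [← h3]; congr 1; push_cast; ring
  · right; rw [← h3, ← cos_two_pi_sub]; congr 1; push_cast; ring

theorem cos_two_mul_div_two (k : ℤ) : (Even k ∧ cos (2 * (k * (π / (2 : ℕ)))) = 1) ∨
    (Odd k ∧ cos (2 * (k * (π / (2 : ℕ)))) = -1) := by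
  rw [cos_two_mul_div_eq_emod k (by norm_num)]
  rcases Int.even_or_odd k with h | h
  · left; refine ⟨h, ?_⟩
    have : k % ((2 : ℕ) : ℤ) = 0 := Int.even_iff.1 h
    rw [this]; simp
  · right; refine ⟨h, ?_⟩
    have : k % ((2 : ℕ) : ℤ) = 1 := Int.odd_iff.1 h
    rw [this, ← cos_pi]; congr 1; push_cast; ring

theorem cos_two_mul_div_four (k : ℤ) : (Even k ∧ (cos (2 * (k * (π / (4 : ℕ)))) = 1 ∨
    cos (2 * (k * (π / (4 : ℕ)))) = -1)) ∨ (Odd k ∧ cos (2 * (k * (π / (4 : ℕ)))) = 0) := by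
  rcases Int.even_or_odd' k with ⟨j, rfl | rfl⟩
  · left
    refine ⟨even_two_mul j, ?_⟩
    have h : 2 * (((2 * j : ℤ) : ℝ) * (π / (4 : ℕ))) = 2 * (j * (π / (2 : ℕ))) := by
      push_cast; ring
    rw [h]
    rcases cos_two_mul_div_two j with h | h
    · exact Or.inl h.2
    · exact Or.inr h.2
  · right
    refine ⟨⟨j, rfl⟩, ?_⟩
    rw [cos_eq_zero_iff]
    exact ⟨j, by push_cast; ring⟩

/-- The possible values of `4 * cos ^ 2` at the multiples of `π / M` for `M ≤ 5`. -/
def cosSqValues : Set ℝ := {0, 1, 2, 4, goldenRatio + 1, 2 - goldenRatio}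

/-- Since 4 cos² θ = 2 + 2 cos 2θ, the tables for doubled angles suffice. -/
theorem four_mul_cos_sq_mem {M : ℕ} (hM : 0 < M) (hM5 : M ≤ 5) (k : ℤ) :
    4 * cos (k * (π / M)) ^ 2 ∈ cosSqValues := by
  have h : 4 * cos (k * (π / M)) ^ 2 = 2 + 2 * cos (2 * (k * (π / M))) := by
    rw [cos_two_mul]; ring
  rw [h]
  interval_cases M
  · rw [cos_two_mul_div_eq_emod k (by norm_num)]
    simp [cosSqValues]; norm_num
  · rcases cos_two_mul_div_two k with h | h <;> rw [h.2] <;> norm_num [cosSqValues]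
  · rcases cos_two_mul_div_three k with h | h <;> rw [h] <;> norm_num [cosSqValues]
  · rcases cos_two_mul_div_four k with ⟨-, h | h⟩ | ⟨-, h⟩ <;> rw [h] <;> norm_num [cosSqValues]
  · rcases cos_two_mul_div_five k with h | h | h <;> rw [h]
    · norm_num [cosSqValues]
    · rw [show 2 + 2 * ((goldenRatio - 1) / 2) = goldenRatio + 1 by ring]; simp [cosSqValues]
    · rw [show 2 + 2 * (-goldenRatio / 2) = 2 - goldenRatio by ring]; simp [cosSqValues]

end Angles

/-! ### Dihedral planes: parity and the bound on the order -/

section Planes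

open Real

variable {V : Type*} [NormedAddCommGroup V] [InnerProductSpace ℝ V]
variable {R : Set V} {f : V →ₗ[ℝ] ℝ} {lam : V → ℝ}

theorem dir_zero (u e : V) : dir u e 0 = u := by simp [dir]

/-- Parity constraint on two elements of the level set in terms of their plane. -/
theorem odd_sub_add_of_mem_levelSet (h : IsLevel R f lam) {u e : V} {M : ℕ}
    (hM : 0 < M) (huu : ⟪u, u⟫ = 1) (he : ⟪e, e⟫ = 1) (hue : ⟪u, e⟫ = 0)
    (hS : ∀ θ, dir u e θ ∈ R ↔ ∃ k : ℤ, θ = k * (π / M)) {k l : ℤ}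
    (hl : dir u e (l * (π / M)) ∈ levelSet R f lam)
    (hk : dir u e (k * (π / M)) ∈ levelSet R f lam)
    (hne : dir u e (l * (π / M)) ≠ dir u e (k * (π / M))) :
    Odd (k - l + M) := by
  by_contra hcon
  obtain ⟨j, hj⟩ := Int.not_odd_iff_even.1 hcon
  have hM' : (M : ℝ) ≠ 0 := by exact_mod_cast hM.ne'
  -- With k - l + M = 2j, the reflection in the root at position j + l sends position l to 2(j + l)
  -- - l - M = k.
  have hd : dir u e (((j + l : ℤ) : ℝ) * (π / M)) ∈ R := (hS _).2 ⟨j + l, rfl⟩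
  refine hne (eq_of_refl_eq h hl hk hd ?_)
  rw [refl_dir huu he hue]
  have hj' : (k : ℝ) - l + M = j + j := by exact_mod_cast hj
  have h2 : 2 * (((j + l : ℤ) : ℝ) * (π / M)) - l * (π / M) = k * (π / M) + π := by
    have : (2 * (j + l) - l : ℝ) = k + M := by linarith
    calc 2 * (((j + l : ℤ) : ℝ) * (π / M)) - l * (π / M)
        = (2 * (j + l) - l) * (π / M) := by push_cast; ring
      _ = k * (π / M) + π := by rw [this]; field_simp
  rw [h2, dir_add_pi, neg_neg]

/-- The reflection in the root halfway between carries u to the negative of the root at position k,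
and `lam` ignores signs and reflections. -/
theorem lam_dir_of_even (hR : IsUnitRootSet R) (h : IsLevel R f lam) {u e : V} {M : ℕ}
    (he : ⟪e, e⟫ = 1) (hue : ⟪u, e⟫ = 0)
    (hS : ∀ θ, dir u e θ ∈ R ↔ ∃ k : ℤ, θ = k * (π / M)) (hu : u ∈ R) {k : ℤ} (hk : Even k) :
    lam (dir u e (k * (π / M))) = lam u := by
  obtain ⟨j, hj⟩ := hk
  have huu := hR.inner_self u hu
  have hd : dir u e (j * (π / M)) ∈ R := (hS _).2 ⟨j, rfl⟩
  have h1 := refl_dir huu he hue (j * (π / M)) 0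
  rw [dir_zero, show 2 * (j * (π / M)) - 0 = k * (π / M) by rw [hj]; push_cast; ring] at h1
  have h2 : dir u e (k * (π / M)) ∈ R := (hS _).2 ⟨k, rfl⟩
  rw [← h.lam_neg hR h2, ← h1, h.lam_refl _ hd _ hu]

/-- Irreducibility of a plane in a larger root system bounds its order. -/
theorem plane_order_le_five (hR : IsUnitRootSet R) {u e : V} {M : ℕ} (hM : 0 < M)
    (huu : ⟪u, u⟫ = 1) (he : ⟪e, e⟫ = 1) (hue : ⟪u, e⟫ = 0)
    (hS : ∀ θ, dir u e θ ∈ R ↔ ∃ k : ℤ, θ = k * (π / M)) {x : V} (hx : x ∈ R)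
    (h0 : ⟪u, x⟫ ^ 2 + ⟪e, x⟫ ^ 2 ≠ 0) (h1 : ⟪u, x⟫ ^ 2 + ⟪e, x⟫ ^ 2 < 1) : M ≤ 5 := by
  by_contra hM5
  set q : V → ℝ := fun y => ⟪u, y⟫ ^ 2 + ⟪e, y⟫ ^ 2 with hq
  have hfin : {y | y ∈ R ∧ q y ≠ 0 ∧ q y < 1}.Finite := hR.finite.subset fun y hy => hy.1
  -- Here q is the squared length of the projection to the plane. Among roots neither in the plane
  -- nor orthogonal to it, take y with the largest projection.
  obtain ⟨y, ⟨hyR, hy0, hy1⟩, hmax⟩ := Set.exists_max_image _ q hfin ⟨x, hx, h0, h1⟩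
  set a := ⟪u, y⟫ with ha
  set b := ⟪e, y⟫ with hb
  have hqy : q y = a ^ 2 + b ^ 2 := rfl
  have hqpos : 0 < q y := lt_of_le_of_ne (by rw [hqy]; positivity) (Ne.symm hy0)
  have heu : ⟪e, u⟫ = 0 := by rw [real_inner_comm, hue]
  -- Reflecting a plane root d in y gives projection length squared 1 - 4t²(1 - q y) with t = ⟪y,
  -- d⟫. For 0 < t² < 1/4 this lies strictly between q y and 1, against maximality.
  have key : ∀ k : ℤ, a * cos (k * (π / M)) + b * sin (k * (π / M)) ≠ 0 →
      1 / 4 ≤ (a * cos (k * (π / M)) + b * sin (k * (π / M))) ^ 2 := by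
    intro k hk
    set θ : ℝ := k * (π / M) with hθ
    have hd : dir u e θ ∈ R := (hS _).2 ⟨k, rfl⟩
    set t := a * cos θ + b * sin θ with ht
    have hyd : ⟪y, dir u e θ⟫ = t := by
      rw [real_inner_comm, inner_dir, ← ha, ← hb, ht]; ring
    have hz := hR.refl_mem y hyR _ hd
    have hzu : ⟪u, refl y (dir u e θ)⟫ = cos θ - 2 * t * a := by
      rw [real_inner_comm, inner_refl, hyd, inner_dir, huu, heu, real_inner_comm, ← ha]; ring
    have hze : ⟪e, refl y (dir u e θ)⟫ = sin θ - 2 * t * b := by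
      rw [real_inner_comm, inner_refl, hyd, inner_dir, he, hue, real_inner_comm, ← hb]; ring
    have hqz : q (refl y (dir u e θ)) = 1 - 4 * t ^ 2 * (1 - q y) := by
      simp only [hq] at *
      rw [hzu, hze, ← ha, ← hb]
      have := sin_sq_add_cos_sq θ
      have ht' : t = a * cos θ + b * sin θ := rfl
      calc (cos θ - 2 * t * a) ^ 2 + (sin θ - 2 * t * b) ^ 2
          = (sin θ ^ 2 + cos θ ^ 2) - 4 * t * (a * cos θ + b * sin θ)
            + 4 * t ^ 2 * (a ^ 2 + b ^ 2) := by ring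
        _ = 1 - 4 * t ^ 2 * (1 - (a ^ 2 + b ^ 2)) := by rw [this, ← ht']; ring
    by_contra hlt
    have hlt' : t ^ 2 < 1 / 4 := not_le.1 hlt
    have ht2 : 0 < t ^ 2 := by positivity
    have hpos1 : 0 < 1 - q y := by linarith
    have hne : q (refl y (dir u e θ)) ≠ 0 := by rw [hqz]; nlinarith
    have hlt1 : q (refl y (dir u e θ)) < 1 := by rw [hqz]; nlinarith
    have := hmax _ ⟨hz, hne, hlt1⟩
    rw [hqz] at this
    nlinarith
  -- write `(a, b)` in polar coordinates
  set z : ℂ := ⟨a, b⟩ with hz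
  have hzn : ‖z‖ ^ 2 = q y := by
    rw [← Complex.normSq_eq_norm_sq, Complex.normSq_mk, hqy]; ring
  have hzpos : 0 < ‖z‖ := by
    rcases (norm_nonneg z).eq_or_lt with h | h
    · rw [← h] at hzn; norm_num at hzn; linarith
    · exact h
  have hza : a = ‖z‖ * cos z.arg := by rw [Complex.norm_mul_cos_arg]
  have hzb : b = ‖z‖ * sin z.arg := by rw [Complex.norm_mul_sin_arg]
  have hcos : ∀ θ, a * cos θ + b * sin θ = ‖z‖ * cos (θ - z.arg) := by
    intro θ
    rw [cos_sub]
    conv_lhs => rw [hza, hzb]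
    ring
  have hMpos : (0 : ℝ) < M := by exact_mod_cast hM
  have hstep : 0 < π / M := div_pos pi_pos hMpos
  have hstep6 : π / M ≤ π / 6 := by
    apply div_le_div_of_nonneg_left pi_pos.le (by norm_num)
    exact_mod_cast (by omega : 6 ≤ M)
  -- For M ≥ 6 the spacing is at most 30 degrees, so some plane root makes an angle in [60°, 90°)
  -- with the projection of y. Its t is nonzero with t² ≤ q y / 4 < 1/4, contradicting `key`.
  set k : ℤ := ⌈(z.arg + π / 3) / (π / M)⌉ with hk
  have hk1 : z.arg + π / 3 ≤ k * (π / M) := (div_le_iff₀ hstep).1 (Int.le_ceil _)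
  have hk2 : k * (π / M) < z.arg + π / 3 + π / M := by
    have := Int.ceil_lt_add_one ((z.arg + π / 3) / (π / M))
    rw [← hk] at this
    have h2 := mul_lt_mul_of_pos_right this hstep
    rwa [add_mul, div_mul_cancel₀ _ hstep.ne', one_mul] at h2
  have hc0 : 0 < cos (k * (π / M) - z.arg) :=
    cos_pos_of_mem_Ioo ⟨by linarith [pi_pos], by linarith [pi_pos]⟩
  have hc1 : cos (k * (π / M) - z.arg) ≤ 1 / 2 := by
    rw [← cos_pi_div_three]
    exact cos_le_cos_of_nonneg_of_le_pi (by linarith [pi_pos]) (by linarith [pi_pos]) (by linarith)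
  have h4 := key k (by rw [hcos]; positivity)
  rw [hcos, mul_pow, hzn] at h4
  have : cos (k * (π / M) - z.arg) ^ 2 ≤ 1 / 4 := by nlinarith
  nlinarith

end Planes

end DominantRegions

namespace DominantRegions

/-! ### Circuits and their inner products -/

section Circuits

open Real

variable {V : Type*} [NormedAddCommGroup V] [InnerProductSpace ℝ V]
variable {R : Set V} {f : V →ₗ[ℝ] ℝ} {lam : V → ℝ} {A : Finset V}

/-- A minimal linearly dependent finite set of vectors. -/
structure IsCircuit (A : Finset V) : Prop where
  dependent : ¬ LinearIndepOn ℝ id (A : Set V)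
  indep : ∀ B ⊂ A, LinearIndepOn ℝ id (B : Set V)

theorem exists_isCircuit {L : Set V} (hL : L.Finite) (hdep : ¬ LinearIndepOn ℝ id L) :
    ∃ A : Finset V, (A : Set V) ⊆ L ∧ IsCircuit A := by
  classical
  obtain ⟨A, hAL, hA⟩ := exists_minimal_le_of_wellFoundedLT
    (fun A : Finset V => ¬ LinearIndepOn ℝ id (A : Set V)) hL.toFinset (by simpa using hdep)
  refine ⟨A, fun x hx => by simpa using hAL hx, hA.prop, fun B hB => ?_⟩
  by_contra hcon
  exact hA.not_prop_of_lt hB hcon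

/-- A vanishing coefficient would leave a nontrivial relation on a proper subset, so minimality
makes all coefficients nonzero. -/
theorem IsCircuit.exists_relation (hA : IsCircuit A) :
    ∃ c : V → ℝ, (∀ u ∈ A, c u ≠ 0) ∧ ∑ u ∈ A, c u • u = 0 := by
  classical
  have h := hA.dependent
  rw [linearIndepOn_finset_iff] at h
  push Not at h
  obtain ⟨c, hc, u, hu, hcu⟩ := h
  refine ⟨c, fun w hw hcw => ?_, by simpa using hc⟩
  have hB := linearIndepOn_finset_iff.1 (hA.indep _ (Finset.erase_ssubset hw)) c ?_
  · have huw : u ≠ w := fun h => hcu (h ▸ hcw)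
    exact hcu (hB u (Finset.mem_erase.2 ⟨huw, hu⟩))
  · have := Finset.add_sum_erase A (fun u => c u • id u) hw
    rw [hc, hcw] at this
    simpa using this

theorem IsCircuit.nonempty (hA : IsCircuit A) : A.Nonempty := by
  rw [Finset.nonempty_iff_ne_empty]
  rintro rfl
  exact hA.dependent (by simp)

/-- Connectedness: if S were orthogonal to the rest, the two parts of the relation would be
orthogonal and sum to zero, so the part on S would vanish, against independence of S. -/
theorem IsCircuit.exists_inner_ne_zero (hA : IsCircuit A) {S : Finset V} (hS : S ⊂ A)
    (hne : S.Nonempty) : ∃ s ∈ S, ∃ t ∈ A, t ∉ S ∧ ⟪s, t⟫ ≠ 0 := by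
  classical
  by_contra! hcon
  obtain ⟨c, hc0, hc⟩ := hA.exists_relation
  obtain ⟨s, hs⟩ := hne
  have hsplit : ∑ u ∈ S, c u • u + ∑ u ∈ A \ S, c u • u = 0 := by
    rw [add_comm, Finset.sum_sdiff hS.1, hc]
  have horth : ⟪∑ u ∈ S, c u • u, ∑ u ∈ A \ S, c u • u⟫ = 0 := by
    rw [sum_inner]
    refine Finset.sum_eq_zero fun x hx => ?_
    rw [inner_sum]
    refine Finset.sum_eq_zero fun y hy => ?_
    rw [real_inner_smul_left, real_inner_smul_right,
      hcon x hx y (Finset.mem_sdiff.1 hy).1 (Finset.mem_sdiff.1 hy).2]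
    ring
  have hzero : ∑ u ∈ S, c u • u = 0 := by
    rw [eq_neg_of_add_eq_zero_right hsplit, inner_neg_right, neg_eq_zero] at horth
    exact inner_self_eq_zero.1 horth
  exact hc0 s (hS.1 hs) (linearIndepOn_finset_iff.1 (hA.indep S hS) c (by simpa using hzero) s hs)

/-- Removing one element leaves an independent set with the same span, because that element has a
nonzero coefficient in the relation. -/
theorem IsCircuit.finrank_span (hA : IsCircuit A) :
    Module.finrank ℝ (Submodule.span ℝ (A : Set V)) + 1 = A.card := by
  classical
  obtain ⟨u, hu⟩ := hA.nonempty
  obtain ⟨c, hc0, hc⟩ := hA.exists_relation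
  have hspan : Submodule.span ℝ (A : Set V) = Submodule.span ℝ ((A.erase u : Finset V) : Set V) := by
    apply le_antisymm
    · rw [Submodule.span_le]
      intro w hw
      by_cases hwu : w = u
      · subst hwu
        have h1 := Finset.add_sum_erase A (fun u => c u • u) hu
        rw [hc] at h1
        have h2 : w = (c w)⁻¹ • (-∑ x ∈ A.erase w, c x • x) := by
          rw [← eq_neg_of_add_eq_zero_left h1, smul_smul, inv_mul_cancel₀ (hc0 w hu), one_smul]
        have h3 : (c w)⁻¹ • (-∑ x ∈ A.erase w, c x • x) ∈
            Submodule.span ℝ ((A.erase w : Finset V) : Set V) :=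
          Submodule.smul_mem _ _ (Submodule.neg_mem _ (Submodule.sum_mem _ fun x hx =>
            Submodule.smul_mem _ _ (Submodule.subset_span hx)))
        rwa [← h2] at h3
      · exact Submodule.subset_span (Finset.mem_coe.2 (Finset.mem_erase.2 ⟨hwu, hw⟩))
    · exact Submodule.span_mono (by simp)
  have hi : LinearIndepOn ℝ id ((A.erase u : Finset V) : Set V) :=
    hA.indep _ (Finset.erase_ssubset hu)
  have h1 : Module.finrank ℝ (Submodule.span ℝ ((A.erase u : Finset V) : Set V)) =
      (A.erase u).card := by
    exact finrank_span_finset_eq_card hi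
  rw [hspan, h1, Finset.card_erase_add_one hu]

/-- The squared distance from x to the plane is 1 minus the sum of the squared coordinates. -/
theorem inner_sq_add_inner_sq_le {u e x : V} (hu : ⟪u, u⟫ = 1) (he : ⟪e, e⟫ = 1)
    (hue : ⟪u, e⟫ = 0) (hx : ⟪x, x⟫ = 1) : ⟪u, x⟫ ^ 2 + ⟪e, x⟫ ^ 2 ≤ 1 ∧
      (⟪u, x⟫ ^ 2 + ⟪e, x⟫ ^ 2 = 1 → x = ⟪u, x⟫ • u + ⟪e, x⟫ • e) := by
  have key : ⟪x - (⟪u, x⟫ • u + ⟪e, x⟫ • e), x - (⟪u, x⟫ • u + ⟪e, x⟫ • e)⟫ =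
      1 - (⟪u, x⟫ ^ 2 + ⟪e, x⟫ ^ 2) := by
    simp only [inner_sub_left, inner_sub_right, inner_add_left, inner_add_right,
      real_inner_smul_left, real_inner_smul_right, hu, he, hue, hx, real_inner_comm u x,
      real_inner_comm e x, real_inner_comm u e]
    ring
  refine ⟨by linarith [real_inner_self_nonneg (x := x - (⟪u, x⟫ • u + ⟪e, x⟫ • e))], fun h => ?_⟩
  rw [h, sub_self, inner_self_eq_zero, sub_eq_zero] at key
  exact key

theorem exists_dir_of_sq_add_sq {u e : V} {a b : ℝ} (h : a ^ 2 + b ^ 2 = 1) :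
    ∃ θ, a • u + b • e = dir u e θ := by
  have hn : ‖(⟨a, b⟩ : ℂ)‖ = 1 := by
    have h1 : ‖(⟨a, b⟩ : ℂ)‖ ^ 2 = 1 := by
      rw [← Complex.normSq_eq_norm_sq, Complex.normSq_mk]
      linarith
    rcases sq_eq_one_iff.1 h1 with h2 | h2
    · exact h2
    · linarith [norm_nonneg (⟨a, b⟩ : ℂ)]
  refine ⟨(⟨a, b⟩ : ℂ).arg, ?_⟩
  have h1 := Complex.norm_mul_cos_arg (⟨a, b⟩ : ℂ)
  have h2 := Complex.norm_mul_sin_arg (⟨a, b⟩ : ℂ)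
  rw [hn, one_mul] at h1 h2
  rw [dir, h1, h2]

theorem inner_eq_zero_of_forall_mem {x u : V} {s : Set V} (hu : u ∈ Submodule.span ℝ s)
    (h : ∀ y ∈ s, ⟪x, y⟫ = 0) : ⟪x, u⟫ = 0 := by
  induction hu using Submodule.span_induction with
  | mem y hy => exact h y hy
  | zero => exact inner_zero_right _
  | add y z _ _ hy hz => rw [inner_add_right, hy, hz, add_zero]
  | smul a y _ hy => rw [real_inner_smul_right, hy, mul_zero]

/-- The planes of a circuit with at least four elements have order at most five. -/
theorem IsCircuit.plane_order_le_five (hA : IsCircuit A) (hR : IsUnitRootSet R)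
    (hAR : (A : Set V) ⊆ R) (hcard : 4 ≤ A.card) {u e : V} {M : ℕ} (hM : 0 < M)
    (huu : ⟪u, u⟫ = 1) (he : ⟪e, e⟫ = 1) (hue : ⟪u, e⟫ = 0)
    (hS : ∀ θ, dir u e θ ∈ R ↔ ∃ k : ℤ, θ = k * (π / M))
    (hu : u ∈ Submodule.span ℝ (A : Set V)) : M ≤ 5 := by
  classical
  by_contra hM5
  -- If the order exceeds five, every element of A lies in the plane or is orthogonal to it.
  -- Connectedness leaves two extremes: all in the plane, impossible in rank at least three, or all
  -- orthogonal, impossible for u in their span.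
  have hq : ∀ x ∈ A, ⟪u, x⟫ ^ 2 + ⟪e, x⟫ ^ 2 ≠ 0 → x = ⟪u, x⟫ • u + ⟪e, x⟫ • e := by
    intro x hx h0
    obtain ⟨h1, h2⟩ := inner_sq_add_inner_sq_le huu he hue (hR.inner_self x (hAR hx))
    rcases h1.eq_or_lt with h | h
    · exact h2 h
    · exact absurd (DominantRegions.plane_order_le_five hR hM huu he hue hS (hAR hx) h0 h) hM5
  set S := A.filter (fun x => ⟪u, x⟫ ^ 2 + ⟪e, x⟫ ^ 2 ≠ 0) with hSdef
  have hnot : ∀ x ∈ A, x ∉ S → ⟪u, x⟫ = 0 ∧ ⟪e, x⟫ = 0 := by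
    intro x hx hxS
    have : ⟪u, x⟫ ^ 2 + ⟪e, x⟫ ^ 2 = 0 := by
      by_contra hcon
      exact hxS (Finset.mem_filter.2 ⟨hx, hcon⟩)
    constructor <;> nlinarith [sq_nonneg ⟪u, x⟫, sq_nonneg ⟪e, x⟫]
  rcases S.eq_empty_or_nonempty with hemp | hne
  · have : ⟪u, u⟫ = 0 := inner_eq_zero_of_forall_mem hu fun x hx =>
      (hnot x hx (by simp [hemp])).1
    rw [huu] at this; norm_num at this
  · have hsub : S ⊆ A := Finset.filter_subset _ A
    rcases hsub.eq_or_ssubset with heq | hss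
    · have hle : Submodule.span ℝ (A : Set V) ≤ Submodule.span ℝ (({u, e} : Finset V) : Set V) := by
        rw [Submodule.span_le]
        intro x hx
        have hxS : x ∈ S := by rw [heq]; exact hx
        have := hq x hx (Finset.mem_filter.1 hxS).2
        rw [SetLike.mem_coe, this]
        exact Submodule.add_mem _ (Submodule.smul_mem _ _ (Submodule.subset_span (by simp)))
          (Submodule.smul_mem _ _ (Submodule.subset_span (by simp)))
      have h1 := Submodule.finrank_mono hle
      have h2 := finrank_span_finset_le_card (R := ℝ) ({u, e} : Finset V)
      have h3 := Finset.card_le_two (a := u) (b := e)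
      have h4 := hA.finrank_span
      unfold Set.finrank at h2
      omega
    · obtain ⟨s, hs, t, ht, htS, hst⟩ := hA.exists_inner_ne_zero hss hne
      obtain ⟨hsA, hs0⟩ := Finset.mem_filter.1 hs
      obtain ⟨h1, h2⟩ := hnot t ht htS
      apply hst
      rw [hq s hsA hs0, inner_add_left, real_inner_smul_left, real_inner_smul_left, h1, h2]
      ring

/-- Squared cosines in the span of a circuit with at least four elements. -/
theorem IsCircuit.four_mul_inner_sq_mem (hA : IsCircuit A) (hR : IsUnitRootSet R)
    (hAR : (A : Set V) ⊆ R) (hcard : 4 ≤ A.card) {u w : V} (hu : u ∈ R) (hw : w ∈ R)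
    (hus : u ∈ Submodule.span ℝ (A : Set V)) : 4 * ⟪u, w⟫ ^ 2 ∈ cosSqValues := by
  have huu := hR.inner_self u hu
  have hww := hR.inner_self w hw
  by_cases h1 : u = w
  · subst h1; rw [huu]; norm_num [cosSqValues]
  by_cases h2 : u = -w
  · subst h2; rw [inner_neg_left, hww]; norm_num [cosSqValues]
  obtain ⟨e, he, hue, hdir, -, habs⟩ := exists_dir_eq huu hww h1 h2
  obtain ⟨M, hM, hS⟩ := exists_plane_order hR hu he hue
  obtain ⟨k, hk⟩ := (hS _).1 (hdir ▸ hw)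
  have hM5 := hA.plane_order_le_five hR hAR hcard hM huu he hue hS hus
  rw [← cos_arccos (abs_lt.1 habs).1.le (abs_lt.1 habs).2.le, hk]
  exact four_mul_cos_sq_mem hM hM5 k

/-- The possible inner products of two elements of a circuit in the level set. -/
theorem IsCircuit.inner_cases (hA : IsCircuit A) (hR : IsUnitRootSet R) (h : IsLevel R f lam)
    (hAL : (A : Set V) ⊆ levelSet R f lam) (hcard : 4 ≤ A.card) {u w : V} (hu : u ∈ A)
    (hw : w ∈ A) (hne : u ≠ w) :
    ⟪u, w⟫ = 0 ∨ ⟪u, w⟫ ^ 2 = 1 / 2 ∨ (lam u = lam w ∧ (⟪u, w⟫ = -1 / 2 ∨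
      ⟪u, w⟫ = (goldenRatio - 1) / 2 ∨ ⟪u, w⟫ = -goldenRatio / 2)) := by
  have hAR : (A : Set V) ⊆ R := fun x hx => (hAL hx).1
  have huu := hR.inner_self u (hAR hu)
  have hww := hR.inner_self w (hAR hw)
  have h2 : u ≠ -w := by
    rintro rfl
    exact not_neg_mem_levelSet h hR (hAL hw) (hAL hu)
  obtain ⟨e, he, hue, hdir, -, habs⟩ := exists_dir_eq huu hww hne h2
  obtain ⟨M, hM, hS⟩ := exists_plane_order hR (hAR hu) he hue
  have hM5 := hA.plane_order_le_five hR hAR hcard hM huu he hue hS (Submodule.subset_span hu)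
  obtain ⟨k, hk⟩ := (hS _).1 (hdir ▸ hAR hw)
  have hinner : ⟪u, w⟫ = cos (k * (π / M)) := by
    rw [← hk, cos_arccos (abs_lt.1 habs).1.le (abs_lt.1 habs).2.le]
  rw [hk] at hdir
  -- Parity, with u at position 0, selects k odd for M = 2, 4 and k even for M = 1, 3, 5. In the
  -- even case `lam u = lam w`.
  have hodd : Odd (k + M) := by
    have h0 : dir u e (((0 : ℤ) : ℝ) * (π / M)) = u := by simp [dir]
    have := odd_sub_add_of_mem_levelSet h hM huu he hue hS (k := k) (l := 0)
      (by rw [h0]; exact hAL hu) (by rw [← hdir]; exact hAL hw) (by rw [h0, ← hdir]; exact hne)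
    simpa using this
  have hne1 : ⟪u, w⟫ ≠ 1 := fun h1 => hne (eq_of_inner_eq_one huu hww h1)
  have hlam : Even k → lam u = lam w := fun hk => by
    rw [hdir]; exact (lam_dir_of_even hR h he hue hS (hAR hu) hk).symm
  have hsq : 4 * ⟪u, w⟫ ^ 2 = 2 + 2 * cos (2 * (k * (π / M))) := by
    rw [hinner, cos_two_mul]; ring
  have hev : Even k → ∃ j : ℤ, ⟪u, w⟫ = cos (2 * (j * (π / M))) := by
    rintro ⟨j, hj⟩
    exact ⟨j, by rw [hinner, hj]; congr 1; push_cast; ring⟩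
  interval_cases M
  · exfalso
    have hk : Even k := by rcases hodd with ⟨m, hm⟩; exact ⟨m, by push_cast at hm; omega⟩
    obtain ⟨j, hj⟩ := hev hk
    rw [cos_two_mul_div_eq_emod j (by norm_num)] at hj
    exact hne1 (by rw [hj]; simp)
  · left
    have hk : Odd k := by rcases hodd with ⟨m, hm⟩; exact ⟨m - 1, by push_cast at hm; omega⟩
    rcases cos_two_mul_div_two k with h' | h'
    · exact absurd h'.1 (Int.not_even_iff_odd.2 hk)
    · rw [h'.2] at hsq
      exact pow_eq_zero_iff two_ne_zero |>.1 (by linarith)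
  · right; right
    have hk : Even k := by rcases hodd with ⟨m, hm⟩; exact ⟨m - 1, by push_cast at hm; omega⟩
    obtain ⟨j, hj⟩ := hev hk
    refine ⟨hlam hk, Or.inl ?_⟩
    rcases cos_two_mul_div_three j with h' | h'
    · exact absurd (hj.trans h') hne1
    · exact hj.trans h'
  · right; left
    have hk : Odd k := by rcases hodd with ⟨m, hm⟩; exact ⟨m - 2, by push_cast at hm; omega⟩
    rcases cos_two_mul_div_four k with h' | h'
    · exact absurd h'.1 (Int.not_even_iff_odd.2 hk)
    · rw [h'.2] at hsq; linarith
  · right; right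
    have hk : Even k := by rcases hodd with ⟨m, hm⟩; exact ⟨m - 2, by push_cast at hm; omega⟩
    obtain ⟨j, hj⟩ := hev hk
    refine ⟨hlam hk, Or.inr ?_⟩
    rcases cos_two_mul_div_five j with h' | h' | h'
    · exact absurd (hj.trans h') hne1
    · exact Or.inl (hj.trans h')
    · exact Or.inr (hj.trans h')

/-- A circuit in the level set has at least four elements. -/
theorem IsCircuit.four_le_card (hA : IsCircuit A) (hR : IsUnitRootSet R) (h : IsLevel R f lam)
    (hAL : (A : Set V) ⊆ levelSet R f lam) : 4 ≤ A.card := by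
  classical
  by_contra hcard
  obtain ⟨c, hc0, hc⟩ := hA.exists_relation
  have hpos := hA.nonempty.card_pos
  have hcard' : A.card = 1 ∨ A.card = 2 ∨ A.card = 3 := by omega
  rcases hcard' with h1 | h1 | h1
  · obtain ⟨u, rfl⟩ := Finset.card_eq_one.1 h1
    simp only [Finset.coe_singleton, Set.singleton_subset_iff] at hAL
    rw [Finset.sum_singleton, smul_eq_zero] at hc
    rcases hc with hc | hc
    · exact hc0 u (by simp) hc
    · have := hR.inner_self u hAL.1
      rw [hc] at this; simp at this
  · obtain ⟨u, w, huw, rfl⟩ := Finset.card_eq_two.1 h1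
    have hu := hAL (show u ∈ (({u, w} : Finset V) : Set V) by simp)
    have hw := hAL (show w ∈ (({u, w} : Finset V) : Set V) by simp)
    have hcw := hc0 w (by simp)
    rw [Finset.sum_pair huw] at hc
    have hw' : w = (-(c w)⁻¹ * c u) • u := by
      rw [mul_smul, eq_neg_of_add_eq_zero_left hc, smul_neg, neg_smul, neg_neg, smul_smul,
        inv_mul_cancel₀ hcw, one_smul]
    set t := -(c w)⁻¹ * c u
    have hww := hR.inner_self w hw.1
    rw [hw', real_inner_smul_left, real_inner_smul_right, hR.inner_self u hu.1] at hww
    have ht : t ^ 2 = 1 := by linarith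
    rcases sq_eq_one_iff.1 ht with ht | ht
    · rw [ht, one_smul] at hw'; exact huw hw'.symm
    · rw [ht, neg_one_smul] at hw'
      exact not_neg_mem_levelSet h hR hu (hw' ▸ hw)
  · obtain ⟨u, w, z, huw, huz, hwz, rfl⟩ := Finset.card_eq_three.1 h1
    have hu := hAL (show u ∈ (({u, w, z} : Finset V) : Set V) by simp)
    have hw := hAL (show w ∈ (({u, w, z} : Finset V) : Set V) by simp)
    have hz := hAL (show z ∈ (({u, w, z} : Finset V) : Set V) by simp)
    have huu := hR.inner_self u hu.1
    have hww := hR.inner_self w hw.1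
    have hzz := hR.inner_self z hz.1
    have hcz := hc0 z (by simp)
    have hcu := hc0 u (by simp)
    have hcw := hc0 w (by simp)
    rw [Finset.sum_insert (by simp [huw, huz]), Finset.sum_pair hwz] at hc
    have h2 : u ≠ -w := by
      rintro rfl
      exact not_neg_mem_levelSet h hR hw hu
    obtain ⟨e, he, hue, hdir, -, habs⟩ := exists_dir_eq huu hww huw h2
    obtain ⟨M, hM, hS⟩ := exists_plane_order hR hu.1 he hue
    obtain ⟨k, hk⟩ := (hS _).1 (hdir ▸ hw.1)
    rw [hk] at hdir
    set θ := (k : ℝ) * (π / M)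
    -- `z` lies in the plane of `u` and `e`
    obtain ⟨a, b, hab⟩ : ∃ a b : ℝ, z = a • u + b • e := by
      refine ⟨-(c z)⁻¹ * (c u + c w * cos θ), -(c z)⁻¹ * (c w * sin θ), ?_⟩
      have : c z • z = -(c u • u + c w • w) := by
        rw [eq_neg_iff_add_eq_zero, ← hc]; abel
      have hz' : z = (c z)⁻¹ • (c z • z) := by rw [smul_smul, inv_mul_cancel₀ hcz, one_smul]
      rw [this] at hz'
      have hw' : w = cos θ • u + sin θ • e := hdir
      generalize c u = α, c w = β, c z = γ at hz' ⊢
      rw [hz', hw']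
      module
    have hab1 : a ^ 2 + b ^ 2 = 1 := by
      rw [hab] at hzz
      simp only [inner_add_left, inner_add_right, real_inner_smul_left, real_inner_smul_right, huu,
        he, hue, real_inner_comm u e] at hzz
      linarith
    obtain ⟨η, hη⟩ := exists_dir_of_sq_add_sq (u := u) (e := e) hab1
    rw [← hab] at hη
    obtain ⟨l, hl⟩ := (hS _).1 (hη ▸ hz.1)
    rw [hl] at hη
    have h0 : dir u e (((0 : ℤ) : ℝ) * (π / M)) = u := by simp [dir]
    have o1 := odd_sub_add_of_mem_levelSet h hM huu he hue hS (k := k) (l := 0)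
      (by rw [h0]; exact hu) (by rw [← hdir]; exact hw) (by rw [h0, ← hdir]; exact huw)
    have o2 := odd_sub_add_of_mem_levelSet h hM huu he hue hS (k := l) (l := 0)
      (by rw [h0]; exact hu) (by rw [← hη]; exact hz) (by rw [h0, ← hη]; exact huz)
    have o3 := odd_sub_add_of_mem_levelSet h hM huu he hue hS (k := k) (l := l)
      (by rw [← hη]; exact hz) (by rw [← hdir]; exact hw) (by rw [← hη, ← hdir]; exact hwz.symm)
    -- The three parities say that k, l and k - l are all opposite to M; hence M is odd and k, l are
    -- even.
    have hke : Even k := by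
      rw [Int.even_iff]; rw [Int.odd_iff] at o1 o2 o3; omega
    have hle : Even l := by
      rw [Int.even_iff]; rw [Int.odd_iff] at o1 o2 o3; omega
    have l1 : lam w = lam u := by rw [hdir]; exact lam_dir_of_even hR h he hue hS hu.1 hke
    have l2 : lam z = lam u := by rw [hη]; exact lam_dir_of_even hR h he hue hS hu.1 hle
    have hf := congrArg f hc
    rw [map_add, map_add, map_smul, map_smul, map_smul, map_zero, hu.2, hw.2, hz.2, l1, l2,
      smul_eq_mul, smul_eq_mul, smul_eq_mul] at hf
    -- With equal levels the relation is affine, so the three unit vectors are collinear points;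
    -- since a line meets a circle at most twice, two of them coincide. The norm comparison below
    -- carries this out.
    have hsum : c u + (c w + c z) = 0 := by
      have : (c u + (c w + c z)) * lam u = 0 := by linarith
      exact (mul_eq_zero.1 this).resolve_right (h.pos u hu.1).ne'
    have hz2 : c z • z = -(c u • u + c w • w) := by
      rw [eq_neg_iff_add_eq_zero, ← hc]; abel
    have hn := congrArg (fun x => ⟪x, x⟫) hz2
    simp only [inner_neg_left, inner_neg_right, inner_add_left, inner_add_right,
      real_inner_smul_left, real_inner_smul_right, huu, hww, hzz, real_inner_comm u w] at hn
    have hg : c u * c w * (1 - ⟪u, w⟫) = 0 := by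
      have : c z = -(c u + c w) := by linarith
      rw [this] at hn; linarith
    have hone : ⟪u, w⟫ = 1 := by
      have := (mul_eq_zero.1 hg).resolve_left (mul_ne_zero hcu hcw)
      linarith
    exact huw (eq_of_inner_eq_one huu hww hone)

end Circuits

end DominantRegions

namespace DominantRegions

/-! ### Golden integers and coordinate pairs -/

section GoldenIntegers

open Real

/-- The ring of golden integers `a + b φ`. -/
abbrev Golden : Type := QuadraticAlgebra ℤ 1 1

/-- The embedding of the golden integers that sends the generator to the golden ratio. -/
noncomputable def goldenVal : Golden →+* ℝ :=
  (QuadraticAlgebra.lift (R := ℤ) (a := 1) (b := 1)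
    ⟨goldenRatio, by simp only [one_smul]; rw [← sq, goldenRatio_sq, add_comm]⟩ : Golden →ₐ[ℤ] ℝ)

/-- The conjugate embedding of the golden integers. -/
noncomputable def conjVal : Golden →+* ℝ :=
  (QuadraticAlgebra.lift (R := ℤ) (a := 1) (b := 1)
    ⟨goldenConj, by simp only [one_smul]; rw [← sq, goldenConj_sq, add_comm]⟩ : Golden →ₐ[ℤ] ℝ)

theorem goldenVal_apply (z : Golden) : goldenVal z = z.re + z.im * goldenRatio := by
  change z.re • (1 : ℝ) + z.im • goldenRatio = _
  simp

theorem conjVal_apply (z : Golden) : conjVal z = z.re + z.im * goldenConj := by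
  change z.re • (1 : ℝ) + z.im • goldenConj = _
  simp

theorem goldenVal_injective : Function.Injective goldenVal := by
  rw [injective_iff_map_eq_zero]
  intro z hz
  rw [goldenVal_apply] at hz
  have him : z.im = 0 := by
    by_contra h
    refine goldenRatio_irrational ⟨-z.re / z.im, ?_⟩
    have : (z.im : ℝ) ≠ 0 := by exact_mod_cast h
    push_cast
    rw [div_eq_iff this]
    linarith
  rw [him] at hz
  have hre : z.re = 0 := by simpa using hz
  exact QuadraticAlgebra.ext hre him

/-- Codes for the elements of `cosSqValues`. -/
def cosSqCodes : List Golden := [⟨0, 0⟩, ⟨1, 0⟩, ⟨2, 0⟩, ⟨4, 0⟩, ⟨1, 1⟩, ⟨2, -1⟩]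

theorem exists_code {x : ℝ} (hx : x ∈ cosSqValues) : ∃ z ∈ cosSqCodes, goldenVal z = x := by
  simp only [cosSqValues, Set.mem_insert_iff, Set.mem_singleton_iff] at hx
  simp only [cosSqCodes, List.mem_cons, List.not_mem_nil, or_false, exists_eq_or_imp,
    exists_eq_left, goldenVal_apply]
  rcases hx with rfl | rfl | rfl | rfl | rfl | rfl
  · left; norm_num
  · right; left; norm_num
  · right; right; left; norm_num
  · right; right; right; left; norm_num
  · right; right; right; right; left; push_cast; ring
  · right; right; right; right; right; push_cast; ring

/-- With p = 4a², q = 4b², s = 2(a + b)², t = 2(a - b)², both hypotheses are identities in a and b.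
Restricting all four numbers to the six codes leaves this short list. -/
theorem code_pairs : ∀ p ∈ cosSqCodes, ∀ q ∈ cosSqCodes, ∀ s ∈ cosSqCodes, ∀ t ∈ cosSqCodes,
    s + t = p + q → 4 * (s * t) = (p - q) * (p - q) →
    (p, q) ∈ [((0 : Golden), (0 : Golden)), (4, 0), (0, 4), (2, 2), (1, 1), (2, 0), (0, 2)] := by
  decide +kernel

/-- The possible pairs of coordinates with respect to two elements of a frame. -/
theorem sq_cases_of_mem_cosSqValues {a b : ℝ} (ha : 4 * a ^ 2 ∈ cosSqValues)
    (hb : 4 * b ^ 2 ∈ cosSqValues) (hs : 2 * (a + b) ^ 2 ∈ cosSqValues)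
    (ht : 2 * (a - b) ^ 2 ∈ cosSqValues) :
    (a ^ 2 = 0 ∧ b ^ 2 = 0) ∨ (a ^ 2 = 1 ∧ b ^ 2 = 0) ∨ (a ^ 2 = 0 ∧ b ^ 2 = 1) ∨
    (a ^ 2 = 1 / 2 ∧ b ^ 2 = 1 / 2) ∨ (a ^ 2 = 1 / 4 ∧ b ^ 2 = 1 / 4) ∨
    (a ^ 2 = 1 / 2 ∧ b ^ 2 = 0) ∨ (a ^ 2 = 0 ∧ b ^ 2 = 1 / 2) := by
  obtain ⟨p, hp, hp'⟩ := exists_code ha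
  obtain ⟨q, hq, hq'⟩ := exists_code hb
  obtain ⟨s, hs, hs'⟩ := exists_code hs
  obtain ⟨t, ht, ht'⟩ := exists_code ht
  have h1 : s + t = p + q := goldenVal_injective (by
    rw [map_add, map_add, hp', hq', hs', ht']; ring)
  have h2 : 4 * (s * t) = (p - q) * (p - q) := goldenVal_injective (by
    rw [map_mul, map_mul, map_mul, map_sub, hp', hq', hs', ht', map_ofNat]; ring)
  have h3 := code_pairs p hp q hq s hs t ht h1 h2
  simp only [List.mem_cons, Prod.mk.injEq, List.not_mem_nil, or_false] at h3
  have e : ∀ {x : ℝ} {m : Golden} {k : ℝ}, goldenVal m = 4 * x ^ 2 → goldenVal m = 4 * k →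
      x ^ 2 = k := fun h h' => by linarith
  have v0 : goldenVal 0 = 4 * 0 := by rw [map_zero]; ring
  have v1 : goldenVal 1 = 4 * (1 / 4) := by rw [map_one]; ring
  have v2 : goldenVal 2 = 4 * (1 / 2) := by rw [map_ofNat]; norm_num
  have v4 : goldenVal 4 = 4 * 1 := by rw [map_ofNat]; norm_num
  rcases h3 with ⟨rfl, rfl⟩ | ⟨rfl, rfl⟩ | ⟨rfl, rfl⟩ | ⟨rfl, rfl⟩ | ⟨rfl, rfl⟩ | ⟨rfl, rfl⟩ |
    ⟨rfl, rfl⟩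
  · exact Or.inl ⟨e hp' v0, e hq' v0⟩
  · exact Or.inr (Or.inl ⟨e hp' v4, e hq' v0⟩)
  · exact Or.inr (Or.inr (Or.inl ⟨e hp' v0, e hq' v4⟩))
  · exact Or.inr (Or.inr (Or.inr (Or.inl ⟨e hp' v2, e hq' v2⟩)))
  · exact Or.inr (Or.inr (Or.inr (Or.inr (Or.inl ⟨e hp' v1, e hq' v1⟩))))
  · exact Or.inr (Or.inr (Or.inr (Or.inr (Or.inr (Or.inl ⟨e hp' v2, e hq' v0⟩)))))
  · exact Or.inr (Or.inr (Or.inr (Or.inr (Or.inr (Or.inr ⟨e hp' v0, e hq' v2⟩)))))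

end GoldenIntegers

end DominantRegions

namespace DominantRegions

/-! ### Orthonormal frames of type B -/

section Frames

variable {V : Type*} [NormedAddCommGroup V] [InnerProductSpace ℝ V]
variable {R : Set V} {f : V →ₗ[ℝ] ℝ} {lam : V → ℝ} {A : Finset V} {W : Submodule ℝ V} {F : Finset V}

/-- The normalised sum of two orthogonal unit vectors. -/
noncomputable def diag (x y : V) : V := (√2)⁻¹ • (x + y)

theorem inv_sqrt_two_mul_self : (√2)⁻¹ * (√2)⁻¹ = (1 / 2 : ℝ) := by
  rw [← mul_inv, Real.mul_self_sqrt (by norm_num)]; norm_num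

theorem inner_diag_left (x y z : V) : ⟪diag x y, z⟫ = (√2)⁻¹ * (⟪x, z⟫ + ⟪y, z⟫) := by
  rw [diag, real_inner_smul_left, inner_add_left]

theorem inner_diag_right (x y z : V) : ⟪z, diag x y⟫ = (√2)⁻¹ * (⟪z, x⟫ + ⟪z, y⟫) := by
  rw [diag, real_inner_smul_right, inner_add_right]

theorem diag_neg_neg (x y : V) : diag (-x) (-y) = -diag x y := by
  rw [diag, diag]; module

theorem diag_comm (x y : V) : diag x y = diag y x := by
  rw [diag, diag, add_comm]

theorem diag_diag (x y : V) : diag (diag x y) (diag x (-y)) = x := by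
  have h := inv_sqrt_two_mul_self
  have : diag (diag x y) (diag x (-y)) = ((√2)⁻¹ * (√2)⁻¹ * 2) • x := by
    simp only [diag]; module
  rw [this, h]; norm_num

theorem diag_neg_diag (x y : V) : diag (diag x y) (-diag x (-y)) = y := by
  rw [← diag_neg_neg, neg_neg, diag_comm x, diag_comm (-x), diag_diag]

/-- The normalised difference of two orthogonal unit vectors is the root whose reflection exchanges
them; this feeds `eq_of_diag_mem`. -/
theorem refl_diag {x y : V} (hx : ⟪x, x⟫ = 1) (hxy : ⟪x, y⟫ = 0) : refl (diag x (-y)) x = y := by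
  have h := inv_sqrt_two_mul_self
  rw [refl, inner_diag_left, hx, inner_neg_left, real_inner_comm, hxy, diag, smul_smul]
  rw [show 2 * ((√2)⁻¹ * (1 + -0)) * (√2)⁻¹ = 2 * ((√2)⁻¹ * (√2)⁻¹) by ring, h]
  module

/-- Orthonormal elements of `R` in `W` whose normalised sums and differences lie in `R`. -/
structure IsFrame (R : Set V) (W : Submodule ℝ V) (F : Finset V) : Prop where
  mem : ∀ x ∈ F, x ∈ R
  mem_span : ∀ x ∈ F, x ∈ W
  orth : ∀ x ∈ F, ∀ y ∈ F, x ≠ y → ⟪x, y⟫ = 0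
  diag_mem : ∀ x ∈ F, ∀ y ∈ F, x ≠ y → diag x y ∈ R ∧ diag x (-y) ∈ R

theorem IsFrame.diag_smul_mem (hF : IsFrame R W F) (hR : IsUnitRootSet R) {x y : V} (hx : x ∈ F)
    (hy : y ∈ F) (hxy : x ≠ y) {a b : ℝ} (ha : a ^ 2 = 1) (hb : b ^ 2 = 1) :
    diag (a • x) (b • y) ∈ R := by
  obtain ⟨h1, h2⟩ := hF.diag_mem x hx y hy hxy
  rcases sq_eq_one_iff.1 ha with rfl | rfl <;> rcases sq_eq_one_iff.1 hb with rfl | rfl <;>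
    simp only [one_smul, neg_smul]
  · exact h1
  · exact h2
  · rw [← neg_neg y, diag_neg_neg]; exact hR.neg_mem h2
  · rw [diag_neg_neg]; exact hR.neg_mem h1

theorem IsFrame.inner_sum_smul (hF : IsFrame R W F) (hR : IsUnitRootSet R) (a : V → ℝ) {x : V}
    (hx : x ∈ F) : ⟪x, ∑ y ∈ F, a y • y⟫ = a x := by
  rw [inner_sum, Finset.sum_eq_single_of_mem x hx, real_inner_smul_right,
    hR.inner_self x (hF.mem x hx), mul_one]
  intro y hy hyx
  rw [real_inner_smul_right, hF.orth x hx y hy hyx.symm, mul_zero]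

theorem IsFrame.bessel (hF : IsFrame R W F) (hR : IsUnitRootSet R) {u : V} (hu : ⟪u, u⟫ = 1) :
    ∑ x ∈ F, ⟪x, u⟫ ^ 2 ≤ 1 ∧ (∑ x ∈ F, ⟪x, u⟫ ^ 2 = 1 → u = ∑ x ∈ F, ⟪x, u⟫ • x) := by
  have h1 : ⟪∑ x ∈ F, ⟪x, u⟫ • x, u⟫ = ∑ x ∈ F, ⟪x, u⟫ ^ 2 := by
    rw [sum_inner]
    exact Finset.sum_congr rfl fun x _ => by rw [real_inner_smul_left, sq]
  have h2 : ⟪∑ x ∈ F, ⟪x, u⟫ • x, ∑ x ∈ F, ⟪x, u⟫ • x⟫ = ∑ x ∈ F, ⟪x, u⟫ ^ 2 := by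
    rw [sum_inner]
    exact Finset.sum_congr rfl fun x hx => by
      rw [real_inner_smul_left, hF.inner_sum_smul hR _ hx, sq]
  have key : ⟪u - ∑ x ∈ F, ⟪x, u⟫ • x, u - ∑ x ∈ F, ⟪x, u⟫ • x⟫ = 1 - ∑ x ∈ F, ⟪x, u⟫ ^ 2 := by
    rw [inner_sub_left, inner_sub_right, inner_sub_right, h2,
      real_inner_comm (∑ x ∈ F, ⟪x, u⟫ • x) u, h1, hu]
    ring
  refine ⟨by linarith [real_inner_self_nonneg (x := u - ∑ x ∈ F, ⟪x, u⟫ • x)], fun h => ?_⟩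
  rw [h, sub_self, inner_self_eq_zero, sub_eq_zero] at key
  exact key

theorem IsFrame.card_le [FiniteDimensional ℝ W] (hF : IsFrame R W F) (hR : IsUnitRootSet R) :
    F.card ≤ Module.finrank ℝ W := by
  have hli : LinearIndepOn ℝ id (F : Set V) := by
    rw [linearIndepOn_finset_iff]
    intro g hg x hx
    have := hF.inner_sum_smul hR g hx
    rw [← this]
    change ⟪x, ∑ y ∈ F, g y • id y⟫ = 0
    rw [hg, inner_zero_right]
  rw [← finrank_span_finset_eq_card hli]
  exact Submodule.finrank_mono (Submodule.span_le.2 hF.mem_span)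

theorem isFrame_singleton {x : V} (hx : x ∈ R) (hxW : x ∈ W) : IsFrame R W {x} where
  mem y hy := by rw [Finset.mem_singleton.1 hy]; exact hx
  mem_span y hy := by rw [Finset.mem_singleton.1 hy]; exact hxW
  orth y hy z hz h := absurd ((Finset.mem_singleton.1 hy).trans (Finset.mem_singleton.1 hz).symm) h
  diag_mem y hy z hz h :=
    absurd ((Finset.mem_singleton.1 hy).trans (Finset.mem_singleton.1 hz).symm) h

/-- A root at an angle of 45 degrees to one element of a frame and orthogonal to the others
extends the frame. -/
theorem IsFrame.exists_card_succ (hF : IsFrame R W F) (hR : IsUnitRootSet R) {r x : V} (hr : r ∈ R)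
    (hrW : r ∈ W) (hx : x ∈ F) (hrx : ⟪r, x⟫ ^ 2 = 1 / 2)
    (horth : ∀ y ∈ F, y ≠ x → ⟪r, y⟫ = 0) : ∃ F', IsFrame R W F' ∧ F'.card = F.card + 1 := by
  classical
  have hs := inv_sqrt_two_mul_self
  have hxR := hF.mem x hx
  have hxx := hR.inner_self x hxR
  -- The new frame element is the mirror image of x. It is orthogonal to x because 1 - 2⟪r, x⟫² = 0,
  -- and (x - z)/√2 is ±r.
  set z := refl r x with hz
  have hzR : z ∈ R := hR.refl_mem r hr x hxR
  have hzz := hR.inner_self z hzR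
  have hz' : z = x - (2 * ⟪r, x⟫) • r := rfl
  have hzx : ⟪z, x⟫ = 0 := by rw [hz, inner_refl, hxx]; linarith
  have hzy : ∀ y ∈ F, ⟪z, y⟫ = 0 := by
    intro y hy
    by_cases h : y = x
    · rw [h, hzx]
    · rw [hz, inner_refl, horth y hy h, hF.orth x hx y hy (Ne.symm h)]; ring
  have hzF : z ∉ F := fun h => by
    have := hzy z h
    rw [hzz] at this; norm_num at this
  have hmin : diag x (-z) ∈ R := by
    have h1 : diag x (-z) = ((√2)⁻¹ * (2 * ⟪r, x⟫)) • r := by rw [diag, hz']; module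
    have h2 : ((√2)⁻¹ * (2 * ⟪r, x⟫)) ^ 2 = 1 := by
      rw [mul_pow, mul_pow, hrx, sq, hs]; norm_num
    rw [h1]
    rcases sq_eq_one_iff.1 h2 with h | h
    · rw [h, one_smul]; exact hr
    · rw [h, neg_one_smul]; exact hR.neg_mem hr
  have hplus : diag x z ∈ R := by
    have h1 : diag x z = -refl x (diag x (-z)) := by
      rw [refl, inner_diag_right, hxx, inner_neg_right, real_inner_comm, hzx, diag, diag]
      module
    rw [h1]
    exact hR.neg_mem (hR.refl_mem x hxR _ hmin)
  have hdiag : ∀ y ∈ F, diag y z ∈ R ∧ diag y (-z) ∈ R := by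
    intro y hy
    by_cases h : y = x
    · rw [h]; exact ⟨hplus, hmin⟩
    · have hd := (hF.diag_mem x hx y hy (Ne.symm h)).2
      -- The reflection exchanging x and y transports the diagonal roots from the pair x, z to the
      -- pair y, z.
      have hkey : ∀ w, ⟪x, w⟫ = 0 → ⟪y, w⟫ = 0 → refl (diag x (-y)) (diag x w) = diag y w := by
        intro w hxw hyw
        have : ⟪diag x (-y), diag x w⟫ = 1 / 2 := by
          rw [inner_diag_left, inner_diag_right, inner_diag_right, inner_neg_left, inner_neg_left,
            hxx, hxw, hyw, real_inner_comm, hF.orth x hx y hy (Ne.symm h)]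
          linarith
        rw [refl, this, diag, diag, diag]
        module
      have h1 : ⟪x, z⟫ = 0 := by rw [real_inner_comm]; exact hzx
      have h2 : ⟪y, z⟫ = 0 := by rw [real_inner_comm]; exact hzy y hy
      refine ⟨?_, ?_⟩
      · rw [← hkey z h1 h2]; exact hR.refl_mem _ hd _ hplus
      · rw [← hkey (-z) (by rw [inner_neg_right, h1, neg_zero])
          (by rw [inner_neg_right, h2, neg_zero])]
        exact hR.refl_mem _ hd _ hmin
  refine ⟨insert z F, ⟨?_, ?_, ?_, ?_⟩, Finset.card_insert_of_notMem hzF⟩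
  · intro y hy
    rcases Finset.mem_insert.1 hy with rfl | hy
    · exact hzR
    · exact hF.mem y hy
  · intro y hy
    rcases Finset.mem_insert.1 hy with rfl | hy
    · rw [hz']; exact W.sub_mem (hF.mem_span x hx) (W.smul_mem _ hrW)
    · exact hF.mem_span y hy
  · intro y hy w hw hyw
    rcases Finset.mem_insert.1 hy with rfl | hy <;> rcases Finset.mem_insert.1 hw with rfl | hw
    · exact absurd rfl hyw
    · exact hzy w hw
    · rw [real_inner_comm]; exact hzy y hy
    · exact hF.orth y hy w hw hyw
  · intro y hy w hw hyw
    rcases Finset.mem_insert.1 hy with rfl | hy <;> rcases Finset.mem_insert.1 hw with rfl | hw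
    · exact absurd rfl hyw
    · refine ⟨by rw [diag_comm]; exact (hdiag w hw).1, ?_⟩
      rw [diag_comm, ← neg_neg z, diag_neg_neg]
      exact hR.neg_mem (hdiag w hw).2
    · exact hdiag y hy
    · exact hF.diag_mem y hy w hw hyw

/-- Changing signs turns a frame into one on which `f` is positive. -/
theorem IsFrame.exists_pos (hF : IsFrame R W F) (hR : IsUnitRootSet R) (h : IsLevel R f lam) :
    ∃ F', IsFrame R W F' ∧ F'.card = F.card ∧ ∀ x ∈ F', 0 < f x := by
  classical
  set g : V → V := fun x => (if 0 < f x then (1 : ℝ) else -1) • x with hg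
  have hsq : ∀ x, (if 0 < f x then (1 : ℝ) else -1) ^ 2 = 1 := fun x => by split_ifs <;> norm_num
  have hinj : ∀ x ∈ F, ∀ y ∈ F, g x = g y → x = y := by
    intro x hx y hy hxy
    by_contra hne
    have h0 : ⟪g x, g y⟫ = 0 := by
      simp only [hg, real_inner_smul_left, real_inner_smul_right, hF.orth x hx y hy hne, mul_zero]
    rw [← hxy] at h0
    have h1 := inner_self_eq_zero.1 h0
    have h2 : x = 0 := by
      refine (smul_eq_zero.1 h1).resolve_left fun hc => ?_
      have := hsq x
      rw [hc] at this; norm_num at this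
    have := hR.inner_self x (hF.mem x hx)
    rw [h2, inner_zero_left] at this
    norm_num at this
  refine ⟨F.image g, ⟨?_, ?_, ?_, ?_⟩, Finset.card_image_of_injOn hinj, ?_⟩
  · simp only [Finset.mem_image, forall_exists_index, and_imp, forall_apply_eq_imp_iff₂]
    intro x hx
    simp only [hg]
    split_ifs
    · rw [one_smul]; exact hF.mem x hx
    · rw [neg_one_smul]; exact hR.neg_mem (hF.mem x hx)
  · simp only [Finset.mem_image, forall_exists_index, and_imp, forall_apply_eq_imp_iff₂]
    exact fun x hx => W.smul_mem _ (hF.mem_span x hx)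
  · simp only [Finset.mem_image, forall_exists_index, and_imp, forall_apply_eq_imp_iff₂]
    intro x hx y hy hxy
    have hne : x ≠ y := fun h => hxy (by rw [h])
    simp only [hg, real_inner_smul_left, real_inner_smul_right, hF.orth x hx y hy hne, mul_zero]
  · simp only [Finset.mem_image, forall_exists_index, and_imp, forall_apply_eq_imp_iff₂]
    intro x hx y hy hxy
    have hne : x ≠ y := fun h => hxy (by rw [h])
    refine ⟨hF.diag_smul_mem hR hx hy hne (hsq x) (hsq y), ?_⟩
    simp only [hg, ← neg_smul]
    exact hF.diag_smul_mem hR hx hy hne (hsq x) (by rw [neg_sq]; exact hsq y)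
  · simp only [Finset.mem_image, forall_exists_index, and_imp, forall_apply_eq_imp_iff₂]
    intro x hx
    have := h.ne_zero x (hF.mem x hx)
    simp only [hg, map_smul, smul_eq_mul]
    split_ifs with h1
    · linarith
    · have : f x < 0 := lt_of_le_of_ne (not_lt.1 h1) this
      linarith

/-- Orthogonal elements of the level set whose normalised difference is a root are equal. -/
theorem eq_of_diag_mem (h : IsLevel R f lam) (hR : IsUnitRootSet R) {u w : V}
    (hu : u ∈ levelSet R f lam) (hw : w ∈ levelSet R f lam) (h0 : ⟪u, w⟫ = 0)
    (hd : diag u (-w) ∈ R) : u = w :=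
  eq_of_refl_eq h hu hw hd (refl_diag (hR.inner_self u hu.1) h0)

end Frames

end DominantRegions

namespace DominantRegions

/-! ### Roots relative to a maximal frame -/

section MaximalFrames

variable {V : Type*} [NormedAddCommGroup V] [InnerProductSpace ℝ V]
variable {R : Set V} {f : V →ₗ[ℝ] ℝ} {lam : V → ℝ} {A : Finset V} {W : Submodule ℝ V} {F : Finset V}

/-- A frame of two elements may be rotated by 45 degrees: the diagonals of the new pair are x and y
again. The rotated pair is used to enlarge a frame of cardinality two. -/
theorem isFrame_diag_pair [DecidableEq V] (hF : IsFrame R W F) (hR : IsUnitRootSet R) {x y : V}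
    (hx : x ∈ F) (hy : y ∈ F) (hxy : x ≠ y) :
    IsFrame R W {diag x y, diag x (-y)} ∧ diag x y ≠ diag x (-y) := by
  have hs := inv_sqrt_two_mul_self
  obtain ⟨h1, h2⟩ := hF.diag_mem x hx y hy hxy
  have hxx := hR.inner_self x (hF.mem x hx)
  have hyy := hR.inner_self y (hF.mem y hy)
  have h0 : ⟪diag x y, diag x (-y)⟫ = 0 := by
    rw [inner_diag_left, inner_diag_right, inner_diag_right, inner_neg_right, inner_neg_right, hxx,
      hyy, hF.orth y hy x hx hxy.symm, hF.orth x hx y hy hxy]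
    ring
  have hne : diag x y ≠ diag x (-y) := fun h => by
    rw [← h, hR.inner_self _ h1] at h0; norm_num at h0
  have hW : ∀ {a b : V}, a ∈ W → b ∈ W → diag a b ∈ W :=
    fun ha hb => W.smul_mem _ (W.add_mem ha hb)
  have hxR := hF.mem x hx
  have hyR := hF.mem y hy
  refine ⟨⟨?_, ?_, ?_, ?_⟩, hne⟩
  · simp only [Finset.mem_insert, Finset.mem_singleton, forall_eq_or_imp, forall_eq]
    exact ⟨h1, h2⟩
  · simp only [Finset.mem_insert, Finset.mem_singleton, forall_eq_or_imp, forall_eq]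
    exact ⟨hW (hF.mem_span x hx) (hF.mem_span y hy),
      hW (hF.mem_span x hx) (W.neg_mem (hF.mem_span y hy))⟩
  · simp only [Finset.mem_insert, Finset.mem_singleton, forall_eq_or_imp, forall_eq]
    refine ⟨⟨fun h => absurd rfl h, fun _ => h0⟩, fun _ => ?_, fun h => absurd rfl h⟩
    rw [real_inner_comm]; exact h0
  · simp only [Finset.mem_insert, Finset.mem_singleton, forall_eq_or_imp, forall_eq]
    refine ⟨⟨fun h => absurd rfl h, fun _ => ⟨?_, ?_⟩⟩, fun _ => ⟨?_, ?_⟩, fun h => absurd rfl h⟩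
    · rw [diag_diag]; exact hxR
    · rw [diag_neg_diag]; exact hyR
    · rw [diag_comm, diag_diag]; exact hxR
    · have h := diag_neg_diag x (-y)
      rw [neg_neg] at h
      rw [h]; exact hR.neg_mem hyR

/-- Elements of `R` in the span with nonzero coordinates relative to a maximal frame. -/
theorem IsFrame.cases (hF : IsFrame R W F) (hR : IsUnitRootSet R) (h : IsLevel R f lam)
    (hvals : ∀ u ∈ R, u ∈ W → ∀ w ∈ R, 4 * ⟪u, w⟫ ^ 2 ∈ cosSqValues) (h2 : 2 ≤ F.card)
    (hmax : ∀ F', IsFrame R W F' → F'.card ≤ F.card) (hpos : ∀ x ∈ F, 0 < f x) {u : V}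
    (hu : u ∈ R) (huW : u ∈ W) (hfu : 0 < f u) :
    (∀ x ∈ F, ⟪x, u⟫ = 0) ∨ u ∈ F ∨
      (∃ x ∈ F, ∃ y ∈ F, f y < f x ∧ (u = diag x y ∨ u = diag x (-y))) ∨
      (F.card = 4 ∧ ∀ x ∈ F, ⟪x, u⟫ ^ 2 = 1 / 4) := by
  classical
  have hs := inv_sqrt_two_mul_self
  have hs0 : (0 : ℝ) < (√2)⁻¹ := by positivity
  have huu := hR.inner_self u hu
  -- Maximality of the frame in the form used below: no root of W is at 45 or 135 degrees to one
  -- frame element and orthogonal to all others.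
  have hext : ∀ r ∈ R, r ∈ W → ∀ x ∈ F, ⟪r, x⟫ ^ 2 = 1 / 2 → (∀ y ∈ F, y ≠ x → ⟪r, y⟫ = 0) →
      False := by
    intro r hr hrW x hx hrx horth
    obtain ⟨F', hF', hcard⟩ := hF.exists_card_succ hR hr hrW hx hrx horth
    have := hmax F' hF'
    omega
  have hcases : ∀ x ∈ F, ∀ y ∈ F, x ≠ y → _ := fun x hx y hy hxy =>
    sq_cases_of_mem_cosSqValues (a := ⟪x, u⟫) (b := ⟪y, u⟫)
      (hvals x (hF.mem x hx) (hF.mem_span x hx) u hu)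
      (hvals y (hF.mem y hy) (hF.mem_span y hy) u hu)
      (by
        have := hvals _ (hF.diag_mem x hx y hy hxy).1
          (W.smul_mem _ (W.add_mem (hF.mem_span x hx) (hF.mem_span y hy))) u hu
        rw [inner_diag_left, mul_pow, sq (√2)⁻¹, hs] at this
        convert this using 1; ring)
      (by
        have := hvals _ (hF.diag_mem x hx y hy hxy).2
          (W.smul_mem _ (W.add_mem (hF.mem_span x hx) (W.neg_mem (hF.mem_span y hy)))) u hu
        rw [inner_diag_left, inner_neg_left, mul_pow, sq (√2)⁻¹, hs] at this
        convert this using 1; ring)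
  by_cases h1 : ∃ x ∈ F, ⟪x, u⟫ ^ 2 = 1
  · obtain ⟨x, hx, hxu⟩ := h1
    right; left
    have hxx := hR.inner_self x (hF.mem x hx)
    rcases sq_eq_one_iff.1 hxu with h3 | h3
    · rw [← eq_of_inner_eq_one hxx huu h3]; exact hx
    · have := eq_of_inner_eq_one (u := -x) (w := u) (by rw [inner_neg_neg, hxx]) huu
        (by rw [inner_neg_left, h3, neg_neg])
      rw [← this, map_neg] at hfu
      linarith [hpos x hx]
  by_cases h3 : ∃ x ∈ F, ⟪x, u⟫ ^ 2 = 1 / 2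
  · obtain ⟨x, hx, hxu⟩ := h3
    by_cases h4 : ∃ y ∈ F, y ≠ x ∧ ⟪y, u⟫ ≠ 0
    · obtain ⟨y, hy, hyx, hyu⟩ := h4
      right; right; left
      have hyu2 : ⟪y, u⟫ ^ 2 = 1 / 2 := by
        have hy0 : ⟪y, u⟫ ^ 2 ≠ 0 := pow_ne_zero 2 hyu
        rcases hcases x hx y hy hyx.symm with h | h | h | h | h | h | h
        · exact absurd h.2 hy0
        · exact absurd h.2 hy0
        · rw [h.1] at hxu; norm_num at hxu
        · exact h.2
        · rw [h.1] at hxu; norm_num at hxu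
        · exact absurd h.2 hy0
        · exact h.2
      have hxx := hR.inner_self x (hF.mem x hx)
      have hyy := hR.inner_self y (hF.mem y hy)
      -- the sign-normalised description of `u`
      have key : ∀ x ∈ F, ∀ y ∈ F, x ≠ y → ⟪x, u⟫ ^ 2 = 1 / 2 → ⟪y, u⟫ ^ 2 = 1 / 2 → f y < f x →
          u = diag x y ∨ u = diag x (-y) := by
        intro x hx y hy hxy hxu hyu hlt
        have ha : (2 * (√2)⁻¹ * ⟪x, u⟫) ^ 2 = 1 := by
          rw [mul_pow, mul_pow, sq (√2)⁻¹, hs, hxu]; norm_num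
        have hb : (2 * (√2)⁻¹ * ⟪y, u⟫) ^ 2 = 1 := by
          rw [mul_pow, mul_pow, sq (√2)⁻¹, hs, hyu]; norm_num
        have hd := hF.diag_smul_mem hR hx hy hxy ha hb
        have hueq : u = diag ((2 * (√2)⁻¹ * ⟪x, u⟫) • x) ((2 * (√2)⁻¹ * ⟪y, u⟫) • y) := by
          refine (eq_of_inner_eq_one (hR.inner_self _ hd) huu ?_).symm
          rw [inner_diag_left, real_inner_smul_left, real_inner_smul_left]
          calc _ = 2 * ((√2)⁻¹ * (√2)⁻¹) * (⟪x, u⟫ ^ 2 + ⟪y, u⟫ ^ 2) := by ring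
            _ = 1 := by rw [hs, hxu, hyu]; norm_num
        have hfx := hpos x hx
        have hfy := hpos y hy
        rcases sq_eq_one_iff.1 ha with ha | ha
        · rcases sq_eq_one_iff.1 hb with hb | hb
          · left; rw [ha, hb, one_smul, one_smul] at hueq; exact hueq
          · right; rw [ha, hb, one_smul, neg_one_smul] at hueq; exact hueq
        -- A negative sign on x, which has the larger value of `f`, would make `f u` negative.
        · exfalso
          rw [hueq, diag, map_smul, map_add, map_smul, map_smul, ha] at hfu
          simp only [smul_eq_mul] at hfu
          have := (pos_iff_pos_of_mul_pos hfu).1 hs0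
          rcases sq_eq_one_iff.1 hb with hb | hb <;> rw [hb] at this <;> linarith
      have hfne : f x ≠ f y := by
        intro he
        apply h.ne_zero _ (hF.diag_mem x hx y hy hyx.symm).2
        rw [diag, map_smul, map_add, map_neg, he]; simp
      rcases lt_or_gt_of_ne hfne with hlt | hlt
      · exact ⟨y, hy, x, hx, hlt, key y hy x hx hyx hyu2 hxu hlt⟩
      · exact ⟨x, hx, y, hy, hlt, key x hx y hy hyx.symm hxu hyu2 hlt⟩
    · push Not at h4
      refine (hext u hu huW x hx (by rw [real_inner_comm]; exact hxu) fun y hy hyx => ?_).elim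
      rw [real_inner_comm]; exact h4 y hy hyx
  by_cases h4 : ∃ x ∈ F, ⟪x, u⟫ ^ 2 = 1 / 4
  · obtain ⟨x, hx, hxu⟩ := h4
    have hall : ∀ y ∈ F, ⟪y, u⟫ ^ 2 = 1 / 4 := by
      intro y hy
      by_cases hyx : y = x
      · rw [hyx]; exact hxu
      · rcases hcases x hx y hy (Ne.symm hyx) with h | h | h | h | h | h | h
        · rw [h.1] at hxu; norm_num at hxu
        · rw [h.1] at hxu; norm_num at hxu
        · rw [h.1] at hxu; norm_num at hxu
        · rw [h.1] at hxu; norm_num at hxu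
        · exact h.2
        · rw [h.1] at hxu; norm_num at hxu
        · rw [h.1] at hxu; norm_num at hxu
    right; right; right
    refine ⟨?_, hall⟩
    have hle : F.card ≤ 4 := by
      have hb := (hF.bessel hR huu).1
      rw [Finset.sum_congr rfl hall, Finset.sum_const, nsmul_eq_mul] at hb
      have : (F.card : ℝ) ≤ 4 := by linarith
      exact_mod_cast this
    by_contra hne4
    have hcard : F.card = 2 ∨ F.card = 3 := by omega
    rcases hcard with hc | hc
    -- In the rotated frame u is at 45 or 135 degrees to one element and orthogonal to the other, so
    -- it extends that frame.
    · obtain ⟨y, z, hyz, rfl⟩ := Finset.card_eq_two.1 hc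
      have hy : y ∈ ({y, z} : Finset V) := by simp
      have hz : z ∈ ({y, z} : Finset V) := by simp
      obtain ⟨hG, hGne⟩ := isFrame_diag_pair hF hR hy hz hyz
      have hGc : ({diag y z, diag y (-z)} : Finset V).card = 2 := Finset.card_pair hGne
      have hab : ⟪y, u⟫ ^ 2 = ⟪z, u⟫ ^ 2 := by rw [hall y hy, hall z hz]
      have hstep : ∃ r ∈ ({diag y z, diag y (-z)} : Finset V), ⟪u, r⟫ ^ 2 = 1 / 2 ∧
          ∀ r' ∈ ({diag y z, diag y (-z)} : Finset V), r' ≠ r → ⟪u, r'⟫ = 0 := by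
        have hfour : ((√2)⁻¹ * (⟪u, z⟫ + ⟪u, z⟫)) ^ 2 = 1 / 2 := by
          rw [mul_pow, sq (√2)⁻¹, hs, real_inner_comm]
          linarith [hall z hz]
        have comm1 : ⟪u, y⟫ = ⟪y, u⟫ := real_inner_comm _ _
        have comm2 : ⟪u, z⟫ = ⟪z, u⟫ := real_inner_comm _ _
        rcases sq_eq_sq_iff_eq_or_eq_neg.1 hab with he | he
        · refine ⟨diag y z, by simp, ?_, ?_⟩
          · rw [inner_diag_right, comm1, he, ← comm2]; exact hfour
          · intro r' hr' hne
            simp only [Finset.mem_insert, Finset.mem_singleton] at hr'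
            rcases hr' with rfl | rfl
            · exact absurd rfl hne
            · rw [inner_diag_right, inner_neg_right, comm1, he, ← comm2]; ring
        · refine ⟨diag y (-z), by simp, ?_, ?_⟩
          · rw [inner_diag_right, inner_neg_right, comm1, he, ← comm2, ← hfour]; ring
          · intro r' hr' hne
            simp only [Finset.mem_insert, Finset.mem_singleton] at hr'
            rcases hr' with rfl | rfl
            · rw [inner_diag_right, comm1, he, ← comm2]; ring
            · exact absurd rfl hne
      obtain ⟨r, hr, hr1, hr2⟩ := hstep
      obtain ⟨F', hF', hcard⟩ := hG.exists_card_succ hR hu huW hr hr1 hr2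
      have := hmax F' hF'
      omega
    · obtain ⟨p, q, z, hpq, hpz, hqz, rfl⟩ := Finset.card_eq_three.1 hc
      have hp : p ∈ ({p, q, z} : Finset V) := by simp
      have hq : q ∈ ({p, q, z} : Finset V) := by simp
      have hz : z ∈ ({p, q, z} : Finset V) := by simp
      have hpp := hR.inner_self p (hF.mem p hp)
      have hqq := hR.inner_self q (hF.mem q hq)
      have ep := hF.orth p hp q hq hpq
      have eq' : ⟪q, p⟫ = 0 := hF.orth q hq p hp hpq.symm
      have epz := hF.orth p hp z hz hpz
      have eqz := hF.orth q hq z hz hqz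
      -- The signs 2⟪p, u⟫ and 2⟪q, u⟫ match those of u. Then d - √2 u is orthogonal to p and q, has
      -- squared inner product 1/2 with z, and extends the frame.
      set d := diag ((2 * ⟪p, u⟫) • p) ((2 * ⟪q, u⟫) • q) with hd
      have hdR : d ∈ R := hF.diag_smul_mem hR hp hq hpq
        (by rw [mul_pow, hall p hp]; norm_num) (by rw [mul_pow, hall q hq]; norm_num)
      have hdW : d ∈ W := W.smul_mem _ (W.add_mem (W.smul_mem _ (hF.mem_span p hp))
        (W.smul_mem _ (hF.mem_span q hq)))
      have hud : ⟪u, d⟫ = (√2)⁻¹ := by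
        rw [real_inner_comm, hd, inner_diag_left, real_inner_smul_left, real_inner_smul_left]
        calc _ = (√2)⁻¹ * (2 * ⟪p, u⟫ ^ 2 + 2 * ⟪q, u⟫ ^ 2) := by ring
          _ = _ := by rw [hall p hp, hall q hq]; norm_num
      have hr : ∀ w, ⟪refl u d, w⟫ =
          (√2)⁻¹ * (2 * ⟪p, u⟫ * ⟪p, w⟫ + 2 * ⟪q, u⟫ * ⟪q, w⟫ - 2 * ⟪u, w⟫) := by
        intro w
        rw [inner_refl, hud, hd, inner_diag_left, real_inner_smul_left, real_inner_smul_left]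
        ring
      refine hext (refl u d) (hR.refl_mem u hu d hdR) (W.sub_mem hdW (W.smul_mem _ huW)) z hz ?_ ?_
      · rw [hr, epz, eqz, mul_pow, sq (√2)⁻¹, hs, real_inner_comm z u]
        linarith [hall z hz]
      · intro y hy hyz
        simp only [Finset.mem_insert, Finset.mem_singleton] at hy
        rw [hr]
        rcases hy with rfl | rfl | rfl
        · rw [hpp, eq', real_inner_comm y u]; ring
        · rw [hqq, ep, real_inner_comm y u]; ring
        · exact absurd rfl hyz
  · left
    intro x hx
    obtain ⟨y, hy, hyx⟩ := Finset.exists_mem_ne (by omega : 1 < F.card) x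
    have : ⟪x, u⟫ ^ 2 = 0 := by
      rcases hcases x hx y hy hyx.symm with h | h | h | h | h | h | h
      · exact h.1
      · exact absurd ⟨x, hx, h.1⟩ h1
      · exact h.1
      · exact absurd ⟨x, hx, h.1⟩ h3
      · exact absurd ⟨x, hx, h.1⟩ h4
      · exact absurd ⟨x, hx, h.1⟩ h3
      · exact h.1
    exact pow_eq_zero_iff two_ne_zero |>.1 this

end MaximalFrames

end DominantRegions

namespace DominantRegions

/-! ### Counting level elements against a frame -/

section FrameCounting

variable {V : Type*} [NormedAddCommGroup V] [InnerProductSpace ℝ V]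
variable {R : Set V} {f : V →ₗ[ℝ] ℝ} {lam : V → ℝ} {A : Finset V} {W : Submodule ℝ V} {F : Finset V}

theorem exists_maximal_frame [FiniteDimensional ℝ W] (hR : IsUnitRootSet R) (hF : IsFrame R W F) :
    ∃ F', IsFrame R W F' ∧ F.card ≤ F'.card ∧ ∀ G, IsFrame R W G → G.card ≤ F'.card := by
  classical
  set P : ℕ → Prop := fun k => ∃ G, IsFrame R W G ∧ G.card = k with hP
  have hle := hF.card_le hR
  obtain ⟨F', hF', hc⟩ : P (Nat.findGreatest P (Module.finrank ℝ W)) :=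
    Nat.findGreatest_spec hle ⟨F, hF, rfl⟩
  refine ⟨F', hF', ?_, fun G hG => ?_⟩
  · rw [hc]; exact Nat.le_findGreatest hle ⟨F, hF, rfl⟩
  · rw [hc]; exact Nat.le_findGreatest (hG.card_le hR) ⟨G, hG, rfl⟩

/-- A linear combination of a frame with coefficients `± 1 / 2` lies in `R` as soon as one such
combination does. -/
theorem IsFrame.sum_mem (hF : IsFrame R W F) (hR : IsUnitRootSet R) {a b : V → ℝ}
    (ha : ∀ x ∈ F, a x ^ 2 = 1 / 4) (hb : ∀ x ∈ F, b x ^ 2 = 1 / 4)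
    (hmem : ∑ x ∈ F, a x • x ∈ R) : ∑ x ∈ F, b x • x ∈ R := by
  classical
  -- T collects the elements whose sign is already corrected; a wrong sign at y is corrected by the
  -- reflection in y.
  have key : ∀ T ⊆ F, ∑ x ∈ F, (if x ∈ T then b x else a x) • x ∈ R := by
    intro T
    induction T using Finset.induction_on with
    | empty => intro _; simpa using hmem
    | insert y T hy ih =>
      intro hT
      have hyF : y ∈ F := hT (Finset.mem_insert_self _ _)
      have ih := ih fun x hx => hT (Finset.mem_insert_of_mem hx)
      rcases sq_eq_sq_iff_eq_or_eq_neg.1 ((ha y hyF).trans (hb y hyF).symm) with he | he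
      · convert ih using 2 with x hx
        by_cases hxy : x = y
        · subst hxy; simp [hy, he]
        · simp [Finset.mem_insert, hxy]
      · have h1 := hR.refl_mem y (hF.mem y hyF) _ ih
        rw [refl, hF.inner_sum_smul hR _ hyF, if_neg hy] at h1
        convert h1 using 1
        rw [← Finset.add_sum_erase F _ hyF, ← Finset.add_sum_erase F
          (fun x => (if x ∈ T then b x else a x) • x) hyF, if_pos (Finset.mem_insert_self _ _),
          if_neg hy, he]
        have : ∑ x ∈ F.erase y, (if x ∈ insert y T then b x else a x) • x =
            ∑ x ∈ F.erase y, (if x ∈ T then b x else a x) • x := by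
          refine Finset.sum_congr rfl fun x hx => ?_
          simp [Finset.mem_insert, Finset.ne_of_mem_erase hx]
        rw [this]
        module
  have := key F le_rfl
  rwa [Finset.sum_congr rfl fun x hx => by rw [if_pos hx]] at this

/-- Three elements of the level set cannot have pairwise inner products `-1 / 2`. -/
theorem card_le_two_of_inner_eq_neg_half (h : IsLevel R f lam) (hR : IsUnitRootSet R) {S : Finset V}
    (hS : (S : Set V) ⊆ levelSet R f lam)
    (hip : ∀ u ∈ S, ∀ w ∈ S, u ≠ w → ⟪u, w⟫ = -1 / 2) : S.card ≤ 2 := by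
  by_contra hcon
  obtain ⟨u, w, z, hu, hw, hz, huw, huz, hwz⟩ := Finset.two_lt_card_iff.1 (not_le.1 hcon)
  have hpos : ∀ x ∈ S, 0 < f x := fun x hx => by rw [(hS hx).2]; exact h.pos x (hS hx).1
  have h0 : ⟪u + w + z, u + w + z⟫ = 0 := by
    simp only [inner_add_left, inner_add_right]
    rw [hR.inner_self u (hS hu).1, hR.inner_self w (hS hw).1, hR.inner_self z (hS hz).1,
      hip u hu w hw huw, hip u hu z hz huz, hip w hw z hz hwz, hip w hw u hu huw.symm,
      hip z hz u hu huz.symm, hip z hz w hw hwz.symm]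
    norm_num
  have h1 := congrArg f (inner_self_eq_zero.1 h0)
  rw [map_add, map_add, map_zero] at h1
  linarith [hpos u hu, hpos w hw, hpos z hz]

/-- Without half-spin elements, a set of elements of the level set that are described by a frame is
not larger than the frame. -/
theorem IsFrame.card_le_card (hF : IsFrame R W F) (h : IsLevel R f lam) (hR : IsUnitRootSet R)
    (hne : F.Nonempty) (hAL : (A : Set V) ⊆ levelSet R f lam)
    (hcases : ∀ u ∈ A, u ∈ F ∨ ∃ x ∈ F, ∃ y ∈ F, f y < f x ∧ (u = diag x y ∨ u = diag x (-y))) :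
    A.card ≤ F.card := by
  classical
  -- Send a diagonal to its frame element with the larger value of `f`, and frame elements to x₀. No
  -- diagonal is sent to x₀, where `f` is least, so that slot is free. Two elements in one fibre
  -- would be at 60 degrees or be exchanged by a reflection.
  obtain ⟨x₀, hx₀, hmin⟩ := F.exists_min_image f hne
  refine Finset.card_le_card_of_forall_subsingleton (fun u x => (u ∈ F ∧ x = x₀) ∨
    ∃ y ∈ F, f y < f x ∧ (u = diag x y ∨ u = diag x (-y))) (fun u hu => ?_) ?_
  · rcases hcases u hu with hu | ⟨x, hx, y, hy, hlt, hu⟩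
    · exact ⟨x₀, hx₀, Or.inl ⟨hu, rfl⟩⟩
    · exact ⟨x, hx, Or.inr ⟨y, hy, hlt, hu⟩⟩
  · rintro x hx u ⟨huA, hu⟩ w ⟨hwA, hw⟩
    have huL := hAL huA
    have hwL := hAL hwA
    by_contra huw
    have hs := inv_sqrt_two_mul_self
    rcases hu with ⟨hu, rfl⟩ | ⟨y, hy, hyx, hu⟩ <;> rcases hw with ⟨hw, hxx⟩ | ⟨z, hz, hzx, hw⟩
    · exact huw (eq_of_diag_mem h hR huL hwL (hF.orth u hu w hw huw) (hF.diag_mem u hu w hw huw).2)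
    · exact absurd (hmin z hz) (not_le.2 hzx)
    · subst hxx; exact absurd (hmin y hy) (not_le.2 hyx)
    · have hxx := hR.inner_self x (hF.mem x hx)
      have hyy := hR.inner_self y (hF.mem y hy)
      have hxy : x ≠ y := fun e => by rw [e] at hyx; exact lt_irrefl _ hyx
      have hxz : x ≠ z := fun e => by rw [e] at hzx; exact lt_irrefl _ hzx
      have i1 := hF.orth x hx y hy hxy
      have i2 := hF.orth x hx z hz hxz
      have i3 := hF.orth y hy x hx hxy.symm
      by_cases hyz : y = z
      · subst hyz
        have h0 : ⟪diag x y, diag x (-y)⟫ = 0 := by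
          simp only [inner_diag_left, inner_diag_right, inner_neg_right, hxx, hyy, i1, i3]; ring
        rcases hu with rfl | rfl <;> rcases hw with rfl | rfl
        · exact huw rfl
        · refine huw (eq_of_diag_mem h hR huL hwL h0 ?_)
          rw [diag_neg_diag]; exact hF.mem y hy
        · refine huw (eq_of_diag_mem h hR hwL huL h0 ?_).symm
          rw [diag_neg_diag]; exact hF.mem y hy
        · exact huw rfl
      · have i4 := hF.orth y hy z hz hyz
        refine inner_ne_half h hR huL hwL ?_
        rcases hu with rfl | rfl <;> rcases hw with rfl | rfl <;>
          simp only [inner_diag_left, inner_diag_right, inner_neg_right, inner_neg_left, hxx,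
            i2, i3, i4] <;> linarith

end FrameCounting

end DominantRegions

namespace DominantRegions

/-! ### Half-spin roots (type F₄) and exclusion of 45 and 135 degrees -/

section HalfSpin

variable {V : Type*} [NormedAddCommGroup V] [InnerProductSpace ℝ V]
variable {R : Set V} {f : V →ₗ[ℝ] ℝ} {lam : V → ℝ} {A : Finset V} {W : Submodule ℝ V} {F : Finset V}

theorem eq_neg_half_of_sq (h : IsLevel R f lam) (hR : IsUnitRootSet R) {u w : V}
    (hu : u ∈ levelSet R f lam) (hw : w ∈ levelSet R f lam) (hsq : ⟪u, w⟫ ^ 2 = 1 / 4) :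
    ⟪u, w⟫ = -1 / 2 := by
  have h1 := inner_ne_half h hR hu hw
  have : (⟪u, w⟫ - 1 / 2) * (⟪u, w⟫ + 1 / 2) = 0 := by linarith
  rcases mul_eq_zero.1 this with h2 | h2
  · exact absurd (by linarith) h1
  · linarith

/-- Two half-spin elements of the level set. -/
theorem IsFrame.inner_half_half (hF : IsFrame R W F) (h : IsLevel R f lam) (hR : IsUnitRootSet R)
    (hcard : F.card = 4) {u w : V} (hu : u ∈ levelSet R f lam) (hw : w ∈ levelSet R f lam)
    (huw : u ≠ w) (hau : ∀ x ∈ F, ⟪x, u⟫ ^ 2 = 1 / 4) (haw : ∀ x ∈ F, ⟪x, w⟫ ^ 2 = 1 / 4)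
    (hu' : u = ∑ x ∈ F, ⟪x, u⟫ • x) (hw' : w = ∑ x ∈ F, ⟪x, w⟫ • x) : ⟪u, w⟫ = -1 / 2 := by
  classical
  set D := F.filter (fun x => ⟪x, u⟫ ≠ ⟪x, w⟫) with hD
  have hDmem : ∀ x ∈ D, ⟪x, w⟫ = -⟪x, u⟫ := by
    intro x hx
    obtain ⟨hxF, hne⟩ := Finset.mem_filter.1 hx
    rcases sq_eq_sq_iff_eq_or_eq_neg.1 ((haw x hxF).trans (hau x hxF).symm) with he | he
    · exact absurd he.symm hne
    · exact he
  have hnot : ∀ x ∈ F, x ∉ D → ⟪x, w⟫ = ⟪x, u⟫ := by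
    intro x hx hxD
    by_contra hne
    exact hxD (Finset.mem_filter.2 ⟨hx, Ne.symm hne⟩)
  -- D is the set of sign disagreements. Sizes 0 and 4 mean u = ±w, size 1 means 60 degrees, and
  -- size 2 makes the normalised difference a diagonal root. Only size 3 survives.
  have hval : ⟪u, w⟫ = 1 - D.card / 2 := by
    have e1 : ⟪u, w⟫ = ∑ x ∈ F, ⟪x, w⟫ * ⟪x, u⟫ := by
      conv_lhs => rw [hw', inner_sum]
      exact Finset.sum_congr rfl fun x _ => by rw [real_inner_smul_right, real_inner_comm x u]
    have e2 : ∀ x ∈ F, ⟪x, w⟫ * ⟪x, u⟫ = 1 / 4 - if x ∈ D then 1 / 2 else 0 := by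
      intro x hx
      by_cases hxD : x ∈ D
      · rw [if_pos hxD, hDmem x hxD]; linarith [hau x hx]
      · rw [if_neg hxD, hnot x hx hxD]; linarith [hau x hx]
    rw [e1, Finset.sum_congr rfl e2, Finset.sum_sub_distrib, Finset.sum_const, hcard,
      Finset.sum_ite_mem, Finset.inter_eq_right.2 (Finset.filter_subset _ F), Finset.sum_const]
    simp only [nsmul_eq_mul]
    push_cast
    ring
  have hD4 : D.card ≤ 4 := by rw [← hcard]; exact Finset.card_le_card (Finset.filter_subset _ F)
  have huu := hR.inner_self u hu.1
  have hww := hR.inner_self w hw.1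
  obtain hc | hc | hc | hc | hc : D.card = 0 ∨ D.card = 1 ∨ D.card = 2 ∨ D.card = 3 ∨ D.card = 4 := by
    omega
  · rw [hc] at hval
    exact absurd (eq_of_inner_eq_one huu hww (by rw [hval]; norm_num)) huw
  · rw [hc] at hval
    exact absurd (by rw [hval]; norm_num) (inner_ne_half h hR hu hw)
  · obtain ⟨p, q, hpq, hDpq⟩ := Finset.card_eq_two.1 hc
    have hp : p ∈ F := (Finset.mem_filter.1 (show p ∈ D by rw [hDpq]; simp)).1
    have hq : q ∈ F := (Finset.mem_filter.1 (show q ∈ D by rw [hDpq]; simp)).1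
    have hsub : u + -w = (2 * ⟪p, u⟫) • p + (2 * ⟪q, u⟫) • q := by
      have e1 : u + -w = ∑ x ∈ F, (⟪x, u⟫ - ⟪x, w⟫) • x := by
        simp only [sub_smul, Finset.sum_sub_distrib]
        rw [← hu', ← hw', sub_eq_add_neg]
      have hDF : D ⊆ F := Finset.filter_subset _ F
      rw [e1, ← Finset.sum_subset hDF, hDpq, Finset.sum_pair hpq, hDmem p (by rw [hDpq]; simp), hDmem q (by rw [hDpq]; simp)]
      · congr 2 <;> ring
      · intro x hx hxD
        rw [hnot x hx hxD, sub_self, zero_smul]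
    refine absurd (eq_of_diag_mem h hR hu hw (by rw [hval, hc]; norm_num) ?_) huw
    rw [diag, hsub]
    exact hF.diag_smul_mem hR hp hq hpq (by rw [mul_pow, hau p hp]; norm_num)
      (by rw [mul_pow, hau q hq]; norm_num)
  · rw [hval, hc]; norm_num
  · have h1 : u = -w := eq_of_inner_eq_one huu (by rw [inner_neg_neg, hww])
      (by rw [inner_neg_right, hval, hc]; norm_num)
    exact absurd (h1 ▸ hu) (not_neg_mem_levelSet h hR hw)

/-- Two elements of the level set that are normalised sums of elements of a frame of cardinality
four. -/
theorem IsFrame.inner_diag_diag (hF : IsFrame R W F) (h : IsLevel R f lam) (hR : IsUnitRootSet R)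
    (hcard : F.card = 4)
    (hhalf : ∀ b : V → ℝ, (∀ x ∈ F, b x ^ 2 = 1 / 4) → ∑ x ∈ F, b x • x ∈ R)
    {p q x y : V} (hp : p ∈ F) (hq : q ∈ F) (hx : x ∈ F) (hy : y ∈ F) (hqp : f q < f p)
    (hyx : f y < f x) {a b : ℝ} (ha : a ^ 2 = 1) (hb : b ^ 2 = 1)
    (hu : diag p (a • q) ∈ levelSet R f lam) (hw : diag x (b • y) ∈ levelSet R f lam)
    (huw : diag p (a • q) ≠ diag x (b • y)) :
    ⟪diag p (a • q), diag x (b • y)⟫ = -1 / 2 := by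
  classical
  have hs := inv_sqrt_two_mul_self
  have hself : ∀ z ∈ F, ⟪z, z⟫ = 1 := fun z hz => hR.inner_self z (hF.mem z hz)
  have horth := hF.orth
  have hpq : p ≠ q := fun e => by rw [e] at hqp; exact lt_irrefl _ hqp
  have hxy : x ≠ y := fun e => by rw [e] at hyx; exact lt_irrefl _ hyx
  have hval : ⟪diag p (a • q), diag x (b • y)⟫ =
      (⟪p, x⟫ + b * ⟪p, y⟫ + a * ⟪q, x⟫ + a * b * ⟪q, y⟫) / 2 := by
    simp only [inner_diag_left, inner_diag_right, real_inner_smul_left, real_inner_smul_right]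
    calc _ = (√2)⁻¹ * (√2)⁻¹ * (⟪p, x⟫ + b * ⟪p, y⟫ + a * ⟪q, x⟫ + a * b * ⟪q, y⟫) := by ring
      _ = _ := by rw [hs]; ring
  by_cases h1 : p = x
  · subst h1
    by_cases h2 : q = y
    · subst h2
      exfalso
      have hab : b = -a := by
        rcases sq_eq_sq_iff_eq_or_eq_neg.1 (hb.trans ha.symm) with he | he
        · exact absurd (by rw [he]) huw
        · exact he
      refine huw (eq_of_diag_mem h hR hu hw ?_ ?_)
      · rw [hval, hself p hp, hself q hq, horth p hp q hq hpq, horth q hq p hp hpq.symm, hab]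
        linarith
      · rw [hab, neg_smul, diag_neg_diag]
        rcases sq_eq_one_iff.1 ha with rfl | rfl
        · rw [one_smul]; exact hF.mem q hq
        · rw [neg_one_smul]; exact hR.neg_mem (hF.mem q hq)
    · refine absurd ?_ (inner_ne_half h hR hu hw)
      rw [hval, hself p hp, horth p hp y hy hxy, horth q hq p hp hpq.symm, horth q hq y hy h2]
      ring
  · refine Or.elim (em (⟪diag p (a • q), diag x (b • y)⟫ ^ 2 = 1 / 4))
      (eq_neg_half_of_sq h hR hu hw) fun hne => ?_
    rw [hval, horth p hp x hx h1] at hne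
    by_cases h2 : q = y
    · subst h2
      refine absurd ?_ hne
      rw [horth p hp q hq hpq, horth q hq x hx (Ne.symm hxy), hself q hq]
      calc _ = a ^ 2 * b ^ 2 / 4 := by ring
        _ = _ := by rw [ha, hb]; norm_num
    by_cases h3 : q = x
    · subst h3
      have h4 : p ≠ y := fun e => by rw [e] at hqp; exact lt_asymm hqp hyx
      refine absurd ?_ hne
      rw [horth p hp y hy h4, hself q hq, horth q hq y hy hxy]
      calc _ = a ^ 2 / 4 := by ring
        _ = _ := by rw [ha]
    by_cases h4 : p = y
    · subst h4
      refine absurd ?_ hne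
      rw [hself p hp, horth q hq x hx h3, horth q hq p hp hpq.symm]
      calc _ = b ^ 2 / 4 := by ring
        _ = _ := by rw [hb]
    exfalso
    have hFeq : ({p, q, x, y} : Finset V) = F := by
      apply Finset.eq_of_subset_of_card_le
      · intro z hz
        simp only [Finset.mem_insert, Finset.mem_singleton] at hz
        rcases hz with rfl | rfl | rfl | rfl <;> assumption
      · rw [hcard, Finset.card_insert_of_notMem (by simp [hpq, h1, h4]),
          Finset.card_insert_of_notMem (by simp [h2, h3]), Finset.card_pair hxy]
    refine huw (eq_of_diag_mem h hR hu hw ?_ ?_)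
    · rw [hval, horth p hp x hx h1, horth p hp y hy h4, horth q hq x hx h3, horth q hq y hy h2]
      ring
    -- For four distinct frame elements the normalised difference of the diagonals is a half-spin
    -- vector with these coefficients, hence a root.
    · set c : V → ℝ := fun z => if z = p then 1 / 2 else if z = q then a / 2 else
        if z = x then -1 / 2 else -b / 2 with hc
      have hcsq : ∀ z ∈ F, c z ^ 2 = 1 / 4 := by
        intro z _
        simp only [hc]
        split_ifs
        · norm_num
        · rw [div_pow, ha]; norm_num
        · norm_num
        · rw [div_pow, neg_sq, hb]; norm_num
      have := hhalf c hcsq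
      rw [← hFeq, Finset.sum_insert (by simp [hpq, h1, h4]), Finset.sum_insert (by simp [h2, h3]),
        Finset.sum_pair hxy] at this
      have c1 : c p = 1 / 2 := by simp [hc]
      have c2 : c q = a / 2 := by simp [hc, hpq.symm]
      have c3 : c x = -1 / 2 := by simp [hc, Ne.symm h1, Ne.symm h3]
      have c4 : c y = -b / 2 := by simp [hc, Ne.symm h4, Ne.symm h2, hxy.symm]
      rw [c1, c2, c3, c4] at this
      convert this using 1
      have : diag (diag p (a • q)) (-diag x (b • y)) =
          ((√2)⁻¹ * (√2)⁻¹) • (p + a • q + (-x + -(b • y))) := by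
        simp only [diag]; module
      rw [this, hs]
      module

/-- A set of elements of the level set that are described by a frame with half-spin elements has at
most four elements. -/
theorem IsFrame.card_le_four (hF : IsFrame R W F) (h : IsLevel R f lam) (hR : IsUnitRootSet R)
    (hcard : F.card = 4) (hAL : (A : Set V) ⊆ levelSet R f lam)
    (hcases : ∀ u ∈ A, u ∈ F ∨ (∃ x ∈ F, ∃ y ∈ F, f y < f x ∧ (u = diag x y ∨ u = diag x (-y))) ∨
      ∀ x ∈ F, ⟪x, u⟫ ^ 2 = 1 / 4)
    (hex : ∃ u ∈ A, ∀ x ∈ F, ⟪x, u⟫ ^ 2 = 1 / 4) : A.card ≤ 4 := by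
  classical
  have hsum : ∀ u ∈ A, (∀ x ∈ F, ⟪x, u⟫ ^ 2 = 1 / 4) → u = ∑ x ∈ F, ⟪x, u⟫ • x := by
    intro u hu hxu
    refine (hF.bessel hR (hR.inner_self u (hAL hu).1)).2 ?_
    rw [Finset.sum_congr rfl hxu, Finset.sum_const, hcard]; norm_num
  obtain ⟨η, hη, hηx⟩ := hex
  have hhalf : ∀ b : V → ℝ, (∀ x ∈ F, b x ^ 2 = 1 / 4) → ∑ x ∈ F, b x • x ∈ R :=
    fun b hb => hF.sum_mem hR hηx hb (hsum η hη hηx ▸ (hAL hη).1)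
  set P : V → Prop := fun u => ∃ x ∈ F, ∃ y ∈ F, f y < f x ∧ (u = diag x y ∨ u = diag x (-y)) with hP
  -- A splits into diagonals and the rest (frame elements and half-spin vectors). Within each class
  -- distinct elements have inner product -1/2, so each class has at most two.
  have h1 : (A.filter P).card ≤ 2 := by
    refine card_le_two_of_inner_eq_neg_half h hR
      (fun u hu => hAL (Finset.mem_filter.1 hu).1) fun u hu w hw huw => ?_
    obtain ⟨huA, p, hp, q, hq, hqp, hu⟩ := Finset.mem_filter.1 hu
    obtain ⟨hwA, x, hx, y, hy, hyx, hw⟩ := Finset.mem_filter.1 hw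
    have hform : ∀ {u p q : V}, u = diag p q ∨ u = diag p (-q) →
        ∃ a : ℝ, a ^ 2 = 1 ∧ u = diag p (a • q) := by
      rintro u p q (hu | hu)
      · exact ⟨1, by norm_num, by rw [one_smul]; exact hu⟩
      · exact ⟨-1, by norm_num, by rw [neg_one_smul]; exact hu⟩
    obtain ⟨a, ha, rfl⟩ := hform hu
    obtain ⟨b, hb, rfl⟩ := hform hw
    exact hF.inner_diag_diag h hR hcard hhalf hp hq hx hy hqp hyx ha hb (hAL huA) (hAL hwA) huw
  have h2 : (A.filter fun u => ¬ P u).card ≤ 2 := by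
    refine card_le_two_of_inner_eq_neg_half h hR
      (fun u hu => hAL (Finset.mem_filter.1 hu).1) fun u hu w hw huw => ?_
    obtain ⟨huA, hu⟩ := Finset.mem_filter.1 hu
    obtain ⟨hwA, hw⟩ := Finset.mem_filter.1 hw
    have huL := hAL huA
    have hwL := hAL hwA
    have hu := (hcases u huA).imp_right fun h => h.resolve_left hu
    have hw := (hcases w hwA).imp_right fun h => h.resolve_left hw
    rcases hu with hu | hu <;> rcases hw with hw | hw
    · exact absurd (eq_of_diag_mem h hR huL hwL (hF.orth u hu w hw huw)
        (hF.diag_mem u hu w hw huw).2) huw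
    · exact eq_neg_half_of_sq h hR huL hwL (hw u hu)
    · exact eq_neg_half_of_sq h hR huL hwL (by rw [real_inner_comm]; exact hu w hw)
    · exact hF.inner_half_half h hR hcard huL hwL huw hu hw (hsum u huA hu) (hsum w hwA hw)
  have := Finset.card_filter_add_card_filter_not (s := A) P
  omega

/-- No two elements of a circuit in the level set form an angle of 45 or 135 degrees. -/
theorem IsCircuit.inner_sq_ne_half (hA : IsCircuit A) (hR : IsUnitRootSet R) (h : IsLevel R f lam)
    (hAL : (A : Set V) ⊆ levelSet R f lam) {u w : V} (hu : u ∈ A) (hw : w ∈ A) :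
    ⟪u, w⟫ ^ 2 ≠ 1 / 2 := by
  classical
  intro huw
  have hAR : (A : Set V) ⊆ R := fun x hx => (hAL hx).1
  have hA4 := hA.four_le_card hR h hAL
  set W := Submodule.span ℝ (A : Set V) with hW
  have hmemW : ∀ x ∈ A, x ∈ W := fun x hx => Submodule.subset_span hx
  obtain ⟨G, hG, hGcard⟩ := (isFrame_singleton (hAR hw) (hmemW w hw)).exists_card_succ hR (hAR hu)
    (hmemW u hu) (Finset.mem_singleton_self w) huw
    fun y hy hyw => absurd (Finset.mem_singleton.1 hy) hyw
  have : FiniteDimensional ℝ W := FiniteDimensional.span_finset ℝ A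
  obtain ⟨F₀, hF₀, hGF, hmax₀⟩ := exists_maximal_frame hR hG
  obtain ⟨F, hF, hFcard, hpos⟩ := hF₀.exists_pos hR h
  have hmax : ∀ G, IsFrame R W G → G.card ≤ F.card := fun G hG => hFcard ▸ hmax₀ G hG
  have hF2 : 2 ≤ F.card := by
    rw [hFcard]; rw [Finset.card_singleton] at hGcard; omega
  have hcases := fun u (hu : u ∈ A) => hF.cases hR h
    (fun u hu huW w hw => hA.four_mul_inner_sq_mem hR hAR hA4 hu hw huW) hF2 hmax hpos (hAR hu)
    (hmemW u hu) (by rw [(hAL hu).2]; exact h.pos u (hAR hu))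
  have hspan : ∀ u ∈ A, (∀ x ∈ F, ⟪x, u⟫ = 0) ∨ u ∈ Submodule.span ℝ (F : Set V) := by
    intro u hu
    rcases hcases u hu with hc | hc | ⟨x, hx, y, hy, -, hc⟩ | ⟨hc, hc'⟩
    · exact Or.inl hc
    · exact Or.inr (Submodule.subset_span hc)
    · right
      have hx' : x ∈ Submodule.span ℝ (F : Set V) := Submodule.subset_span hx
      have hy' : y ∈ Submodule.span ℝ (F : Set V) := Submodule.subset_span hy
      rcases hc with rfl | rfl
      · exact Submodule.smul_mem _ _ (Submodule.add_mem _ hx' hy')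
      · exact Submodule.smul_mem _ _ (Submodule.add_mem _ hx' (Submodule.neg_mem _ hy'))
    · right
      rw [(hF.bessel hR (hR.inner_self u (hAR hu))).2 (by
        rw [Finset.sum_congr rfl hc', Finset.sum_const, hc]; norm_num)]
      exact Submodule.sum_mem _ fun x hx => Submodule.smul_mem _ _ (Submodule.subset_span hx)
  -- Each element of A is orthogonal to the frame or in its span; connectedness, and the frame lying
  -- in the span of A, exclude the first.
  have hnot : ∀ u ∈ A, ¬ ∀ x ∈ F, ⟪x, u⟫ = 0 := by
    set S := A.filter (fun u => ¬ ∀ x ∈ F, ⟪x, u⟫ = 0) with hS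
    have hSA : S ⊆ A := Finset.filter_subset _ A
    have hSne : S.Nonempty := by
      by_contra hcon
      rw [Finset.not_nonempty_iff_eq_empty] at hcon
      have hall : ∀ u ∈ A, ∀ x ∈ F, ⟪x, u⟫ = 0 := fun u hu => by
        by_contra hc
        have : u ∈ S := Finset.mem_filter.2 ⟨hu, hc⟩
        rw [hcon] at this
        simp at this
      obtain ⟨x, hx⟩ := Finset.card_pos.1 (show 0 < F.card by omega)
      have := inner_eq_zero_of_forall_mem (x := x) (hF.mem_span x hx) fun u hu => hall u hu x hx
      rw [hR.inner_self x (hF.mem x hx)] at this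
      norm_num at this
    rcases hSA.eq_or_ssubset with he | hss
    · intro u hu
      rw [← he] at hu
      exact (Finset.mem_filter.1 hu).2
    · obtain ⟨s, hs, t, ht, htS, hst⟩ := hA.exists_inner_ne_zero hss hSne
      exfalso
      obtain ⟨hsA, hs'⟩ := Finset.mem_filter.1 hs
      have ht' : ∀ x ∈ F, ⟪t, x⟫ = 0 := by
        by_contra hc
        exact htS (Finset.mem_filter.2 ⟨ht, fun h => hc fun x hx => by
          rw [real_inner_comm]; exact h x hx⟩)
      apply hst
      rw [real_inner_comm]
      exact inner_eq_zero_of_forall_mem ((hspan s hsA).resolve_left hs') ht'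
  -- The frame has at most dim W = A.card - 1 elements, so each bound of A by the frame size is
  -- contradictory.
  have hle := hF.card_le hR
  have hrank : Module.finrank ℝ W + 1 = A.card := hA.finrank_span
  by_cases hex : ∃ u ∈ A, F.card = 4 ∧ ∀ x ∈ F, ⟪x, u⟫ ^ 2 = 1 / 4
  · obtain ⟨η, hη, hF4, hη'⟩ := hex
    have := hF.card_le_four h hR hF4 hAL
      (fun u hu => ((hcases u hu).resolve_left (hnot u hu)).imp_right (Or.imp_right And.right))
      ⟨η, hη, hη'⟩
    omega
  · have := hF.card_le_card h hR (Finset.card_pos.1 (by omega)) hAL fun u hu =>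
      ((hcases u hu).resolve_left (hnot u hu)).imp_right fun h =>
        h.resolve_right fun h' => hex ⟨u, hu, h'⟩
    omega

end HalfSpin

end DominantRegions

namespace DominantRegions

/-! ### Positivity of Gram determinants under conjugation -/

section Conjugate

variable {V : Type*} [NormedAddCommGroup V] [InnerProductSpace ℝ V]
variable {R : Set V} {m : ℕ} {b : Fin m → V} {P : Matrix (Fin m) (Fin m) Golden}

theorem conjVal_injective : Function.Injective conjVal := by
  rw [injective_iff_map_eq_zero]
  intro z hz
  rw [conjVal_apply] at hz
  have him : z.im = 0 := by
    by_contra h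
    refine Real.goldenConj_irrational ⟨-z.re / z.im, ?_⟩
    have : (z.im : ℝ) ≠ 0 := by exact_mod_cast h
    push_cast
    rw [div_eq_iff this]
    linarith
  rw [him] at hz
  have hre : z.re = 0 := by simpa using hz
  exact QuadraticAlgebra.ext hre him

/-- Up to a positive factor this is the determinant of a positive definite Gram matrix. -/
theorem goldenVal_det_pos (hb : LinearIndependent ℝ b)
    (hP : ∀ i j, goldenVal (P i j) = 2 * ⟪b i, b j⟫) : 0 < goldenVal P.det := by
  have h1 := (Matrix.posDef_gram_iff_linearIndependent (𝕜 := ℝ)).2 hb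
  have h2 : goldenVal.mapMatrix P = (2 : ℝ) • Matrix.gram ℝ b := by
    ext i j
    simp [hP, Matrix.gram_apply]
  rw [RingHom.map_det, h2, Matrix.det_smul]
  have := h1.det_pos
  positivity

/-- The linear combination of the vectors `b` with golden coefficients `r`. -/
noncomputable def comb (b : Fin m → V) (r : Fin m → Golden) : V := ∑ i, goldenVal (r i) • b i

theorem comb_injective (hb : LinearIndependent ℝ b) : Function.Injective (comb b) := by
  intro r s h
  funext i
  have h1 : ∑ i, (goldenVal (r i) - goldenVal (s i)) • b i = 0 := by
    simp only [sub_smul, Finset.sum_sub_distrib]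
    exact sub_eq_zero.2 h
  exact goldenVal_injective (sub_eq_zero.1 (Fintype.linearIndependent_iff.1 hb _ h1 i))

theorem goldenVal_mulVec (hP : ∀ i j, goldenVal (P i j) = 2 * ⟪b i, b j⟫) (r : Fin m → Golden)
    (j : Fin m) : goldenVal (P.mulVec r j) = 2 * ⟪b j, comb b r⟫ := by
  simp only [Matrix.mulVec, dotProduct, map_sum, map_mul, hP, comb, inner_sum,
    real_inner_smul_right, Finset.mul_sum]
  exact Finset.sum_congr rfl fun i _ => by ring

/-- The action of the reflection in `b j` on coefficients. -/
def reflCoef (P : Matrix (Fin m) (Fin m) Golden) (j : Fin m) (r : Fin m → Golden) :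
    Fin m → Golden := r - P.mulVec r j • Pi.single j 1

theorem comb_reflCoef (hP : ∀ i j, goldenVal (P i j) = 2 * ⟪b i, b j⟫) (j : Fin m)
    (r : Fin m → Golden) : comb b (reflCoef P j r) = refl (b j) (comb b r) := by
  have h1 : ∀ i, goldenVal (reflCoef P j r i) • b i =
      goldenVal (r i) • b i - if i = j then goldenVal (P.mulVec r j) • b j else 0 := by
    intro i
    by_cases hij : i = j
    · subst hij; simp [reflCoef, sub_smul]
    · simp [reflCoef, hij]
  rw [comb, Finset.sum_congr rfl fun i _ => h1 i, Finset.sum_sub_distrib,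
    Finset.sum_ite_eq' Finset.univ j, if_pos (Finset.mem_univ _), goldenVal_mulVec hP]
  rfl

theorem mulVec_reflCoef (j i : Fin m) (r : Fin m → Golden) :
    P.mulVec (reflCoef P j r) i = P.mulVec r i - P.mulVec r j * P i j := by
  rw [reflCoef, Matrix.mulVec_sub, Matrix.mulVec_smul, Pi.sub_apply, Pi.smul_apply,
    Matrix.mulVec_single_one, smul_eq_mul]
  rfl

/-- The Gram matrix of independent elements of `R` keeps a positive determinant under
conjugation. -/
theorem conjVal_det_pos (hR : IsUnitRootSet R) (hbR : ∀ i, b i ∈ R) (hb : LinearIndependent ℝ b)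
    (hP : ∀ i j, goldenVal (P i j) = 2 * ⟪b i, b j⟫) : 0 < conjVal P.det := by
  classical
  have hdiag : ∀ j, P j j = 2 := fun j => goldenVal_injective (by
    rw [hP, hR.inner_self _ (hbR j), map_ofNat]; norm_num)
  have hfin : {r : Fin m → Golden | comb b r ∈ R}.Finite :=
    hR.finite.preimage (comb_injective hb).injOn
  set T := hfin.toFinset with hT
  have hmemT : ∀ r, r ∈ T ↔ comb b r ∈ R := fun r => hfin.mem_toFinset
  have hrefl : ∀ j, ∀ r ∈ T, reflCoef P j r ∈ T := fun j r hr => by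
    rw [hmemT, comb_reflCoef hP]
    exact hR.refl_mem _ (hbR j) _ ((hmemT r).1 hr)
  have hself : ∀ j r, P.mulVec (reflCoef P j r) j = -P.mulVec r j := fun j r => by
    rw [mulVec_reflCoef, hdiag]; ring
  have hinv : ∀ j r, reflCoef P j (reflCoef P j r) = r := fun j r => by
    conv_lhs => rw [reflCoef, hself]
    rw [reflCoef]
    module
  -- The columns of B list conjugated pairings with all roots in T, so BᵀB is an invariant positive
  -- semidefinite form obtained by summing over a finite reflection-stable set.
  set B : Matrix T (Fin m) ℝ := fun r i => conjVal (P.mulVec r i) with hB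
  have hq : ∀ i j, (B.conjTranspose * B) i j =
      ∑ r ∈ T, conjVal (P.mulVec r i) * conjVal (P.mulVec r j) := by
    intro i j
    rw [Matrix.mul_apply, ← Finset.sum_coe_sort T]
    rfl
  have hsym : ∀ i j, ∑ r ∈ T, conjVal (P.mulVec r i) * conjVal (P.mulVec r j) =
      ∑ r ∈ T, conjVal (P.mulVec (reflCoef P j r) i) * conjVal (P.mulVec (reflCoef P j r) j) := by
    intro i j
    exact (Finset.sum_nbij' (reflCoef P j) (reflCoef P j) (hrefl j) (hrefl j)
      (fun r _ => hinv j r) (fun r _ => hinv j r) fun r _ => rfl).symm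
  -- The reflection in b j permutes T and changes the sign of the j-th pairing; comparing both sums
  -- expresses column j through its diagonal entry. Thus half the conjugated Gram matrix becomes BᵀB
  -- after positive column scaling.
  have hrel : ∀ i j, (B.conjTranspose * B) i j =
      1 / 2 * conjVal (P i j) * (B.conjTranspose * B) j j := by
    intro i j
    have h1 := hsym i j
    have h2 : ∀ r, conjVal (P.mulVec (reflCoef P j r) i) * conjVal (P.mulVec (reflCoef P j r) j) =
        conjVal (P i j) * (conjVal (P.mulVec r j) * conjVal (P.mulVec r j)) -
          conjVal (P.mulVec r i) * conjVal (P.mulVec r j) := by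
      intro r
      rw [hself, mulVec_reflCoef, map_sub, map_mul, map_neg]; ring
    rw [Finset.sum_congr rfl fun r _ => h2 r, Finset.sum_sub_distrib, ← Finset.mul_sum] at h1
    rw [hq, hq]
    linarith
  have hpos : ∀ j, 0 < (B.conjTranspose * B) j j := by
    intro j
    rw [hq]
    refine Finset.sum_pos' (fun r _ => mul_self_nonneg _) ⟨Pi.single j 1, ?_, ?_⟩
    · rw [hmemT]
      have : comb b (Pi.single j 1) = b j := by
        rw [comb, Finset.sum_eq_single_of_mem j (Finset.mem_univ _)]
        · simp
        · intro i _ hij; simp [hij]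
      rw [this]; exact hbR j
    · rw [Matrix.mulVec_single_one]
      change 0 < conjVal (P j j) * conjVal (P j j)
      rw [hdiag, map_ofNat]; norm_num
  have hmat : B.conjTranspose * B =
      ((1 / 2 : ℝ) • conjVal.mapMatrix P) * Matrix.diagonal fun j => (B.conjTranspose * B) j j := by
    ext i j
    rw [Matrix.mul_diagonal, hrel i j]
    simp
  have hdet := (Matrix.posSemidef_conjTranspose_mul_self B).det_nonneg
  rw [hmat, Matrix.det_mul, Matrix.det_diagonal, Matrix.det_smul, ← RingHom.map_det] at hdet
  have hprod : 0 < ∏ j, (B.conjTranspose * B) j j := Finset.prod_pos fun j _ => hpos j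
  -- Semidefiniteness gives only a nonnegative determinant; strictness comes from injectivity of
  -- conjugation and independence of b.
  have hne : conjVal P.det ≠ 0 := by
    intro h0
    have h1 : P.det = 0 := conjVal_injective (h0.trans (map_zero _).symm)
    have := goldenVal_det_pos hb hP
    rw [h1, map_zero] at this
    exact lt_irrefl _ this
  refine lt_of_le_of_ne ?_ hne.symm
  by_contra hneg
  have h2 : (1 / 2 : ℝ) ^ Fintype.card (Fin m) * conjVal P.det < 0 :=
    mul_neg_of_pos_of_neg (by positivity) (not_le.1 hneg)
  exact absurd hdet (not_le.2 (mul_neg_of_neg_of_pos h2 hprod))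

end Conjugate

end DominantRegions

namespace DominantRegions

/-! ### Determinants and the finite search -/

section Determinants

/-! The ring operations of the golden integers in a form suited to evaluation in the kernel. -/

def gmul (x y : Golden) : Golden :=
  ⟨x.re * y.re + x.im * y.im, x.re * y.im + x.im * y.re + x.im * y.im⟩

def gadd (x y : Golden) : Golden := ⟨x.re + y.re, x.im + y.im⟩

def gsub (x y : Golden) : Golden := ⟨x.re - y.re, x.im - y.im⟩

def gsmul (n : ℤ) (x : Golden) : Golden := ⟨n * x.re, n * x.im⟩

/-- Testing for a zero first factor spares the evaluation of the cofactor in the second. -/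
def lmul (x y : Golden) : Golden := if x = ⟨0, 0⟩ then ⟨0, 0⟩ else gmul x y

theorem gmul_eq (x y : Golden) : gmul x y = x * y := by
  ext <;> simp [gmul]

theorem gadd_eq (x y : Golden) : gadd x y = x + y := rfl

theorem gsub_eq (x y : Golden) : gsub x y = x - y := rfl

theorem gsmul_eq (n : ℤ) (x : Golden) : gsmul n x = n * x := by
  ext <;> simp [gsmul]

theorem lmul_eq (x y : Golden) : lmul x y = x * y := by
  unfold lmul
  split_ifs with h
  · have h0 : x = 0 := h
    rw [h0, zero_mul]; rfl
  · exact gmul_eq x y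

/-- The determinant of a `2 × 2` matrix given by its entries. -/
def detAux2 (a1 a2 b1 b2 : Golden) : Golden :=
  gsub (gmul a1 b2)
    ((gmul a2 b1))

/-- The determinant of a `3 × 3` matrix given by its entries. -/
def detAux3 (a1 a2 a3 b1 b2 b3 c1 c2 c3 : Golden) : Golden :=
  gsub (lmul a1 (detAux2 b2 b3 c2 c3))
    (gsub (lmul a2 (detAux2 b1 b3 c1 c3))
    ((lmul a3 (detAux2 b1 b2 c1 c2))))

/-- The determinant of a `4 × 4` matrix given by its entries. -/
def detAux4 (a1 a2 a3 a4 b1 b2 b3 b4 c1 c2 c3 c4 d1 d2 d3 d4 : Golden) : Golden :=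
  gsub (lmul a1 (detAux3 b2 b3 b4 c2 c3 c4 d2 d3 d4))
    (gsub (lmul a2 (detAux3 b1 b3 b4 c1 c3 c4 d1 d3 d4))
    (gsub (lmul a3 (detAux3 b1 b2 b4 c1 c2 c4 d1 d2 d4))
    ((lmul a4 (detAux3 b1 b2 b3 c1 c2 c3 d1 d2 d3)))))

/-- The determinant of a `5 × 5` matrix given by its entries. -/
def detAux5 (a1 a2 a3 a4 a5 b1 b2 b3 b4 b5 c1 c2 c3 c4 c5 d1 d2 d3 d4 d5 e1 e2 e3 e4 e5 : Golden) : Golden :=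
  gsub (lmul a1 (detAux4 b2 b3 b4 b5 c2 c3 c4 c5 d2 d3 d4 d5 e2 e3 e4 e5))
    (gsub (lmul a2 (detAux4 b1 b3 b4 b5 c1 c3 c4 c5 d1 d3 d4 d5 e1 e3 e4 e5))
    (gsub (lmul a3 (detAux4 b1 b2 b4 b5 c1 c2 c4 c5 d1 d2 d4 d5 e1 e2 e4 e5))
    (gsub (lmul a4 (detAux4 b1 b2 b3 b5 c1 c2 c3 c5 d1 d2 d3 d5 e1 e2 e3 e5))
    ((lmul a5 (detAux4 b1 b2 b3 b4 c1 c2 c3 c4 d1 d2 d3 d4 e1 e2 e3 e4))))))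

theorem det_eq_detAux2 (M : Matrix (Fin 2) (Fin 2) Golden) :
    M.det = detAux2 (M 0 0) (M 0 1) (M 1 0) (M 1 1) := by
  rw [Matrix.det_fin_two, detAux2, gsub_eq, gmul_eq, gmul_eq]

theorem det_eq_detAux3 (M : Matrix (Fin 3) (Fin 3) Golden) :
    M.det = detAux3 (M 0 0) (M 0 1) (M 0 2)
      (M 1 0) (M 1 1) (M 1 2)
      (M 2 0) (M 2 1) (M 2 2) := by
  rw [Matrix.det_succ_row_zero, Fin.sum_univ_three, detAux3]
  simp only [det_eq_detAux2, Matrix.submatrix_apply, lmul_eq, gsub_eq]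
  simp [Fin.succAbove]
  ring

theorem det_eq_detAux4 (M : Matrix (Fin 4) (Fin 4) Golden) :
    M.det = detAux4 (M 0 0) (M 0 1) (M 0 2) (M 0 3)
      (M 1 0) (M 1 1) (M 1 2) (M 1 3)
      (M 2 0) (M 2 1) (M 2 2) (M 2 3)
      (M 3 0) (M 3 1) (M 3 2) (M 3 3) := by
  rw [Matrix.det_succ_row_zero, Fin.sum_univ_four, detAux4]
  simp only [det_eq_detAux3, Matrix.submatrix_apply, lmul_eq, gsub_eq]
  simp [Fin.succAbove]
  ring

theorem det_eq_detAux5 (M : Matrix (Fin 5) (Fin 5) Golden) :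
    M.det = detAux5 (M 0 0) (M 0 1) (M 0 2) (M 0 3) (M 0 4)
      (M 1 0) (M 1 1) (M 1 2) (M 1 3) (M 1 4)
      (M 2 0) (M 2 1) (M 2 2) (M 2 3) (M 2 4)
      (M 3 0) (M 3 1) (M 3 2) (M 3 3) (M 3 4)
      (M 4 0) (M 4 1) (M 4 2) (M 4 3) (M 4 4) := by
  rw [Matrix.det_succ_row_zero, Fin.sum_univ_five, detAux5]
  simp only [det_eq_detAux4, Matrix.submatrix_apply, lmul_eq, gsub_eq]
  simp [Fin.succAbove]
  ring

/-- The determinant of a symmetric `3 × 3` matrix with diagonal entries `2`. -/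
def triDet (a b c : Golden) : Golden :=
  gadd ⟨8, 0⟩ (gadd (gsmul 2 (gmul a (gmul b c)))
    (gsmul (-2) (gadd (gmul a a) (gadd (gmul b b) (gmul c c)))))

/-- The determinant of a symmetric `4 × 4` matrix with diagonal entries `2`. -/
def quadDet (a b c d e f : Golden) : Golden :=
  gadd ⟨16, 0⟩ (gadd (gsmul (-4) (gadd (gmul a a) (gadd (gmul b b) (gadd (gmul c c)
    (gadd (gmul d d) (gadd (gmul e e) (gmul f f)))))))
   (gadd (gsmul 4 (gadd (gmul (gmul a b) c) (gadd (gmul (gmul a d) e)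
    (gadd (gmul (gmul b d) f) (gmul (gmul c e) f)))))
   (gadd (gadd (gmul (gmul a f) (gmul a f)) (gadd (gmul (gmul b e) (gmul b e))
    (gmul (gmul c d) (gmul c d))))
     (gsmul (-2) (gadd (gmul (gmul a f) (gmul b e)) (gadd (gmul (gmul a f) (gmul c d))
      (gmul (gmul b e) (gmul c d))))))))

theorem triDet_eq (a b c : Golden) : triDet a b c = detAux3 2 a b a 2 c b c 2 := by
  simp only [triDet, detAux3, detAux2, lmul_eq, gmul_eq, gadd_eq, gsub_eq, gsmul_eq]
  rw [show (⟨8, 0⟩ : Golden) = 8 from rfl]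
  push_cast
  ring

theorem quadDet_eq (a b c d e f : Golden) :
    quadDet a b c d e f = detAux4 2 a b d a 2 c e b c 2 f d e f 2 := by
  simp only [quadDet, detAux4, detAux3, detAux2, lmul_eq, gmul_eq, gadd_eq, gsub_eq, gsmul_eq]
  rw [show (⟨16, 0⟩ : Golden) = 16 from rfl]
  push_cast
  ring

/-- The golden integer has positive trace and norm. -/
def IsTotPos (z : Golden) : Prop :=
  0 < 2 * z.re + z.im ∧ 0 < z.re * z.re + z.re * z.im - z.im * z.im

instance : DecidablePred IsTotPos := fun _ => inferInstanceAs (Decidable (_ ∧ _))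

theorem isTotPos_of_pos {z : Golden} (h₁ : 0 < goldenVal z) (h₂ : 0 < conjVal z) : IsTotPos z := by
  have hs := Real.goldenRatio_add_goldenConj
  have hm := Real.goldenRatio_mul_goldenConj
  have h3 := add_pos h₁ h₂
  have h4 := mul_pos h₁ h₂
  rw [goldenVal_apply, conjVal_apply] at h3 h4
  have e3 : (z.re + z.im * Real.goldenRatio) + (z.re + z.im * Real.goldenConj) =
      2 * z.re + z.im * (Real.goldenRatio + Real.goldenConj) := by ring
  have e4 : (z.re + z.im * Real.goldenRatio) * (z.re + z.im * Real.goldenConj) =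
      z.re * z.re + z.re * z.im * (Real.goldenRatio + Real.goldenConj) +
        z.im * z.im * (Real.goldenRatio * Real.goldenConj) := by ring
  rw [e3, hs] at h3
  rw [e4, hs, hm] at h4
  constructor
  · have : (0 : ℝ) < ((2 * z.re + z.im : ℤ) : ℝ) := by push_cast; linarith
    exact_mod_cast this
  · have : (0 : ℝ) < ((z.re * z.re + z.re * z.im - z.im * z.im : ℤ) : ℝ) := by
      push_cast; linarith
    exact_mod_cast this

/-- The possible values of twice the inner product of two elements of a circuit. -/
def bonds : List Golden := [0, ⟨-1, 0⟩, ⟨-1, 1⟩, ⟨0, -1⟩]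

set_option synthInstance.maxHeartbeats 400000 in
set_option synthInstance.maxSize 4000 in
set_option maxRecDepth 10000 in
-- The six letters are the bonds 02, 12, 03, 13, 23 and the fixed bond 01 of value φ - 1; the
-- disjunctions attach each new vertex to an earlier one. A vanishing Gram determinant is
-- incompatible with a relation of coefficient sum zero, which the row of ones detects. Conditions
-- are interleaved with the quantifiers to prune the search early.
theorem no_four_circuit : ∀ b ∈ bonds, ∀ c ∈ bonds, (b ≠ 0 ∨ c ≠ 0) →
    IsTotPos (triDet ⟨-1, 1⟩ b c) →
    ∀ d ∈ bonds, ∀ e ∈ bonds, IsTotPos (triDet ⟨-1, 1⟩ d e) →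
    ∀ f ∈ bonds, (d ≠ 0 ∨ e ≠ 0 ∨ f ≠ 0) →
    IsTotPos (triDet b d f) → IsTotPos (triDet c e f) →
    quadDet ⟨-1, 1⟩ b c d e f = 0 →
    detAux4 1 1 1 1 ⟨-1, 1⟩ 2 c e b c 2 f d e f 2 ≠ 0 := by
  decide +kernel

/-- The entry in position `(p, q)` of a symmetric `5 × 5` matrix with diagonal entries `2`. -/
def bondMat (a b c d e f g h i j : Golden) : Fin 5 → Fin 5 → Golden :=
  ![![2, a, b, d, g], ![a, 2, c, e, h], ![b, c, 2, f, i], ![d, e, f, 2, j], ![g, h, i, j, 2]]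

set_option synthInstance.maxHeartbeats 1000000 in
set_option synthInstance.maxSize 10000 in
set_option maxRecDepth 10000 in
-- The first conclusion excludes circuits with at least six elements, whose five-element subsets are
-- independent. The second serves circuits with exactly five: the singular cases compatible with
-- coefficient sum zero all contain the path refuted by `false_of_path`.
theorem five_circuit_cases : ∀ b ∈ bonds, ∀ c ∈ bonds, (b ≠ 0 ∨ c ≠ 0) →
    IsTotPos (triDet ⟨-1, 1⟩ b c) →
    ∀ d ∈ bonds, ∀ e ∈ bonds, IsTotPos (triDet ⟨-1, 1⟩ d e) →
    ∀ f ∈ bonds, (d ≠ 0 ∨ e ≠ 0 ∨ f ≠ 0) →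
    IsTotPos (triDet b d f) → IsTotPos (triDet c e f) →
    IsTotPos (quadDet ⟨-1, 1⟩ b c d e f) →
    ∀ g ∈ bonds, ∀ h ∈ bonds, IsTotPos (triDet ⟨-1, 1⟩ g h) →
    ∀ i ∈ bonds, IsTotPos (triDet b g i) → IsTotPos (triDet c h i) →
    IsTotPos (quadDet ⟨-1, 1⟩ b c g h i) →
    ∀ j ∈ bonds, (g ≠ 0 ∨ h ≠ 0 ∨ i ≠ 0 ∨ j ≠ 0) →
    IsTotPos (triDet d g j) → IsTotPos (triDet e h j) → IsTotPos (triDet f i j) →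
    IsTotPos (quadDet ⟨-1, 1⟩ d e g h j) →
    IsTotPos (quadDet b d f g i j) →
    IsTotPos (quadDet c e f h i j) →
    ¬ IsTotPos (detAux5 2 ⟨-1, 1⟩ b d g ⟨-1, 1⟩ 2 c e h b c 2 f i d e f 2 j g h i j 2) ∧
    (detAux5 2 ⟨-1, 1⟩ b d g ⟨-1, 1⟩ 2 c e h b c 2 f i d e f 2 j g h i j 2 = 0 →
      detAux5 1 1 1 1 1 ⟨-1, 1⟩ 2 c e h b c 2 f i d e f 2 j g h i j 2 = 0 →
      ∃ p q r s : Fin 5, bondMat ⟨-1, 1⟩ b c d e f g h i j p q = ⟨0, -1⟩ ∧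
        bondMat ⟨-1, 1⟩ b c d e f g h i j q r = ⟨-1, 1⟩ ∧
        bondMat ⟨-1, 1⟩ b c d e f g h i j r s = ⟨0, -1⟩ ∧
        bondMat ⟨-1, 1⟩ b c d e f g h i j p r = 0 ∧
        bondMat ⟨-1, 1⟩ b c d e f g h i j q s = 0 ∧
        bondMat ⟨-1, 1⟩ b c d e f g h i j p s = 0) := by
  decide +kernel

end Determinants

end DominantRegions

namespace DominantRegions

/-! ### Independence of the level set -/

section Independence

variable {V : Type*} [NormedAddCommGroup V] [InnerProductSpace ℝ V]
variable {R : Set V} {f : V →ₗ[ℝ] ℝ} {lam : V → ℝ} {A : Finset V}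

theorem injective_vec3 {α : Type*} {a b c : α} (h₁ : a ≠ b) (h₂ : a ≠ c) (h₃ : b ≠ c) :
    Function.Injective ![a, b, c] := by
  intro i j hij
  fin_cases i <;> fin_cases j <;> simp_all

theorem injective_vec4 {α : Type*} {a b c d : α} (h₁ : a ≠ b) (h₂ : a ≠ c) (h₃ : b ≠ c)
    (h₄ : a ≠ d) (h₅ : b ≠ d) (h₆ : c ≠ d) : Function.Injective ![a, b, c, d] := by
  intro i j hij
  fin_cases i <;> fin_cases j <;> simp_all

theorem injective_vec5 {α : Type*} {a b c d e : α} (h₁ : a ≠ b) (h₂ : a ≠ c) (h₃ : b ≠ c)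
    (h₄ : a ≠ d) (h₅ : b ≠ d) (h₆ : c ≠ d) (h₇ : a ≠ e) (h₈ : b ≠ e) (h₉ : c ≠ e) (h₁₀ : d ≠ e) :
    Function.Injective ![a, b, c, d, e] := by
  intro i j hij
  fin_cases i <;> fin_cases j <;> simp_all

/-- Fewer elements than the whole circuit are independent, so both embeddings of their Gram
determinant are positive. -/
theorem IsCircuit.isTotPos_det (hA : IsCircuit A) (hR : IsUnitRootSet R) (hAR : (A : Set V) ⊆ R)
    {m : ℕ} {x : Fin m → V} (hx : Function.Injective x) (hxA : ∀ i, x i ∈ A) (hm : m < A.card)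
    {P : Matrix (Fin m) (Fin m) Golden} (hP : ∀ i j, goldenVal (P i j) = 2 * ⟪x i, x j⟫) :
    IsTotPos P.det := by
  classical
  have hsub : Finset.univ.image x ⊂ A := by
    refine Finset.ssubset_iff_subset_ne.2 ⟨fun u hu => ?_, fun he => ?_⟩
    · obtain ⟨i, -, rfl⟩ := Finset.mem_image.1 hu
      exact hxA i
    · have := Finset.card_image_of_injective Finset.univ hx
      rw [he, Finset.card_univ, Fintype.card_fin] at this
      omega
  have hli := hA.indep _ hsub
  rw [Finset.coe_image, Finset.coe_univ, Set.image_univ, linearIndepOn_id_range_iff hx] at hli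
  exact isTotPos_of_pos (goldenVal_det_pos hli hP)
    (conjVal_det_pos hR (fun i => hAR (hxA i)) hli hP)

/-- The coefficients of the relation form a kernel vector of the Gram matrix. Their sum is zero, so
this survives replacing a row by ones. -/
theorem IsCircuit.det_eq_zero (hA : IsCircuit A) {m : ℕ} {x : Fin (m + 1) → V}
    (hx : Function.Injective x) (hxA : ∀ i, x i ∈ A) (hm : A.card = m + 1)
    (hf : ∀ c : V → ℝ, ∑ u ∈ A, c u • u = 0 → ∑ u ∈ A, c u = 0)
    {P : Matrix (Fin (m + 1)) (Fin (m + 1)) Golden}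
    (hP : ∀ i j, goldenVal (P i j) = 2 * ⟪x i, x j⟫) :
    P.det = 0 ∧ (P.updateRow 0 fun _ => 1).det = 0 := by
  classical
  obtain ⟨c, hc0, hc⟩ := hA.exists_relation
  have himg : Finset.univ.image x = A := by
    refine Finset.eq_of_subset_of_card_le (fun u hu => ?_) ?_
    · obtain ⟨i, -, rfl⟩ := Finset.mem_image.1 hu
      exact hxA i
    · rw [Finset.card_image_of_injective _ hx, Finset.card_univ, Fintype.card_fin, hm]
  have hsum := hf c hc
  rw [← himg, Finset.sum_image hx.injOn] at hc hsum
  have hker : ∀ i, ∑ j, goldenVal (P i j) * c (x j) = 0 := by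
    intro i
    have : ∑ j, goldenVal (P i j) * c (x j) = 2 * ⟪x i, ∑ j, c (x j) • x j⟫ := by
      rw [inner_sum, Finset.mul_sum]
      exact Finset.sum_congr rfl fun j _ => by rw [hP, real_inner_smul_right]; ring
    rw [this, hc, inner_zero_right, mul_zero]
  have hv : (fun j => c (x j)) ≠ 0 := fun h => hc0 _ (hxA 0) (congrFun h 0)
  have key : ∀ Q : Matrix (Fin (m + 1)) (Fin (m + 1)) Golden,
      (∀ i, ∑ j, goldenVal (Q i j) * c (x j) = 0) → Q.det = 0 := by
    intro Q hQ
    apply goldenVal_injective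
    rw [RingHom.map_det, map_zero]
    exact Matrix.exists_mulVec_eq_zero_iff.1 ⟨_, hv, funext hQ⟩
  refine ⟨key P hker, key _ fun i => ?_⟩
  by_cases hi : i = 0
  · subst hi
    simpa using hsum
  · simpa [Matrix.updateRow_ne hi] using hker i

/-- The level set contains no path of three edges of orders `5 / 2`, `5`, `5 / 2`. -/
theorem false_of_path (hR : IsUnitRootSet R) (h : IsLevel R f lam) {w x y z : V}
    (hw : w ∈ levelSet R f lam) (hx : x ∈ levelSet R f lam) (hy : y ∈ levelSet R f lam)
    (hz : z ∈ levelSet R f lam) (hlx : lam x = lam w) (hly : lam y = lam w) (hlz : lam z = lam w)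
    (hwx : 2 * ⟪w, x⟫ = -Real.goldenRatio) (hxy : 2 * ⟪x, y⟫ = Real.goldenRatio - 1)
    (hyz : 2 * ⟪y, z⟫ = -Real.goldenRatio) (hwy : ⟪w, y⟫ = 0) (hxz : ⟪x, z⟫ = 0)
    (hwz : ⟪w, z⟫ = 0) : False := by
  have hφ := Real.goldenRatio_sq
  have h1 : refl y z = z + Real.goldenRatio • y := by rw [refl, hyz]; module
  have h2 : refl x (refl y z) = z + Real.goldenRatio • y - x := by
    have : 2 * ⟪x, refl y z⟫ = 1 := by
      rw [h1, inner_add_right, real_inner_smul_right, hxz]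
      linear_combination Real.goldenRatio * hxy + hφ
    rw [refl, this, h1]; module
  -- The coefficients 1, φ, -1, -φ of this root sum to zero, and `f` is constant on the four
  -- vectors.
  have h3 : refl w (refl x (refl y z)) =
      z + Real.goldenRatio • y - x - Real.goldenRatio • w := by
    have : 2 * ⟪w, refl x (refl y z)⟫ = Real.goldenRatio := by
      rw [h2, inner_sub_right, inner_add_right, real_inner_smul_right, hwz, hwy]; linarith
    rw [refl, this, h2]
  have hmem := hR.refl_mem w hw.1 _ (hR.refl_mem x hx.1 _ (hR.refl_mem y hy.1 z hz.1))
  refine h.ne_zero _ hmem ?_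
  rw [h3, map_sub, map_sub, map_add, map_smul, map_smul, hw.2, hx.2, hy.2, hz.2, hlx, hly, hlz]
  simp only [smul_eq_mul]
  ring

/-- Vectors in an open half space with pairwise nonpositive inner products are not a circuit. -/
theorem IsCircuit.exists_inner_pos (hA : IsCircuit A) (hpos : ∀ u ∈ A, 0 < f u) :
    ∃ u ∈ A, ∃ w ∈ A, u ≠ w ∧ 0 < ⟪u, w⟫ := by
  classical
  by_contra! hcon
  obtain ⟨c, hc0, hc⟩ := hA.exists_relation
  rw [← Finset.sum_filter_add_sum_filter_not A (fun u => 0 < c u)] at hc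
  set S := A.filter (fun u => 0 < c u) with hS
  set T := A.filter (fun u => ¬ 0 < c u) with hT
  have hSp : ∀ u ∈ S, u ∈ A ∧ 0 < c u := fun u hu => Finset.mem_filter.1 hu
  have hTn : ∀ u ∈ T, u ∈ A ∧ c u < 0 := fun u hu => by
    obtain ⟨h1, h2⟩ := Finset.mem_filter.1 hu
    exact ⟨h1, lt_of_le_of_ne (not_lt.1 h2) (hc0 u h1)⟩
  -- Splitting the relation by sign gives two opposite vectors with nonnegative inner product, so
  -- both vanish; but `f` has a strict sign on a nonempty part.
  have hip : 0 ≤ ⟪∑ u ∈ S, c u • u, ∑ u ∈ T, c u • u⟫ := by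
    rw [sum_inner]
    refine Finset.sum_nonneg fun u hu => ?_
    rw [inner_sum]
    refine Finset.sum_nonneg fun w hw => ?_
    rw [real_inner_smul_left, real_inner_smul_right]
    obtain ⟨huA, huc⟩ := hSp u hu
    obtain ⟨hwA, hwc⟩ := hTn w hw
    have huw : u ≠ w := fun e => by rw [e] at huc; exact lt_asymm huc hwc
    have := mul_nonneg_of_nonpos_of_nonpos hwc.le (hcon u huA w hwA huw)
    exact mul_nonneg huc.le this
  have hx : ∑ u ∈ S, c u • u = 0 := by
    rw [eq_neg_of_add_eq_zero_right hc, inner_neg_right] at hip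
    have := real_inner_self_nonneg (x := ∑ u ∈ S, c u • u)
    have h0 : ⟪∑ u ∈ S, c u • u, ∑ u ∈ S, c u • u⟫ = 0 := le_antisymm (by linarith) this
    exact inner_self_eq_zero.1 h0
  have hy : ∑ u ∈ T, c u • u = 0 := by rw [hx, zero_add] at hc; exact hc
  obtain ⟨u, hu⟩ := hA.nonempty
  have h1 := congrArg f hx
  have h2 := congrArg f hy
  simp only [map_sum, map_smul, map_zero, smul_eq_mul] at h1 h2
  by_cases hcu : 0 < c u
  · have := Finset.sum_pos (s := S) (f := fun u => c u * f u)
      (fun u hu => mul_pos (hSp u hu).2 (hpos u (hSp u hu).1)) ⟨u, Finset.mem_filter.2 ⟨hu, hcu⟩⟩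
    linarith
  · have := Finset.sum_neg (s := T) (f := fun u => c u * f u)
      (fun u hu => mul_neg_of_neg_of_pos (hTn u hu).2 (hpos u (hTn u hu).1))
      ⟨u, Finset.mem_filter.2 ⟨hu, hcu⟩⟩
    linarith

set_option maxHeartbeats 2000000 in
/-- The level set contains no circuit. -/
theorem not_isCircuit (hR : IsUnitRootSet R) (h : IsLevel R f lam)
    (hAL : (A : Set V) ⊆ levelSet R f lam) : ¬ IsCircuit A := by
  classical
  intro hA
  have hAR : (A : Set V) ⊆ R := fun x hx => (hAL hx).1
  have hA4 := hA.four_le_card hR h hAL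
  have hfpos : ∀ u ∈ A, 0 < f u := fun u hu => by rw [(hAL hu).2]; exact h.pos u (hAR hu)
  have hcases : ∀ u ∈ A, ∀ w ∈ A, u ≠ w → ⟪u, w⟫ = 0 ∨ (lam u = lam w ∧ (⟪u, w⟫ = -1 / 2 ∨
      ⟪u, w⟫ = (Real.goldenRatio - 1) / 2 ∨ ⟪u, w⟫ = -Real.goldenRatio / 2)) := by
    intro u hu w hw huw
    rcases hA.inner_cases hR h hAL hA4 hu hw huw with hc | hc | hc
    · exact Or.inl hc
    · exact absurd hc (hA.inner_sq_ne_half hR h hAL hu hw)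
    · exact Or.inr hc
  -- `lam` is constant on `A`
  obtain ⟨u₀, hu₀⟩ := hA.nonempty
  have hlam : ∀ u ∈ A, lam u = lam u₀ := by
    set S := A.filter (fun u => lam u = lam u₀) with hS
    have hSA : S ⊆ A := Finset.filter_subset _ A
    rcases hSA.eq_or_ssubset with he | hss
    · intro u hu
      rw [← he] at hu
      exact (Finset.mem_filter.1 hu).2
    · obtain ⟨s, hs, t, ht, htS, hst⟩ :=
        hA.exists_inner_ne_zero hss ⟨u₀, Finset.mem_filter.2 ⟨hu₀, rfl⟩⟩
      obtain ⟨hsA, hs'⟩ := Finset.mem_filter.1 hs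
      have hne : s ≠ t := fun e => htS (e ▸ hs)
      rcases hcases s hsA t ht hne with hc | hc
      · exact absurd hc hst
      · exact absurd (Finset.mem_filter.2 ⟨ht, hc.1 ▸ hs'⟩) htS
  have hrel : ∀ c : V → ℝ, ∑ u ∈ A, c u • u = 0 → ∑ u ∈ A, c u = 0 := by
    intro c hc
    have h1 := congrArg f hc
    simp only [map_sum, map_smul, map_zero, smul_eq_mul] at h1
    rw [Finset.sum_congr rfl fun u hu => by rw [(hAL hu).2, hlam u hu], ← Finset.sum_mul] at h1
    exact (mul_eq_zero.1 h1).resolve_right (h.pos u₀ (hAR hu₀)).ne'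
  -- twice the inner products as golden integers
  have hcode : ∀ u ∈ A, ∀ w ∈ A, ∃ z : Golden, goldenVal z = 2 * ⟪u, w⟫ ∧ (u ≠ w → z ∈ bonds) := by
    intro u hu w hw
    by_cases huw : u = w
    · subst huw
      exact ⟨2, by rw [map_ofNat, hR.inner_self u (hAR hu)]; norm_num, fun h => absurd rfl h⟩
    · rcases hcases u hu w hw huw with hc | ⟨-, hc | hc | hc⟩
      · exact ⟨0, by rw [hc, map_zero, mul_zero], fun _ => by simp [bonds]⟩
      · exact ⟨⟨-1, 0⟩, by rw [hc, goldenVal_apply]; norm_num, fun _ => by simp [bonds]⟩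
      · exact ⟨⟨-1, 1⟩, by rw [hc, goldenVal_apply]; push_cast; ring, fun _ => by simp [bonds]⟩
      · exact ⟨⟨0, -1⟩, by rw [hc, goldenVal_apply]; push_cast; ring, fun _ => by simp [bonds]⟩
  choose! p hp hpb using hcode
  have hp0 : ∀ u ∈ A, p u u = 2 := fun u hu => goldenVal_injective (by
    rw [hp u hu u hu, hR.inner_self u (hAR hu), map_ofNat]; norm_num)
  have hps : ∀ u ∈ A, ∀ w ∈ A, p u w = p w u := fun u hu w hw => goldenVal_injective (by
    rw [hp u hu w hw, hp w hw u hu, real_inner_comm])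
  have hpne : ∀ u ∈ A, ∀ w ∈ A, ⟪u, w⟫ ≠ 0 → p u w ≠ 0 := by
    intro u hu w hw hne h0
    have := hp u hu w hw
    rw [h0, map_zero] at this
    exact hne (by linarith)
  have hp5 : ∀ u ∈ A, ∀ w ∈ A, p u w = ⟨0, -1⟩ → 2 * ⟪u, w⟫ = -Real.goldenRatio := by
    intro u hu w hw he
    rw [← hp u hu w hw, he, goldenVal_apply]; push_cast; ring
  have hpr : ∀ u ∈ A, ∀ w ∈ A, p u w = ⟨-1, 1⟩ → 2 * ⟪u, w⟫ = Real.goldenRatio - 1 := by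
    intro u hu w hw he
    rw [← hp u hu w hw, he, goldenVal_apply]; push_cast; ring
  have hpz : ∀ u ∈ A, ∀ w ∈ A, p u w = 0 → ⟪u, w⟫ = 0 := by
    intro u hu w hw he
    have := hp u hu w hw
    rw [he, map_zero] at this
    linarith
  -- positivity of small determinants
  have htri : ∀ u ∈ A, ∀ v ∈ A, ∀ w ∈ A, u ≠ v → u ≠ w → v ≠ w →
      IsTotPos (triDet (p u v) (p u w) (p v w)) := by
    intro u hu v hv w hw huv huw hvw
    have hxA : ∀ i, ![u, v, w] i ∈ A := by
      intro i; fin_cases i <;> assumption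
    have hx : Function.Injective ![u, v, w] :=
      injective_vec3 huv huw hvw
    have := hA.isTotPos_det hR hAR hx hxA (by omega)
      (P := Matrix.of fun i j => p (![u, v, w] i) (![u, v, w] j))
      fun i j => hp _ (hxA i) _ (hxA j)
    rw [det_eq_detAux3] at this
    simp only [Matrix.of_apply, Matrix.cons_val] at this
    rw [hp0 u hu, hp0 v hv, hp0 w hw, hps v hv u hu, hps w hw u hu, hps w hw v hv] at this
    rwa [triDet_eq]
  have hquad : 5 ≤ A.card → ∀ u ∈ A, ∀ v ∈ A, ∀ w ∈ A, ∀ z ∈ A, u ≠ v → u ≠ w → v ≠ w →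
      u ≠ z → v ≠ z → w ≠ z →
      IsTotPos (quadDet (p u v) (p u w) (p v w) (p u z) (p v z) (p w z)) := by
    intro hA5 u hu v hv w hw z hz huv huw hvw huz hvz hwz
    have hxA : ∀ i, ![u, v, w, z] i ∈ A := by
      intro i; fin_cases i <;> assumption
    have hx : Function.Injective ![u, v, w, z] :=
      injective_vec4 huv huw hvw huz hvz hwz
    have := hA.isTotPos_det hR hAR hx hxA (by omega)
      (P := Matrix.of fun i j => p (![u, v, w, z] i) (![u, v, w, z] j))
      fun i j => hp _ (hxA i) _ (hxA j)
    rw [det_eq_detAux4] at this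
    simp only [Matrix.of_apply, Matrix.cons_val] at this
    rw [hp0 u hu, hp0 v hv, hp0 w hw, hp0 z hz, hps v hv u hu, hps w hw u hu, hps w hw v hv,
      hps z hz u hu, hps z hz v hv, hps z hz w hw] at this
    rwa [quadDet_eq]
  -- an edge of order five with positive inner product
  obtain ⟨a₀, h₀, a₁, h₁, h01, hpos01⟩ := hA.exists_inner_pos hfpos
  have hred : p a₀ a₁ = ⟨-1, 1⟩ := by
    refine goldenVal_injective ?_
    rw [hp a₀ h₀ a₁ h₁, goldenVal_apply]
    rcases hcases a₀ h₀ a₁ h₁ h01 with hc | ⟨-, hc | hc | hc⟩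
    · rw [hc] at hpos01; exact absurd hpos01 (lt_irrefl _)
    · rw [hc] at hpos01; norm_num at hpos01
    · rw [hc]; push_cast; ring
    · rw [hc] at hpos01; linarith [Real.goldenRatio_pos]
  -- Vertices are added one at a time, each joined to an earlier one, as the search requires.
  have hnext : ∀ S ⊆ A, S.Nonempty → S.card < A.card →
      ∃ t ∈ A, t ∉ S ∧ ∃ s ∈ S, p s t ≠ 0 := by
    intro S hS hne hcard
    obtain ⟨s, hs, t, ht, htS, hst⟩ := hA.exists_inner_ne_zero
      (Finset.ssubset_iff_subset_ne.2 ⟨hS, fun e => by rw [e] at hcard; omega⟩) hne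
    exact ⟨t, ht, htS, s, hs, hpne s (hS hs) t ht hst⟩
  obtain ⟨a₂, h₂, h2S, hadj2⟩ := hnext {a₀, a₁} (by
      intro u hu
      simp only [Finset.mem_insert, Finset.mem_singleton] at hu
      rcases hu with rfl | rfl <;> assumption) (by simp)
    (by have := Finset.card_le_two (a := a₀) (b := a₁); omega)
  simp only [Finset.mem_insert, Finset.mem_singleton, not_or, exists_eq_or_imp,
    exists_eq_left] at h2S hadj2
  obtain ⟨a₃, h₃, h3S, hadj3⟩ := hnext {a₀, a₁, a₂} (by
      intro u hu
      simp only [Finset.mem_insert, Finset.mem_singleton] at hu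
      rcases hu with rfl | rfl | rfl <;> assumption) (by simp)
    (by have := Finset.card_le_three (a := a₀) (b := a₁) (c := a₂); omega)
  simp only [Finset.mem_insert, Finset.mem_singleton, not_or, exists_eq_or_imp,
    exists_eq_left] at h3S hadj3
  have n02 := Ne.symm h2S.1
  have n12 := Ne.symm h2S.2
  have n03 := Ne.symm h3S.1
  have n13 := Ne.symm h3S.2.1
  have n23 := Ne.symm h3S.2.2
  have t012 := htri _ h₀ _ h₁ _ h₂ h01 n02 n12
  have t013 := htri _ h₀ _ h₁ _ h₃ h01 n03 n13
  have t023 := htri _ h₀ _ h₂ _ h₃ n02 n03 n23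
  have t123 := htri _ h₁ _ h₂ _ h₃ n12 n13 n23
  have b02 := hpb _ h₀ _ h₂ n02
  have b12 := hpb _ h₁ _ h₂ n12
  have b03 := hpb _ h₀ _ h₃ n03
  have b13 := hpb _ h₁ _ h₃ n13
  have b23 := hpb _ h₂ _ h₃ n23
  rw [hred] at t012 t013
  rcases hA4.eq_or_lt with hA4 | hA5
  · have hxA : ∀ i, ![a₀, a₁, a₂, a₃] i ∈ A := by
      intro i; fin_cases i <;> assumption
    have hx : Function.Injective ![a₀, a₁, a₂, a₃] :=
      injective_vec4 h01 n02 n12 n03 n13 n23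
    obtain ⟨d1, d2⟩ := hA.det_eq_zero hx hxA hA4.symm hrel
      (P := Matrix.of fun i j => p (![a₀, a₁, a₂, a₃] i) (![a₀, a₁, a₂, a₃] j))
      fun i j => hp _ (hxA i) _ (hxA j)
    rw [det_eq_detAux4] at d1 d2
    simp only [Matrix.of_apply, Matrix.cons_val, Matrix.updateRow_apply] at d1 d2
    simp at d2
    rw [hp0 _ h₀, hp0 _ h₁, hp0 _ h₂, hp0 _ h₃, hps _ h₁ _ h₀, hps _ h₂ _ h₀, hps _ h₂ _ h₁,
      hps _ h₃ _ h₀, hps _ h₃ _ h₁, hps _ h₃ _ h₂, hred, ← quadDet_eq] at d1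
    rw [hp0 _ h₁, hp0 _ h₂, hp0 _ h₃, hps _ h₁ _ h₀, hps _ h₂ _ h₀, hps _ h₂ _ h₁,
      hps _ h₃ _ h₀, hps _ h₃ _ h₁, hps _ h₃ _ h₂, hred] at d2
    exact no_four_circuit _ b02 _ b12 hadj2 t012 _ b03 _ b13 t013 _ b23 hadj3 t023 t123 d1 d2
  · have hA5' : 5 ≤ A.card := hA5
    obtain ⟨a₄, h₄, h4S, hadj4⟩ := hnext {a₀, a₁, a₂, a₃} (by
        intro u hu
        simp only [Finset.mem_insert, Finset.mem_singleton] at hu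
        rcases hu with rfl | rfl | rfl | rfl <;> assumption) (by simp)
      (by have := Finset.card_le_four (a := a₀) (b := a₁) (c := a₂) (d := a₃); omega)
    simp only [Finset.mem_insert, Finset.mem_singleton, not_or, exists_eq_or_imp,
      exists_eq_left] at h4S hadj4
    have n04 := Ne.symm h4S.1
    have n14 := Ne.symm h4S.2.1
    have n24 := Ne.symm h4S.2.2.1
    have n34 := Ne.symm h4S.2.2.2
    have q0123 := hquad hA5' _ h₀ _ h₁ _ h₂ _ h₃ h01 n02 n12 n03 n13 n23
    have q0124 := hquad hA5' _ h₀ _ h₁ _ h₂ _ h₄ h01 n02 n12 n04 n14 n24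
    have q0134 := hquad hA5' _ h₀ _ h₁ _ h₃ _ h₄ h01 n03 n13 n04 n14 n34
    have q0234 := hquad hA5' _ h₀ _ h₂ _ h₃ _ h₄ n02 n03 n23 n04 n24 n34
    have q1234 := hquad hA5' _ h₁ _ h₂ _ h₃ _ h₄ n12 n13 n23 n14 n24 n34
    have t014 := htri _ h₀ _ h₁ _ h₄ h01 n04 n14
    have t024 := htri _ h₀ _ h₂ _ h₄ n02 n04 n24
    have t124 := htri _ h₁ _ h₂ _ h₄ n12 n14 n24
    have t034 := htri _ h₀ _ h₃ _ h₄ n03 n04 n34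
    have t134 := htri _ h₁ _ h₃ _ h₄ n13 n14 n34
    have t234 := htri _ h₂ _ h₃ _ h₄ n23 n24 n34
    rw [hred] at q0123 q0124 q0134 t014
    obtain ⟨hnp, hsing⟩ := five_circuit_cases _ b02 _ b12 hadj2 t012 _ b03 _ b13 t013 _ b23 hadj3
      t023 t123 q0123 _ (hpb _ h₀ _ h₄ n04) _ (hpb _ h₁ _ h₄ n14) t014 _ (hpb _ h₂ _ h₄ n24) t024
      t124 q0124 _ (hpb _ h₃ _ h₄ n34) hadj4 t034 t134 t234 q0134 q0234 q1234
    have hxA : ∀ i, ![a₀, a₁, a₂, a₃, a₄] i ∈ A := by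
      intro i; fin_cases i <;> assumption
    have hx : Function.Injective ![a₀, a₁, a₂, a₃, a₄] :=
      injective_vec5 h01 n02 n12 n03 n13 n23 n04 n14 n24 n34
    have hdet : (Matrix.of fun i j => p (![a₀, a₁, a₂, a₃, a₄] i) (![a₀, a₁, a₂, a₃, a₄] j)).det =
        detAux5 2 ⟨-1, 1⟩ (p a₀ a₂) (p a₀ a₃) (p a₀ a₄) ⟨-1, 1⟩ 2 (p a₁ a₂) (p a₁ a₃) (p a₁ a₄)
          (p a₀ a₂) (p a₁ a₂) 2 (p a₂ a₃) (p a₂ a₄) (p a₀ a₃) (p a₁ a₃) (p a₂ a₃) 2 (p a₃ a₄)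
          (p a₀ a₄) (p a₁ a₄) (p a₂ a₄) (p a₃ a₄) 2 := by
      rw [det_eq_detAux5]
      simp only [Matrix.of_apply, Matrix.cons_val]
      rw [hp0 _ h₀, hp0 _ h₁, hp0 _ h₂, hp0 _ h₃, hp0 _ h₄, hps _ h₁ _ h₀, hps _ h₂ _ h₀,
        hps _ h₂ _ h₁, hps _ h₃ _ h₀, hps _ h₃ _ h₁, hps _ h₃ _ h₂, hps _ h₄ _ h₀, hps _ h₄ _ h₁,
        hps _ h₄ _ h₂, hps _ h₄ _ h₃, hred]
    rcases hA5'.eq_or_lt with hA5 | hA6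
    · obtain ⟨d1, d2⟩ := hA.det_eq_zero hx hxA hA5.symm hrel
        (P := Matrix.of fun i j => p (![a₀, a₁, a₂, a₃, a₄] i) (![a₀, a₁, a₂, a₃, a₄] j))
        fun i j => hp _ (hxA i) _ (hxA j)
      rw [hdet] at d1
      rw [det_eq_detAux5] at d2
      simp only [Matrix.of_apply, Matrix.cons_val, Matrix.updateRow_apply] at d2
      simp at d2
      rw [hp0 _ h₁, hp0 _ h₂, hp0 _ h₃, hp0 _ h₄, hps _ h₁ _ h₀, hps _ h₂ _ h₀,
        hps _ h₂ _ h₁, hps _ h₃ _ h₀, hps _ h₃ _ h₁, hps _ h₃ _ h₂, hps _ h₄ _ h₀, hps _ h₄ _ h₁,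
        hps _ h₄ _ h₂, hps _ h₄ _ h₃, hred] at d2
      obtain ⟨i, j, k, l, e1, e2, e3, e4, e5, e6⟩ := hsing d1 d2
      have hmat : ∀ i j, bondMat ⟨-1, 1⟩ (p a₀ a₂) (p a₁ a₂) (p a₀ a₃) (p a₁ a₃) (p a₂ a₃)
          (p a₀ a₄) (p a₁ a₄) (p a₂ a₄) (p a₃ a₄) i j =
          p (![a₀, a₁, a₂, a₃, a₄] i) (![a₀, a₁, a₂, a₃, a₄] j) := by
        have hr' : p a₁ a₀ = ⟨-1, 1⟩ := by rw [hps _ h₁ _ h₀, hred]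
        intro i j
        fin_cases i <;> fin_cases j <;>
          simp only [bondMat, Fin.zero_eta, Fin.mk_one, Fin.reduceFinMk, Matrix.cons_val]
        · exact (hp0 _ h₀).symm
        · exact hred.symm
        · exact hr'.symm
        · exact (hp0 _ h₁).symm
        · exact hps _ h₀ _ h₂
        · exact hps _ h₁ _ h₂
        · exact (hp0 _ h₂).symm
        · exact hps _ h₀ _ h₃
        · exact hps _ h₁ _ h₃
        · exact hps _ h₂ _ h₃
        · exact (hp0 _ h₃).symm
        · exact hps _ h₀ _ h₄
        · exact hps _ h₁ _ h₄
        · exact hps _ h₂ _ h₄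
        · exact hps _ h₃ _ h₄
        · exact (hp0 _ h₄).symm
      rw [hmat] at e1 e2 e3 e4 e5 e6
      have hl : ∀ i j, lam (![a₀, a₁, a₂, a₃, a₄] i) = lam (![a₀, a₁, a₂, a₃, a₄] j) :=
        fun i j => (hlam _ (hxA i)).trans (hlam _ (hxA j)).symm
      exact false_of_path hR h (hAL (hxA i)) (hAL (hxA j)) (hAL (hxA k)) (hAL (hxA l)) (hl j i)
        (hl k i) (hl l i) (hp5 _ (hxA i) _ (hxA j) e1) (hpr _ (hxA j) _ (hxA k) e2)
        (hp5 _ (hxA k) _ (hxA l) e3) (hpz _ (hxA i) _ (hxA k) e4) (hpz _ (hxA j) _ (hxA l) e5)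
        (hpz _ (hxA i) _ (hxA l) e6)
    -- With six or more elements these five are independent, so their determinant would be totally
    -- positive.
    · have := hA.isTotPos_det hR hAR hx hxA hA6
        (P := Matrix.of fun i j => p (![a₀, a₁, a₂, a₃, a₄] i) (![a₀, a₁, a₂, a₃, a₄] j))
        fun i j => hp _ (hxA i) _ (hxA j)
      rw [hdet] at this
      exact hnp this

/-- The level set is linearly independent. -/
theorem linearIndepOn_levelSet (hR : IsUnitRootSet R) (h : IsLevel R f lam) :
    LinearIndepOn ℝ id (levelSet R f lam) := by
  by_contra hcon
  obtain ⟨A, hAL, hA⟩ := exists_isCircuit (hR.finite.subset fun u hu => hu.1) hcon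
  exact not_isCircuit hR h hAL hA

end Independence

end DominantRegions

namespace DominantRegions

/-! ### From root systems to regions -/

section RootSystems

variable {V : Type*} [NormedAddCommGroup V] [InnerProductSpace ℝ V]
variable {Φ : Set V} {n : ℕ} {α : Module.Basis (Fin n) ℝ V}

/-- The unit vector in the direction of `β`. -/
noncomputable def unitVec (β : V) : V := ‖β‖⁻¹ • β

theorem inner_unitVec_self {β : V} (h : β ≠ 0) : ⟪unitVec β, unitVec β⟫ = 1 := by
  have hn : ‖β‖ ≠ 0 := norm_ne_zero_iff.2 h
  rw [unitVec, real_inner_smul_left, real_inner_smul_right, real_inner_self_eq_norm_sq]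
  field_simp

theorem refl_unitVec (β γ : V) : refl (unitVec β) (unitVec γ) =
    unitVec (((Submodule.span ℝ {β})ᗮ).reflection γ) := by
  have hn : ‖((Submodule.span ℝ {β})ᗮ).reflection γ‖ = ‖γ‖ := LinearIsometryEquiv.norm_map _ _
  simp only [unitVec, hn]
  simp only [Submodule.reflection_orthogonal_apply, Submodule.reflection_singleton_apply, refl, real_inner_smul_left, real_inner_smul_right,
    RCLike.ofReal_real_eq_id, id_eq, div_eq_mul_inv]
  rw [← inv_pow]
  module

theorem IsRootSystem.ne_zero (hΦ : IsRootSystem Φ) {β : V} (hβ : β ∈ Φ) : β ≠ 0 := by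
  rintro rfl
  exact hΦ.zero_notMem hβ

theorem IsRootSystem.norm_eq_of_unitVec_eq (hΦ : IsRootSystem Φ) {β γ : V} (hβ : β ∈ Φ)
    (hγ : γ ∈ Φ) (h : unitVec β = unitVec γ) : ‖β‖ = ‖γ‖ := by
  have hn : ‖β‖ ≠ 0 := norm_ne_zero_iff.2 (hΦ.ne_zero hβ)
  have h1 : β = (‖β‖ * ‖γ‖⁻¹) • γ := by
    rw [mul_smul]
    change β = ‖β‖ • unitVec γ
    rw [← h, unitVec, smul_smul, mul_inv_cancel₀ hn, one_smul]
  have h2 : β ∈ Φ ∩ (Submodule.span ℝ {γ} : Submodule ℝ V) :=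
    ⟨hβ, Submodule.mem_span_singleton.2 ⟨_, h1.symm⟩⟩
  rw [hΦ.inter_line γ hγ] at h2
  rcases h2 with rfl | h2
  · rfl
  · rw [Set.mem_singleton_iff.1 h2, norm_neg]

/-- For a root β, level one means (v | β/‖β‖) = ‖β‖⁻¹. Reducedness makes the length a function of
the direction; the value 0 elsewhere is immaterial. -/
theorem IsRootSystem.exists_lam (hΦ : IsRootSystem Φ) :
    ∃ lam : V → ℝ, ∀ β ∈ Φ, lam (unitVec β) = ‖β‖⁻¹ := by
  classical
  refine ⟨fun u => if h : ∃ β ∈ Φ, unitVec β = u then ‖h.choose‖⁻¹ else 0, fun β hβ => ?_⟩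
  have h : ∃ γ ∈ Φ, unitVec γ = unitVec β := ⟨β, hβ, rfl⟩
  simp only [dif_pos h]
  rw [hΦ.norm_eq_of_unitVec_eq h.choose_spec.1 hβ h.choose_spec.2]

theorem IsRootSystem.reflection_mem (hΦ : IsRootSystem Φ) {β γ : V} (hβ : β ∈ Φ) (hγ : γ ∈ Φ) :
    ((Submodule.span ℝ {β})ᗮ).reflection γ ∈ Φ := by
  rw [← hΦ.reflection_image β hβ]
  exact Set.mem_image_of_mem _ hγ

theorem IsRootSystem.isUnitRootSet (hΦ : IsRootSystem Φ) : IsUnitRootSet (unitVec '' Φ) where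
  finite := hΦ.finite.image _
  inner_self := by
    rintro _ ⟨β, hβ, rfl⟩
    exact inner_unitVec_self (hΦ.ne_zero hβ)
  refl_mem := by
    rintro _ ⟨β, hβ, rfl⟩ _ ⟨γ, hγ, rfl⟩
    rw [refl_unitVec]
    exact Set.mem_image_of_mem _ (hΦ.reflection_mem hβ hγ)

theorem inner_sum_smul_basis (v : V) (c : Fin n → ℝ) :
    ⟪v, ∑ i, c i • α i⟫ = ∑ i, c i * ⟪v, α i⟫ := by
  rw [inner_sum]
  exact Finset.sum_congr rfl fun i _ => real_inner_smul_right _ _ _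

theorem inner_pos_of_mem_chamber {v : V} (hv : v ∈ chamber α) {c : Fin n → ℝ} (hc : ∀ i, 0 ≤ c i)
    (h : ∑ i, c i • α i ≠ 0) : 0 < ⟪v, ∑ i, c i • α i⟫ := by
  rw [inner_sum_smul_basis]
  have hex : ∃ i, c i ≠ 0 := by
    by_contra! h0
    exact h (by simp [h0])
  obtain ⟨i, hi⟩ := hex
  exact Finset.sum_pos' (fun i _ => mul_nonneg (hc i) (hv i).le)
    ⟨i, Finset.mem_univ _, mul_pos (lt_of_le_of_ne (hc i) hi.symm) (hv i)⟩

theorem inner_ne_zero_of_mem_chamber (hΦ : IsRootSystem Φ) (hα : IsSimpleSystem Φ α) {v : V}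
    (hv : v ∈ chamber α) {β : V} (hβ : β ∈ Φ) : ⟪v, β⟫ ≠ 0 := by
  have h0 := hΦ.ne_zero hβ
  obtain ⟨c, rfl, hc | hc⟩ := hα.same_sign β hβ
  · exact (inner_pos_of_mem_chamber hv hc h0).ne'
  · have hneg : -∑ i, c i • α i = ∑ i, (-c i) • α i := by
      simp [neg_smul]
    have h1 := inner_pos_of_mem_chamber hv (c := fun i => -c i) (fun i => by linarith [hc i])
      (by rw [← hneg]; exact neg_ne_zero.2 h0)
    rw [← hneg, inner_neg_right] at h1
    linarith

/-- A root has coefficients of one sign, so a dominant point never pairs to zero with it;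
reflections preserve lengths. -/
theorem IsRootSystem.isLevel (hΦ : IsRootSystem Φ) (hα : IsSimpleSystem Φ α) {v : V}
    (hv : v ∈ chamber α) {lam : V → ℝ} (hlam : ∀ β ∈ Φ, lam (unitVec β) = ‖β‖⁻¹) :
    IsLevel (unitVec '' Φ) (innerₛₗ ℝ v) lam where
  ne_zero := by
    rintro _ ⟨β, hβ, rfl⟩
    change ⟪v, unitVec β⟫ ≠ 0
    rw [unitVec, real_inner_smul_right]
    exact mul_ne_zero (inv_ne_zero (norm_ne_zero_iff.2 (hΦ.ne_zero hβ)))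
      (inner_ne_zero_of_mem_chamber hΦ hα hv hβ)
  pos := by
    rintro _ ⟨β, hβ, rfl⟩
    rw [hlam β hβ]
    exact inv_pos.2 (norm_pos_iff.2 (hΦ.ne_zero hβ))
  lam_refl := by
    rintro _ ⟨β, hβ, rfl⟩ _ ⟨γ, hγ, rfl⟩
    rw [refl_unitVec, hlam _ (hΦ.reflection_mem hβ hγ), hlam γ hγ, LinearIsometryEquiv.norm_map]

/-- The positive roots of level one with respect to a point of the dominant chamber are linearly
independent. -/
theorem linearIndependent_vec (hΦ : IsRootSystem Φ) (hα : IsSimpleSystem Φ α) {v : V}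
    (hv : v ∈ chamber α) :
    LinearIndependent ℝ fun β : {β : PosRoot Φ α // ⟪v, β.vec⟫ = 1} => β.1.vec := by
  obtain ⟨lam, hlam⟩ := hΦ.exists_lam
  have hli := linearIndepOn_levelSet hΦ.isUnitRootSet (hΦ.isLevel hα hv hlam)
  have hmem : ∀ β : {β : PosRoot Φ α // ⟪v, β.vec⟫ = 1},
      unitVec β.1.vec ∈ levelSet (unitVec '' Φ) (innerₛₗ ℝ v) lam := by
    rintro ⟨β, hβ⟩
    refine ⟨⟨_, β.2.1, rfl⟩, ?_⟩
    refine Eq.trans ?_ (hlam _ β.2.1).symm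
    change ⟪v, unitVec β.vec⟫ = ‖β.vec‖⁻¹
    rw [unitVec, real_inner_smul_right, hβ, mul_one]
  have hinj : Function.Injective fun β : {β : PosRoot Φ α // ⟪v, β.vec⟫ = 1} =>
      (⟨unitVec β.1.vec, hmem β⟩ : levelSet (unitVec '' Φ) (innerₛₗ ℝ v) lam) := by
    intro β γ h
    have h1 : unitVec β.1.vec = unitVec γ.1.vec := congrArg Subtype.val h
    have h2 := hΦ.norm_eq_of_unitVec_eq β.1.2.1 γ.1.2.1 h1
    have h3 : ‖β.1.vec‖⁻¹ ≠ 0 := inv_ne_zero (norm_ne_zero_iff.2 (hΦ.ne_zero β.1.2.1))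
    apply Subtype.ext
    apply Subtype.ext
    have h4 : ‖β.1.vec‖⁻¹ • β.1.vec = ‖β.1.vec‖⁻¹ • γ.1.vec := by
      conv_rhs => rw [show ‖β.1.vec‖ = ‖γ.1.vec‖ from h2]
      exact h1
    exact smul_right_injective V h3 h4
  have h5 := (LinearIndepOn.linearIndependent hli).comp _ hinj
  have hn : ∀ β : {β : PosRoot Φ α // ⟪v, β.vec⟫ = 1}, ‖β.1.vec‖ ≠ 0 := fun β =>
    norm_ne_zero_iff.2 (hΦ.ne_zero β.1.2.1)
  -- Rescaling by the nonzero lengths passes from unit vectors back to the roots.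
  have h6 := h5.units_smul fun β => Units.mk0 _ (hn β)
  convert h6 using 1
  funext β
  change β.1.vec = ‖β.1.vec‖ • unitVec β.1.vec
  rw [unitVec, smul_smul, mul_inv_cancel₀ (hn β), one_smul]

/-- Inner products with linearly independent vectors can be prescribed. -/
theorem exists_inner_eq [FiniteDimensional ℝ V] {ι : Type*} {w : ι → V}
    (hw : LinearIndependent ℝ w) (t : ι → ℝ) : ∃ u : V, ∀ i, ⟪u, w i⟫ = t i := by
  obtain ⟨g, hg⟩ := LinearMap.exists_extend ((Module.Basis.span hw).constr ℝ t)
  refine ⟨(InnerProductSpace.toDual ℝ V).symm (LinearMap.toContinuousLinearMap g), fun i => ?_⟩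
  rw [InnerProductSpace.toDual_symm_apply]
  have h1 := (Module.Basis.span hw).constr_basis ℝ t i
  rw [← hg] at h1
  rw [← h1, LinearMap.comp_apply, Submodule.subtype_apply, Module.Basis.span_apply]
  rfl

theorem finite_posRoot (hΦ : IsRootSystem Φ) : Finite (PosRoot Φ α) := by
  have := hΦ.finite.to_subtype
  exact Finite.of_injective (fun β : PosRoot Φ α => (⟨β.1, β.2.1⟩ : Φ))
    fun β γ h => Subtype.ext (by simpa using h)

/-- The hyperplanes of level one through a point of the dominant chamber can be left on arbitrarily
chosen sides. -/
theorem region_nonempty (hΦ : IsRootSystem Φ) (hα : IsSimpleSystem Φ α) {v : V}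
    (hv : v ∈ chamber α) {K : Set (PosRoot Φ α)} (h₁ : ∀ β : PosRoot Φ α, 1 < ⟪v, β.vec⟫ → β ∈ K)
    (h₂ : ∀ β : PosRoot Φ α, ⟪v, β.vec⟫ < 1 → β ∉ K) : (region K).Nonempty := by
  classical
  have : FiniteDimensional ℝ V := Module.Finite.of_basis α
  have := finite_posRoot (α := α) hΦ
  -- The sign of ⟪u, β⟫ decides the side of the level-one hyperplane of β entered by v + εu; strict
  -- inequalities at v persist for small ε, and there are finitely many.
  obtain ⟨u, hu⟩ := exists_inner_eq (linearIndependent_vec hΦ hα hv)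
    fun β => if β.1 ∈ K then (1 : ℝ) else -1
  have hcont : ∀ w : V, Filter.Tendsto (fun ε : ℝ => ⟪v + ε • u, w⟫)
      (nhdsWithin 0 (Set.Ioi 0)) (nhds ⟪v, w⟫) := by
    intro w
    have : Continuous fun ε : ℝ => ⟪v + ε • u, w⟫ := by fun_prop
    have h := this.tendsto 0
    simp only [zero_smul, add_zero] at h
    exact h.mono_left nhdsWithin_le_nhds
  have e₀ : ∀ᶠ ε : ℝ in nhdsWithin 0 (Set.Ioi 0), ∀ i, 0 < ⟪v + ε • u, α i⟫ :=
    Filter.eventually_all.2 fun i => (hcont _).eventually (lt_mem_nhds (hv i))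
  have e₁ : ∀ᶠ ε : ℝ in nhdsWithin 0 (Set.Ioi 0), ∀ β : PosRoot Φ α,
      (β ∈ K → 1 < ⟪v + ε • u, β.vec⟫) ∧ (β ∉ K → ⟪v + ε • u, β.vec⟫ < 1) := by
    refine Filter.eventually_all.2 fun β => ?_
    rcases lt_trichotomy ⟪v, β.vec⟫ 1 with h | h | h
    · filter_upwards [(hcont β.vec).eventually (gt_mem_nhds h)] with ε hε
      exact ⟨fun hK => absurd hK (h₂ β h), fun _ => hε⟩
    · filter_upwards [self_mem_nhdsWithin] with ε hε
      have hε : 0 < ε := hε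
      have huβ := hu ⟨β, h⟩
      rw [inner_add_left, real_inner_smul_left, h, huβ]
      constructor
      · intro hK
        rw [if_pos hK]; linarith
      · intro hK
        rw [if_neg hK]; linarith
    · filter_upwards [(hcont β.vec).eventually (lt_mem_nhds h)] with ε hε
      exact ⟨fun _ => hε, fun hK => absurd (h₁ β h) hK⟩
  obtain ⟨ε, h0, h1⟩ := (e₀.and e₁).exists
  exact ⟨v + ε • u, h0, fun β hβ => (h1 β).1 hβ, fun β hβ => (h1 β).2 hβ⟩

theorem inner_vec_mono {v : V} (hv : v ∈ chamber α) {β γ : PosRoot Φ α} (h : β ≤ γ) :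
    ⟪v, β.vec⟫ ≤ ⟪v, γ.vec⟫ := by
  obtain ⟨c, hc, h⟩ := h
  rw [← sub_nonneg, ← inner_sub_right, h, inner_sum_smul_basis]
  exact Finset.sum_nonneg fun i _ => mul_nonneg (hc i) (hv i).le

theorem inner_vec_strictMono {v : V} (hv : v ∈ chamber α) {β γ : PosRoot Φ α} (h : β < γ) :
    ⟪v, β.vec⟫ < ⟪v, γ.vec⟫ := by
  obtain ⟨c, hc, h'⟩ := h.le
  rw [← sub_pos, ← inner_sub_right, h']
  refine inner_pos_of_mem_chamber hv hc fun h0 => h.ne ?_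
  rw [h0, sub_eq_zero] at h'
  exact Subtype.ext h'.symm

/-- An element comparable to nothing in Λ could be added to it. -/
theorem IsMaximalAntichain.exists_comparable {Λ : Set (PosRoot Φ α)} (h : IsMaximalAntichain Λ)
    (β : PosRoot Φ α) : ∃ γ ∈ Λ, β ≤ γ ∨ γ ≤ β := by
  by_contra! hcon
  have h1 : IsAntichain (· ≤ ·) (insert β Λ) :=
    h.prop.insert (fun γ hγ _ => (hcon γ hγ).2) fun γ hγ _ => (hcon γ hγ).1
  have h2 : β ∈ Λ := h.le_of_ge h1 (Set.subset_insert _ _) (Set.mem_insert _ _)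
  exact (hcon β h2).1 le_rfl

/-- Each root of I lies above a minimal one, so has value at least 1; each root outside lies below a
maximal one, so has value less than 1. The elements of Λ have value exactly 1 and may be put on the
lower side. -/
theorem region_diff_nonempty (hΦ : IsRootSystem Φ) (hα : IsSimpleSystem Φ α)
    {I : Set (PosRoot Φ α)} {v : V} (hv : v ∈ intC (minSet I))
    (hmax : ∀ γ ∈ maxCompl I, ⟪v, γ.vec⟫ < 1) {Λ : Set (PosRoot Φ α)} (hΛ : Λ ⊆ minSet I) :
    (region (I \ Λ)).Nonempty := by
  have := finite_posRoot (α := α) hΦ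
  refine region_nonempty hΦ hα hv.1 (fun β hβ => ⟨?_, fun h => ?_⟩) fun β hβ h => ?_
  · by_contra hI
    obtain ⟨γ, hβγ, hγ⟩ := exists_maximal_ge_of_wellFoundedGT (· ∈ Iᶜ) β hI
    linarith [inner_vec_mono hv.1 hβγ, hmax γ hγ]
  · linarith [hv.2 β (hΛ h)]
  · obtain ⟨γ, hγβ, hγ⟩ := exists_minimal_le_of_wellFoundedLT (· ∈ I) β h.1
    linarith [inner_vec_mono hv.1 hγβ, hv.2 γ hγ]

theorem region_union_nonempty (hΦ : IsRootSystem Φ) (hα : IsSimpleSystem Φ α)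
    {I : Set (PosRoot Φ α)} {v : V} (hv : v ∈ intC (maxCompl I))
    (hmin : ∀ β ∈ minSet I, 1 < ⟪v, β.vec⟫) {Λ : Set (PosRoot Φ α)} (hΛ : Λ ⊆ maxCompl I) :
    (region (I ∪ Λ)).Nonempty := by
  have := finite_posRoot (α := α) hΦ
  refine region_nonempty hΦ hα hv.1 (fun β hβ => Or.inl ?_) fun β hβ h => ?_
  · by_contra hI
    obtain ⟨γ, hβγ, hγ⟩ := exists_maximal_ge_of_wellFoundedGT (· ∈ Iᶜ) β hI
    linarith [inner_vec_mono hv.1 hβγ, hv.2 γ hγ]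
  · rcases h with h | h
    · obtain ⟨γ, hγβ, hγ⟩ := exists_minimal_le_of_wellFoundedLT (· ∈ I) β h
      linarith [inner_vec_mono hv.1 hγβ, hmin γ hγ]
    · linarith [hv.2 β (hΛ h)]

end RootSystems

end DominantRegions

/-! ### The theorem and its corollary -/

theorem theorem3p1 {V : Type*} [NormedAddCommGroup V] [InnerProductSpace ℝ V]
    (Φ : Set V) (hΦ : DominantRegions.IsRootSystem Φ)
    (n : ℕ) (α : Module.Basis (Fin n) ℝ V) (hα : DominantRegions.IsSimpleSystem Φ α)
    (I : Set (DominantRegions.PosRoot Φ α)) (hI : IsUpperSet I) (hne : I.Nonempty) :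
    ((∃ v₀ ∈ DominantRegions.intC (DominantRegions.minSet I),
        ∀ γ ∈ DominantRegions.maxCompl I, ⟪v₀, γ.vec⟫ < 1) →
      ∀ Λ ⊆ DominantRegions.minSet I, (DominantRegions.region (I \ Λ)).Nonempty) ∧
    ((∃ v₀ ∈ DominantRegions.intC (DominantRegions.maxCompl I),
        ∀ β ∈ DominantRegions.minSet I, 1 < ⟪v₀, β.vec⟫) →
      ∀ Λ ⊆ DominantRegions.maxCompl I, (DominantRegions.region (I ∪ Λ)).Nonempty) ∧
    (DominantRegions.IsMaximalAntichain (DominantRegions.minSet I) →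
      (DominantRegions.intC (DominantRegions.minSet I)).Nonempty →
      ∀ Λ ⊆ DominantRegions.minSet I, (DominantRegions.region (I \ Λ)).Nonempty) ∧
    (DominantRegions.IsMaximalAntichain (DominantRegions.maxCompl I) →
      (DominantRegions.intC (DominantRegions.maxCompl I)).Nonempty →
      ∀ Λ ⊆ DominantRegions.maxCompl I, (DominantRegions.region (I ∪ Λ)).Nonempty) := by
  refine ⟨?_, ?_, ?_, ?_⟩
  · rintro ⟨v, hv, hmax⟩ Λ hΛ
    exact DominantRegions.region_diff_nonempty hΦ hα hv hmax hΛ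
  · rintro ⟨v, hv, hmin⟩ Λ hΛ
    exact DominantRegions.region_union_nonempty hΦ hα hv hmin hΛ
  · rintro hanti ⟨v, hv⟩ Λ hΛ
    refine DominantRegions.region_diff_nonempty hΦ hα hv (fun γ hγ => ?_) hΛ
    -- A root outside the increasing set cannot lie above β in I, so it lies strictly below, and its
    -- value is strictly less than 1.
    obtain ⟨β, hβ, h | h⟩ := hanti.exists_comparable γ
    · have hne : γ ≠ β := fun e => hγ.prop (e ▸ hβ.prop)
      rw [← hv.2 β hβ]
      exact DominantRegions.inner_vec_strictMono hv.1 (lt_of_le_of_ne h hne)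
    · exact absurd (hI h hβ.prop) hγ.prop
  · rintro hanti ⟨v, hv⟩ Λ hΛ
    refine DominantRegions.region_union_nonempty hΦ hα hv (fun β hβ => ?_) hΛ
    obtain ⟨γ, hγ, h | h⟩ := hanti.exists_comparable β
    · exact absurd (hI h hβ.prop) hγ.prop
    · have hne : γ ≠ β := fun e => hγ.prop (e ▸ hβ.prop)
      rw [← hv.2 γ hγ]
      exact DominantRegions.inner_vec_strictMono hv.1 (lt_of_le_of_ne h hne)
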